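/- **Steep functions.** Let $V\subset\mathbb R^{n+1}$. A function $H$ is called $(g,m,C_1,\dots,C_n,\delta_1,\dots,\delta_n,\mathfrak a_1,\dots,\mathfrak a_n)$-steep on $V$ ($g,m,C_r,\delta_r>0$, $\mathfrak a_r\ge 1$) if it is smooth at the points of $V$, $|\nabla H|\ge g$ and $\|\partial^2H\|\le m$ on $V$ and, for every $I\in V$, every $1\le r\le n$, every $r$-dimensional linear subspace $L$ orthogonal to $\nabla H(I)$, and every $0<\xi\le\delta_r$, there is $\eta\in[0,\xi]$ such that $|\Pi_L\nabla H(I')|>C_r\,\xi^{\mathfrak a_r}$ for all $I'\in(I+L)\cap V$ with $|I'-I|=\eta$, where $\Pi_L$ is the orthogonal projection on $L$. **The system.** Consider the planar three-body problem with masses $\bar m_0,\mu\bar m_1,\mu\bar m_2$, and let $M_i=\bar m_0+\mu\bar m_i$, $m_i=\bar m_0\bar m_i/M_i$, $a_i=\frac1{M_i}(\Lambda_i/m_i)^2$ $(i=1,2)$ and $h_{\rm Kep}(\Lambda)=-\sum_{i=1}^2\frac{M_i^2m_i^3}{2\Lambda_i^2}$, $\omega_{\rm Kep}=\partial_\Lambda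 h_{\rm Kep}$. Let $$N=-\bar m_1\bar m_2\left(\Big\langle\frac1{|x^{(2)}|}\Big\rangle+\Big\langle\frac{3(x^{(1)}\cdot x^{(2)})^2-|x^{(1)}|^2|x^{(2)}|^2}{2|x^{(2)}|^5}\Big\rangle\right),$$ where $\langle\cdot\rangle$ is the average over both mean anomalies and $x^{(i)}$ moves on a Kepler ellipse with semi-major axis $a_i$ and eccentricity $e_i=\sqrt{1-(1-t_i/\Lambda_i)^2}$; it does not depend on the arguments of the perihelia. For fixed total angular momentum $G$ put $\varrho=\sqrt{2(\Lambda_1+\Lambda_2-G)}$ and let $\hat N(\Lambda,t)$ be the value of $N$ at $t_1=\frac{\varrho^2}2-t$, $t_2=t$. Fix $\bar m_0,\bar m_1,\bar m_2>0$, $0<a_-<a_+$, $0<\varrho_\star<\varepsilon_0$ with $\varepsilon_0^2/2<\bar m_1\sqrt{\bar m_0a_-}$ (so that $e_1<1$), $\bar M,s_0,\gamma_\star,\bar K_\star,C_\star>0$, $\tau>2$ and an integer $d\ge0$. For $\alpha_*,\mu,\varepsilon_1>0$ and $G\in\mathbb R$ put $$\bar K=\bar K_\star\log\varepsilon_1^{-1},\qquad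 \bar\gamma=\gamma_\star\sqrt[4]{\mu}\,\bar K^{\tau+1},\qquad \bar\rho=\frac{\bar\gamma}{2\bar M\bar K^{\tau+1}},\qquad \kappa=\frac{\mu\bar K^{2\tau+1}}{\bar\gamma^2},$$ let $\bar D$ be the set of $\Lambda\in(0,\infty)^2$ with $a_-<a_1<\alpha_*a_2<a_+$, $\varrho_\star\le\varrho<\varepsilon_0$ and $|\omega_{\rm Kep}\cdot k|\ge\bar\gamma/(\bar M\bar K^\tau)$ for all $k\in\mathbb Z^2$ with $0<|k|_1\le\bar K$, and let $V=\{(\Lambda,t):\Lambda\in\bar D,\ 0<t<\tfrac12(\varepsilon_1/8)^2\}\subset\mathbb R^3$. An *admissible correction* is a function $\hat N_*(\Lambda,t)=\sum_{k=0}^{d}c_k(\Lambda)\,t^k$ (a Birkhoff normal form) whose coefficients (Birkhoff invariants) are real-analytic on $\bar D$, with holomorphic extensions to the complex $\bar\rho/16$-neighbourhood of $\bar D$ that are bounded there by $C_\star(\kappa+\alpha_*^4)$. Such corrections are what averaging over the fast angles adds to $\hat N$ in the normal form of the reduced planar three-body Hamiltonian. **Claim.** There are positive numbers $\hat g,\hat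 m,\hat C_1,\hat C_2,\hat\delta_1,\hat\delta_2$ and $\hat{\mathfrak a}_1,\hat{\mathfrak a}_2\ge1$, independent of $\alpha_*,\mu,\varepsilon_1$ (and of $G$ and $\hat N_*$), and positive numbers $\bar\alpha,\bar\mu,\sigma$ such that, whenever $$0<\alpha_*<\bar\alpha,\qquad 0<\mu<\bar\mu,\qquad 0<\varepsilon_1\le\varrho_\star,\qquad \bar K>6/s_0,\qquad \kappa\le\sigma\,\alpha_*^{7/2},$$ then for every $G\in\mathbb R$ and every admissible correction $\hat N_*$ the function $$H_0(\Lambda_1,\Lambda_2,t)=h_{\rm Kep}(\Lambda)+\mu\big(\hat N+\hat N_*\big)(\Lambda,t)$$ is $(g,m,C_1,C_2,\delta_1,\delta_2,\mathfrak a_1,\mathfrak a_2)$-steep on $V$ with $$g=\hat g,\qquad m=\hat m,\qquad \mathfrak a_i=\hat{\mathfrak a}_i,\qquad \delta_i=\min\{\sqrt{\alpha_*},\varepsilon_1^2\}\,\hat\delta_i,\qquad C_i=\mu\,\alpha_*^2\,\hat C_i .$$ -/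

import Mathlib

open scoped ContDiff

noncomputable section

namespace PlanarThreeBody

/-! ## Steep functions -/

/-- `H` is `(g, m, C₁, …, Cₙ, δ₁, …, δₙ, a₁, …, aₙ)`-steep on a set `V` of `ℝⁿ⁺¹`: it is smooth at
the points of `V`, its gradient has length at least `g` and its Hessian operator norm at most `m`
on `V`, and for every `I` in `V` and every linear subspace `L` of dimension `r`, `1 ≤ r ≤ n`,
orthogonal to the gradient of `H` at `I`,
`max_{0 ≤ η ≤ ξ} min_{I' ∈ (I + L) ∩ V, |I' - I| = η} |grad (H restricted to I + L) (I')| > C_r ξ ^ a_r`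
for all `0 < ξ ≤ δ_r`. The index `r` is `j + 1` with `j : Fin n`. -/
structure IsSteepOn {n : ℕ} (H : EuclideanSpace ℝ (Fin (n + 1)) → ℝ)
    (V : Set (EuclideanSpace ℝ (Fin (n + 1)))) (g m : ℝ) (C δ a : Fin n → ℝ) : Prop where
  g_pos : 0 < g
  m_pos : 0 < m
  C_pos : ∀ j, 0 < C j
  δ_pos : ∀ j, 0 < δ j
  one_le_a : ∀ j, 1 ≤ a j
  smooth : ∀ I ∈ V, ContDiffAt ℝ ∞ H I
  le_grad : ∀ I ∈ V, g ≤ ‖gradient H I‖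
  hess_le : ∀ I ∈ V, ‖fderiv ℝ (gradient H) I‖ ≤ m
  steep : ∀ I ∈ V, ∀ j : Fin n, ∀ L : Submodule ℝ (EuclideanSpace ℝ (Fin (n + 1))),
    Module.finrank ℝ L = (j : ℕ) + 1 → (∀ v ∈ L, inner ℝ (gradient H I) v = 0) →
    ∀ ξ : ℝ, 0 < ξ → ξ ≤ δ j → ∃ η : ℝ, 0 ≤ η ∧ η ≤ ξ ∧
      ∀ I' ∈ V, I' - I ∈ L → ‖I' - I‖ = η → C j * ξ ^ a j < ‖L.starProjection (gradient H I')‖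

/-! ## Masses, Kepler part, orbits

`mb 0` is the mass of the star, `μ * mb 1` and `μ * mb 2` those of the planets. The planets are
indexed by `Fin 2`, planet `i : Fin 2` having mass parameter `mb i.succ`; planet `0` is the inner
one. -/

/-- The auxiliary mass `M_i = m̄₀ + μ m̄_i`. -/
def bigMass (mb : Fin 3 → ℝ) (μ : ℝ) (i : Fin 2) : ℝ := mb 0 + μ * mb i.succ

/-- The reduced mass `m_i = m̄₀ m̄_i / (m̄₀ + μ m̄_i)`. -/
def redMass (mb : Fin 3 → ℝ) (μ : ℝ) (i : Fin 2) : ℝ :=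
  mb 0 * mb i.succ / (mb 0 + μ * mb i.succ)

/-- The semi-major axis `a_i = (Λ_i / m_i)² / M_i`. -/
def semiAxis (mb : Fin 3 → ℝ) (μ : ℝ) (Λ : Fin 2 → ℝ) (i : Fin 2) : ℝ :=
  (Λ i / redMass mb μ i) ^ 2 / bigMass mb μ i

/-- The Keplerian Hamiltonian `h_Kep = - ∑ M_i² m_i³ / (2 Λ_i²)`. -/
def hKep (mb : Fin 3 → ℝ) (μ : ℝ) (Λ : Fin 2 → ℝ) : ℝ :=
  -∑ i, bigMass mb μ i ^ 2 * redMass mb μ i ^ 3 / (2 * Λ i ^ 2)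

/-- The Keplerian frequencies `∂ h_Kep / ∂ Λ_i = M_i² m_i³ / Λ_i³`. -/
def freqKep (mb : Fin 3 → ℝ) (μ : ℝ) (Λ : Fin 2 → ℝ) (i : Fin 2) : ℝ :=
  bigMass mb μ i ^ 2 * redMass mb μ i ^ 3 / Λ i ^ 3

/-- Eccentricity of the ellipse with action `Λ` and secular action `t = (η² + ξ²) / 2`, where
`t = Λ - Λ √(1 - e²)`. -/
def eccentricity (Λ t : ℝ) : ℝ := √(1 - (1 - t / Λ) ^ 2)

/-- The point of eccentric anomaly `E` on the Kepler ellipse in the plane `ℂ` with a focus at the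
origin, semi-major axis `a`, eccentricity `e` and argument of the perihelion `ϖ`. -/
def orbit (a e ϖ E : ℝ) : ℂ :=
  Complex.exp (ϖ * Complex.I) *
    (((a * (Real.cos E - e) : ℝ) : ℂ) + ((a * √(1 - e ^ 2) * Real.sin E : ℝ) : ℂ) * Complex.I)

/-- The average over the mean anomaly `ℓ = E - e sin E`, written with the eccentric anomaly `E`
as integration variable, `dℓ = (1 - e cos E) dE`. -/
def meanAverage (e : ℝ) (F : ℝ → ℝ) : ℝ :=
  (1 / (2 * Real.pi)) * ∫ E in (0 : ℝ)..(2 * Real.pi), F E * (1 - e * Real.cos E)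

/-! ## The secular function and its reduction -/

/-- Zeroth term of the expansion in the ratio of the semi-axes of the doubly averaged inverse
distance: the average of `1 / |x⁽²⁾|`. -/
def secular0 (a₂ e₂ ϖ₂ : ℝ) : ℝ := meanAverage e₂ fun E₂ => 1 / ‖orbit a₂ e₂ ϖ₂ E₂‖

/-- Second term of this expansion: the double average of
`(3 (x⁽¹⁾ · x⁽²⁾)² - |x⁽¹⁾|² |x⁽²⁾|²) / (2 |x⁽²⁾|⁵)`. -/
def secular2 (a₁ e₁ ϖ₁ a₂ e₂ ϖ₂ : ℝ) : ℝ :=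
  meanAverage e₁ fun E₁ => meanAverage e₂ fun E₂ =>
    (3 * (inner ℝ (orbit a₁ e₁ ϖ₁ E₁) (orbit a₂ e₂ ϖ₂ E₂)) ^ 2
      - ‖orbit a₁ e₁ ϖ₁ E₁‖ ^ 2 * ‖orbit a₂ e₂ ϖ₂ E₂‖ ^ 2) / (2 * ‖orbit a₂ e₂ ϖ₂ E₂‖ ^ 5)

/-- The secular function `N = - m̄₁ m̄₂ (f⁽⁰⁾ + f⁽²⁾)` of the planar problem, at actions `Λ`, secular
actions `t₁`, `t₂` and arguments of the perihelia `ϖ₁`, `ϖ₂`. -/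
def secularN (mb : Fin 3 → ℝ) (μ : ℝ) (Λ : Fin 2 → ℝ) (t₁ t₂ ϖ₁ ϖ₂ : ℝ) : ℝ :=
  -(mb 1 * mb 2) *
    (secular0 (semiAxis mb μ Λ 1) (eccentricity (Λ 1) t₂) ϖ₂
      + secular2 (semiAxis mb μ Λ 0) (eccentricity (Λ 0) t₁) ϖ₁
          (semiAxis mb μ Λ 1) (eccentricity (Λ 1) t₂) ϖ₂)

/-- `N̂`: the secular function after the reduction of rotations, at total angular momentum `G`. The
inner secular action is eliminated by `t₁ + t₂ = ϱ² / 2 = Λ₁ + Λ₂ - G`, the frame is rotated so that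
the perihelion of the inner planet lies on the first axis, and `ψ` is the argument of the other
perihelion. (The value does not depend on `ψ`.) -/
def Nhat (mb : Fin 3 → ℝ) (μ G ψ : ℝ) (Λ : Fin 2 → ℝ) (t : ℝ) : ℝ :=
  secularN mb μ Λ (Λ 0 + Λ 1 - G - t) t 0 ψ

/-! ## The domain -/

/-- The set `𝒜_G` of the actions with `a₋ < a₁ < α a₂ < a₊` and `ϱ_⋆ ≤ ϱ < ε₀`, where
`ϱ² = 2 (Λ₁ + Λ₂ - G)`. -/
def setAG (mb : Fin 3 → ℝ) (μ am ap ρs ε₀ α G : ℝ) : Set (Fin 2 → ℝ) :=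
  {Λ | (∀ i, 0 < Λ i) ∧ am < semiAxis mb μ Λ 0 ∧ semiAxis mb μ Λ 0 < α * semiAxis mb μ Λ 1 ∧
    α * semiAxis mb μ Λ 1 < ap ∧
    ρs ≤ √(2 * (Λ 0 + Λ 1 - G)) ∧ √(2 * (Λ 0 + Λ 1 - G)) < ε₀}

/-- The cut-off `K̄ = K_⋆ log (1 / ε₁)`. -/
def cutoff (Ks ε₁ : ℝ) : ℝ := Ks * Real.log ε₁⁻¹

/-- `γ̄ = γ_⋆ μ^(1/4) K̄^(τ+1)`. -/
def gammaBar (γs τ μ K : ℝ) : ℝ := γs * μ ^ (1 / 4 : ℝ) * K ^ (τ + 1)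

/-- `ρ̄ = γ̄ / (2 M̄ K̄^(τ+1))`. -/
def rhoBar (Mb γs τ μ K : ℝ) : ℝ := gammaBar γs τ μ K / (2 * Mb * K ^ (τ + 1))

/-- The set `D̄` of the `Λ ∈ 𝒜_G` with `|ω_Kep · k| ≥ γ̄ / (M̄ K̄^τ)` for all integer vectors `k` with
`0 < |k|₁ ≤ K̄`. -/
def setD (A : Set (Fin 2 → ℝ)) (mb : Fin 3 → ℝ) (Mb γs τ μ K : ℝ) : Set (Fin 2 → ℝ) :=
  {Λ | Λ ∈ A ∧ ∀ k : Fin 2 → ℤ, k ≠ 0 → ∑ i, |(k i : ℝ)| ≤ K →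
    gammaBar γs τ μ K / (Mb * K ^ τ) ≤ |∑ i, freqKep mb μ Λ i * (k i : ℝ)|}

/-- The complex neighbourhood of radius `r` of a set of real vectors. -/
def complexNhd (D : Set (Fin 2 → ℝ)) (r : ℝ) : Set (Fin 2 → ℂ) :=
  {w | ∃ Λ ∈ D, ∀ i, ‖w i - (Λ i : ℂ)‖ < r}

/-- The set of the action vectors `(Λ₁, Λ₂, t)` with `Λ ∈ D` and `t = |z|² / 2`, `0 < |z| < ε₁ / 8`. -/
def actionDomain (D : Set (Fin 2 → ℝ)) (ε₁ : ℝ) : Set (EuclideanSpace ℝ (Fin 3)) :=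
  {I | ![I 0, I 1] ∈ D ∧ 0 < I 2 ∧ I 2 < (ε₁ / 8) ^ 2 / 2}

/-! ## The integrable part -/

/-- The correction `N̂_⋆(Λ, t) = ∑_{k ≤ d} c_k(Λ) t^k`, in Birkhoff normal form with Birkhoff
invariants `c_k`. -/
def Nstar (d : ℕ) (c : ℕ → (Fin 2 → ℂ) → ℂ) (Λ : Fin 2 → ℝ) (t : ℝ) : ℝ :=
  ∑ k ∈ Finset.range (d + 1), (c k fun i => (Λ i : ℂ)).re * t ^ k

/-- The Birkhoff invariants `c_0, …, c_d` are holomorphic on the complex neighbourhood of radius `r`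
of `D`, real at real points, and bounded there by `b`. -/
structure IsSmallNormalForm (D : Set (Fin 2 → ℝ)) (r b : ℝ) (d : ℕ)
    (c : ℕ → (Fin 2 → ℂ) → ℂ) : Prop where
  analytic : ∀ k ≤ d, AnalyticOnNhd ℂ (c k) (complexNhd D r)
  real : ∀ k ≤ d, ∀ Λ : Fin 2 → ℝ, (fun i => (Λ i : ℂ)) ∈ complexNhd D r →
    (c k fun i => (Λ i : ℂ)).im = 0
  bound : ∀ k ≤ d, ∀ w ∈ complexNhd D r, ‖c k w‖ ≤ b

/-- `H₀ = h_Kep + μ (N̂ + N̂_⋆)` as a function of the three actions `(Λ₁, Λ₂, t)`. -/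
def H0 (mb : Fin 3 → ℝ) (μ G ψ : ℝ) (d : ℕ) (c : ℕ → (Fin 2 → ℂ) → ℂ)
    (I : EuclideanSpace ℝ (Fin 3)) : ℝ :=
  hKep mb μ ![I 0, I 1] +
    μ * (Nhat mb μ G ψ ![I 0, I 1] (I 2) + Nstar d c ![I 0, I 1] (I 2))

end PlanarThreeBody

end

namespace PlanarThreeBody

/-! ### Averages over a Kepler ellipse -/

/-! Write `b` for the square root of `α` and `ν` for the fourth root of `μ`. On the domain the inner
action is of order 1, the outer one of order `1/b`, and the Birkhoff invariants extend to a polydisc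
of radius `q * ν` in the Λ-variables. The averages are computed in closed form. The monopole is a
multiple of `1/Λ₂²` and is absorbed into the outer Kepler term (`coefA₁`). The quadrupole becomes
the rational function `secN2`, of size `b^6`; its second derivative in `t` is at least a constant
times `b^6`, and its third is of exact order `b^7` (`quadD2_bounds`, `quadD3_bounds`). The
hypothesis on κ makes the correction at most a small multiple of `b^7`, so by Cauchy estimates it
spoils neither derivative.

Let `v` be orthogonal to the gradient at `I`. The inner frequency is of order 1, the outer one of
order `b^3` and the perturbation small, so `v 0` is negligible against `v 1` and `v 2`. Along such
directions the gradient increment at `J` is, up to errors, the sum of a concave Kepler form in `J 1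
- I 1`, at least of order `b^4`, and a convex secular form in `J 2 - I 2`, of order `ν^4 b^6`. The
signs are opposite.

For planes (`steep_two`) the plane projects isomorphically onto the last two coordinates, so it
contains the vector with components `-(J 1 - I 1)` and `J 2 - I 2`. Tested against it, the two forms
add up, and the projected gradient is bounded below at distance exactly `ξ`.

For lines there is no such freedom and the forms may cancel. If the direction has a large enough
component `v 1`, Kepler wins (`steep_one_of_le`). Otherwise the direction is almost the `t`-axis and
the gradient along it is `s * Q + s ^ 2 * R` with `|R|` of order `ν^4 b^7`, because of the third
derivative in `t` (`exists_resonant_expansion`). Whatever `Q` is, such an expression is of order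
`ν^4 b^7 ξ^2` at one of two radii (`exists_radius`).

As `ξ ≤ b ≤ 1`, the bounds `ν^4 b^6 ξ` and `ν^4 b^7 ξ^2` both dominate `ν^4 b^4 ξ^5 = μ α^2 ξ^5`:
hence the common exponent 5.

Non-resonance conditions cut strips out of the domain, so `V` need not be convex and mean values
along segments are not available. Kepler increments are therefore factored algebraically, Lipschitz
bounds are proved between arbitrary points of `V`, and Taylor expansions of holomorphic functions
come from Schwarz lemmas on complex discs around one point. -/

lemma one_sub_mul_cos_pos {e : ℝ} (he0 : 0 ≤ e) (he1 : e < 1) (E : ℝ) : 0 < 1 - e * Real.cos E := by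
  nlinarith [Real.cos_le_one E]

/-- The true anomaly as a smooth function of the eccentric anomaly. -/
lemma exists_trueAnomaly {e : ℝ} (he0 : 0 ≤ e) (he1 : e < 1) :
    ∃ f : ℝ → ℝ, (∀ E, HasDerivAt f (√(1 - e ^ 2) / (1 - e * Real.cos E)) E) ∧
      f (2 * Real.pi) - f 0 = 2 * Real.pi := by
  set s := √(1 - e ^ 2) with hs
  have hs2 : s ^ 2 = 1 - e ^ 2 := Real.sq_sqrt (by nlinarith)
  have hs0 : 0 < s := Real.sqrt_pos.2 (by nlinarith)
  set β := e / (1 + s) with hβ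
  have h1 : β * (1 + s) = e := by rw [hβ]; field_simp
  have h2 : β ^ 2 * (1 + s) = 1 - s := by
    have : (1 + s) * (β ^ 2 * (1 + s)) = (1 + s) * (1 - s) := by
      linear_combination (β * (1 + s) + e) * h1 + hs2
    exact mul_left_cancel₀ (by positivity) this
  have hβ0 : 0 ≤ β := by positivity
  have hβ1 : β < 1 := by
    rw [hβ, div_lt_one (by positivity)]; linarith
  -- This form of the true anomaly has no branch jumps: `0 ≤ β < 1` keeps the denominator positive,
  -- and the arctangent term is periodic, so one turn adds exactly `2π`.
  refine ⟨fun E => E + 2 * Real.arctan (β * Real.sin E / (1 - β * Real.cos E)), fun E => ?_, ?_⟩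
  · have hD := one_sub_mul_cos_pos hβ0 hβ1 E
    have hD' := one_sub_mul_cos_pos he0 he1 E
    have hq : HasDerivAt (fun E => β * Real.sin E / (1 - β * Real.cos E))
        ((β * Real.cos E * (1 - β * Real.cos E) - β * Real.sin E * (-(β * -Real.sin E)))
          / (1 - β * Real.cos E) ^ 2) E := by
      refine ((Real.hasDerivAt_sin E).const_mul β).div ?_ hD.ne'
      simpa using ((Real.hasDerivAt_cos E).const_mul β).const_sub 1
    refine ((hasDerivAt_id E).add ((hq.arctan).const_mul 2)).congr_deriv ?_
    have hsc := Real.sin_sq_add_cos_sq E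
    have e1 : e * (1 + β ^ 2) = 2 * β := by linear_combination (-1 - β ^ 2) * h1 + β * h2
    have e2 : s * (1 + β ^ 2) = 1 - β ^ 2 := by linear_combination h2
    have h3 : 1 + (β * Real.sin E / (1 - β * Real.cos E)) ^ 2
        = (1 - 2 * β * Real.cos E + β ^ 2) / (1 - β * Real.cos E) ^ 2 := by
      rw [eq_div_iff (by positivity), add_mul, div_pow, div_mul_cancel₀ _ (by positivity)]
      linear_combination β ^ 2 * hsc
    have h4 : 0 < 1 - 2 * β * Real.cos E + β ^ 2 := by
      have : 0 < (1 - β * Real.cos E) ^ 2 := by positivity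
      nlinarith [sq_nonneg (β * Real.sin E)]
    have h5 : β * Real.cos E * (1 - β * Real.cos E) - β * Real.sin E * (-(β * -Real.sin E))
        = β * Real.cos E - β ^ 2 := by linear_combination -β ^ 2 * hsc
    have h6 : ∀ Q N W : ℝ, Q ≠ 0 → Q / N * (W / Q) = W / N := fun Q N W hQ => by field_simp
    rw [h3, h5, one_div_div, h6 _ _ _ (by positivity), mul_div_assoc',
      one_add_div h4.ne', div_eq_div_iff h4.ne' hD'.ne']
    have hb : (1 + β ^ 2) ≠ 0 := by positivity
    refine mul_left_cancel₀ hb ?_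
    linear_combination -(1 - 2 * β * Real.cos E + β ^ 2) * e2 - (1 - β ^ 2) * Real.cos E * e1
  · simp


/-- The two quotients here and in the next lemma are the cosine and sine of the true anomaly `f`.
Their derivatives are recorded as `-sin f · f'` and `cos f · f'`, which spares any trigonometry with
the arctangent formula. -/
lemma hasDerivAt_cos_trueAnomaly {e : ℝ} (he0 : 0 ≤ e) (he1 : e < 1) (E : ℝ) :
    HasDerivAt (fun E => (Real.cos E - e) / (1 - e * Real.cos E))
      (-(√(1 - e ^ 2) * Real.sin E / (1 - e * Real.cos E))
        * (√(1 - e ^ 2) / (1 - e * Real.cos E))) E := by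
  have hs2 : √(1 - e ^ 2) ^ 2 = 1 - e ^ 2 := Real.sq_sqrt (by nlinarith)
  have hD := one_sub_mul_cos_pos he0 he1 E
  have h := ((Real.hasDerivAt_cos E).sub_const e).div
    (((Real.hasDerivAt_cos E).const_mul e).const_sub 1) hD.ne'
  refine h.congr_deriv ?_
  field_simp
  linear_combination Real.sin E * hs2

lemma hasDerivAt_sin_trueAnomaly {e : ℝ} (he0 : 0 ≤ e) (he1 : e < 1) (E : ℝ) :
    HasDerivAt (fun E => √(1 - e ^ 2) * Real.sin E / (1 - e * Real.cos E))
      ((Real.cos E - e) / (1 - e * Real.cos E) * (√(1 - e ^ 2) / (1 - e * Real.cos E))) E := by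
  have hD := one_sub_mul_cos_pos he0 he1 E
  have h := ((Real.hasDerivAt_sin E).const_mul √(1 - e ^ 2)).div
    (((Real.hasDerivAt_cos E).const_mul e).const_sub 1) hD.ne'
  refine h.congr_deriv ?_
  have hsc := Real.sin_sq_add_cos_sq E
  field_simp
  linear_combination (-e * √(1 - e ^ 2)) * hsc

/-- The quadrupole integral over the outer orbit. -/
lemma integral_quadrupole {e : ℝ} (he0 : 0 ≤ e) (he1 : e < 1) (A B : ℝ) :
    ∫ E in (0 : ℝ)..(2 * Real.pi),
      (3 * ((Real.cos E - e) * A + √(1 - e ^ 2) * Real.sin E * B) ^ 2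
        - (A ^ 2 + B ^ 2) * (1 - e * Real.cos E) ^ 2) / (1 - e * Real.cos E) ^ 4
      = (A ^ 2 + B ^ 2) * Real.pi / √(1 - e ^ 2) ^ 3 := by
  obtain ⟨f, hf, hf2⟩ := exists_trueAnomaly he0 he1
  have hs2 : √(1 - e ^ 2) ^ 2 = 1 - e ^ 2 := Real.sq_sqrt (by nlinarith)
  have hs0 : 0 < √(1 - e ^ 2) := Real.sqrt_pos.2 (by nlinarith)
  have hC := hasDerivAt_cos_trueAnomaly he0 he1
  have hS := hasDerivAt_sin_trueAnomaly he0 he1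
  set s := √(1 - e ^ 2)
  set C : ℝ → ℝ := fun E => (Real.cos E - e) / (1 - e * Real.cos E) with hCd
  set S : ℝ → ℝ := fun E => s * Real.sin E / (1 - e * Real.cos E) with hSd
  have hder : ∀ E, HasDerivAt (fun E => (1 / s ^ 3) *
      (3 * (A ^ 2 * ((f E + S E * C E) / 2 + e * (S E - S E ^ 3 / 3))
        + B ^ 2 * ((f E - S E * C E) / 2 + e * (S E ^ 3 / 3))
        + 2 * A * B * (S E ^ 2 / 2 - e * (C E ^ 3 / 3))) - (A ^ 2 + B ^ 2) * (f E + e * S E)))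
      ((3 * ((Real.cos E - e) * A + s * Real.sin E * B) ^ 2
        - (A ^ 2 + B ^ 2) * (1 - e * Real.cos E) ^ 2) / (1 - e * Real.cos E) ^ 4) E := by
    intro E
    have hD := one_sub_mul_cos_pos he0 he1 E
    have hCS : S E ^ 2 + C E ^ 2 = 1 := by
      simp only [hCd, hSd]
      have hsc := Real.sin_sq_add_cos_sq E
      field_simp
      linear_combination Real.sin E ^ 2 * hs2 + (1 - e ^ 2) * hsc
    have h1 := (((hf E).add ((hS E).mul (hC E))).div_const 2).add
      (((hS E).sub (((hS E).pow 3).div_const 3)).const_mul e)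
    have h2 := (((hf E).sub ((hS E).mul (hC E))).div_const 2).add
      ((((hS E).pow 3).div_const 3).const_mul e)
    have h3 := (((hS E).pow 2).div_const 2).sub ((((hC E).pow 3).div_const 3).const_mul e)
    have h4 := ((hf E).add ((hS E).const_mul e)).const_mul (A ^ 2 + B ^ 2)
    have h := (((((h1.const_mul (A ^ 2)).add (h2.const_mul (B ^ 2))).add
      (h3.const_mul (2 * A * B))).const_mul 3).sub h4).const_mul (1 / s ^ 3)
    refine h.congr_deriv ?_
    have e1 : Real.cos E - e = C E * (1 - e * Real.cos E) := (div_mul_cancel₀ _ hD.ne').symm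
    have e2 : s * Real.sin E = S E * (1 - e * Real.cos E) := (div_mul_cancel₀ _ hD.ne').symm
    -- The orbit equation `r (1 + e cos f) = a (1 - e²)`. It turns the integrand into `s⁻³ (3 (A cos
    -- f + B sin f)² - (A² + B²)) (1 + e cos f) df`, a trigonometric polynomial in `f`.
    have e3 : (1 - e * Real.cos E) * (1 + e * C E) = s ^ 2 := by
      rw [hs2]; linear_combination -e * e1
    change 1 / s ^ 3 * (3 * (A ^ 2 * ((s / (1 - e * Real.cos E)
        + (C E * (s / (1 - e * Real.cos E)) * C E
          + S E * (-(S E) * (s / (1 - e * Real.cos E))))) / 2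
        + e * (C E * (s / (1 - e * Real.cos E))
          - (3 : ℕ) * S E ^ (3 - 1) * (C E * (s / (1 - e * Real.cos E))) / 3))
        + B ^ 2 * ((s / (1 - e * Real.cos E)
        - (C E * (s / (1 - e * Real.cos E)) * C E
          + S E * (-(S E) * (s / (1 - e * Real.cos E))))) / 2
        + e * ((3 : ℕ) * S E ^ (3 - 1) * (C E * (s / (1 - e * Real.cos E))) / 3))
        + 2 * A * B * ((2 : ℕ) * S E ^ (2 - 1) * (C E * (s / (1 - e * Real.cos E))) / 2
        - e * ((3 : ℕ) * C E ^ (3 - 1) * (-(S E) * (s / (1 - e * Real.cos E))) / 3)))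
        - (A ^ 2 + B ^ 2) * (s / (1 - e * Real.cos E)
          + e * (C E * (s / (1 - e * Real.cos E))))) = _
    clear h h1 h2 h3 h4
    rw [e1, e2]
    generalize 1 - e * Real.cos E = D at *
    generalize C E = c at *
    generalize S E = σ at *
    have e4 : (3 * (c * D * A + σ * D * B) ^ 2 - (A ^ 2 + B ^ 2) * D ^ 2) / D ^ 4
        = (3 * (c * A + σ * B) ^ 2 - (A ^ 2 + B ^ 2)) * (1 + e * c) / (D * s ^ 2) := by
      have : 1 + e * c ≠ 0 := fun h0 => by
        rw [h0, mul_zero] at e3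
        exact (pow_pos hs0 2).ne e3
      rw [← e3, div_eq_div_iff (by positivity)
        (mul_ne_zero hD.ne' (mul_ne_zero hD.ne' this))]
      ring
    rw [e4]
    push_cast
    have hσ : σ ^ 2 = 1 - c ^ 2 := by linarith
    have : s / D * s ^ 2 = s ^ 3 * (1 / D) := by ring
    field_simp
    linear_combination -(3 * A ^ 2 + 3 * B ^ 2 + 6 * A ^ 2 * c * e) * hσ
  have hcont : Continuous fun E : ℝ => (3 * ((Real.cos E - e) * A + s * Real.sin E * B) ^ 2
      - (A ^ 2 + B ^ 2) * (1 - e * Real.cos E) ^ 2) / (1 - e * Real.cos E) ^ 4 :=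
    Continuous.div (by fun_prop) (by fun_prop)
      fun E => (pow_pos (one_sub_mul_cos_pos he0 he1 E) 4).ne'
  rw [intervalIntegral.integral_eq_sub_of_hasDerivAt (fun E _ => hder E)
    (hcont.intervalIntegrable _ _)]
  -- `C` and `S` return to their initial values, so only the terms proportional to `f` survive;
  -- their coefficient is `(A² + B²) / 2`.
  simp only [hCd, hSd, Real.sin_two_pi, Real.cos_two_pi, Real.sin_zero, Real.cos_zero]
  field_simp
  linear_combination (A ^ 2 + B ^ 2) * hf2

lemma norm_orbit {a e : ℝ} (ha : 0 ≤ a) (he0 : 0 ≤ e) (he1 : e < 1) (ϖ E : ℝ) :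
    ‖orbit a e ϖ E‖ = a * (1 - e * Real.cos E) := by
  have hs2 : √(1 - e ^ 2) ^ 2 = 1 - e ^ 2 := Real.sq_sqrt (by nlinarith)
  have hD := one_sub_mul_cos_pos he0 he1 E
  have hsc := Real.sin_sq_add_cos_sq E
  rw [orbit, norm_mul, Complex.norm_exp_ofReal_mul_I, one_mul, Complex.norm_add_mul_I,
    Real.sqrt_eq_iff_mul_self_eq (by positivity) (by positivity)]
  linear_combination a ^ 2 * Real.sin E ^ 2 * hs2 + a ^ 2 * (1 - e ^ 2) * hsc

/-- `A` and `B` are the coordinates of `z` in the frame of the perihelion. The averages see them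
only through `A² + B²`. -/
lemma inner_orbit (z : ℂ) (a e ϖ : ℝ) :
    ∃ A B : ℝ, A ^ 2 + B ^ 2 = ‖z‖ ^ 2 ∧ ∀ E, inner ℝ z (orbit a e ϖ E)
      = a * ((Real.cos E - e) * A + √(1 - e ^ 2) * Real.sin E * B) := by
  refine ⟨((starRingEnd ℂ) z * Complex.exp (ϖ * Complex.I)).re,
    -((starRingEnd ℂ) z * Complex.exp (ϖ * Complex.I)).im, ?_, fun E => ?_⟩
  · have h : ‖(starRingEnd ℂ) z * Complex.exp (ϖ * Complex.I)‖ = ‖z‖ := by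
      rw [norm_mul, Complex.norm_exp_ofReal_mul_I, mul_one, RCLike.norm_conj]
    rw [← h, ← Complex.normSq_eq_norm_sq, Complex.normSq_apply]
    ring
  · rw [Complex.inner, orbit, mul_comm, ← mul_assoc, Complex.mul_re]
    simp only [Complex.add_re, Complex.add_im, Complex.ofReal_re, Complex.ofReal_im,
      Complex.mul_re, Complex.mul_im, Complex.I_re, Complex.I_im]
    ring

lemma secular0_eq {a e : ℝ} (ha : 0 < a) (he0 : 0 ≤ e) (he1 : e < 1) (ϖ : ℝ) :
    secular0 a e ϖ = 1 / a := by
  have h : ∀ E : ℝ, 1 / ‖orbit a e ϖ E‖ * (1 - e * Real.cos E) = 1 / a := fun E => by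
    have hD := one_sub_mul_cos_pos he0 he1 E
    rw [norm_orbit ha.le he0 he1]
    field_simp
  simp only [secular0, meanAverage, h, intervalIntegral.integral_const, smul_eq_mul]
  field_simp
  ring

/-- Only the modulus of `z` remains after the outer average, which is why the secular function does
not depend on the perihelia. -/
lemma meanAverage_quadrupole {a e : ℝ} (ha : 0 < a) (he0 : 0 ≤ e) (he1 : e < 1) (ϖ : ℝ) (z : ℂ) :
    (meanAverage e fun E => (3 * (inner ℝ z (orbit a e ϖ E)) ^ 2
      - ‖z‖ ^ 2 * ‖orbit a e ϖ E‖ ^ 2) / (2 * ‖orbit a e ϖ E‖ ^ 5))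
      = ‖z‖ ^ 2 / (4 * a ^ 3 * √(1 - e ^ 2) ^ 3) := by
  obtain ⟨A, B, hAB, h⟩ := inner_orbit z a e ϖ
  have hs0 : 0 < √(1 - e ^ 2) := Real.sqrt_pos.2 (by nlinarith)
  have h' : ∀ E : ℝ, (3 * (inner ℝ z (orbit a e ϖ E)) ^ 2
      - ‖z‖ ^ 2 * ‖orbit a e ϖ E‖ ^ 2) / (2 * ‖orbit a e ϖ E‖ ^ 5) * (1 - e * Real.cos E)
      = (1 / (2 * a ^ 3)) * ((3 * ((Real.cos E - e) * A + √(1 - e ^ 2) * Real.sin E * B) ^ 2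
        - (A ^ 2 + B ^ 2) * (1 - e * Real.cos E) ^ 2) / (1 - e * Real.cos E) ^ 4) := fun E => by
    have hD := one_sub_mul_cos_pos he0 he1 E
    rw [norm_orbit ha.le he0 he1, h, hAB]
    field_simp
  simp only [meanAverage, h']
  rw [intervalIntegral.integral_const_mul, integral_quadrupole he0 he1, hAB]
  have := Real.pi_pos
  field_simp
  ring

lemma meanAverage_norm_orbit_sq {a e : ℝ} (ha : 0 < a) (he0 : 0 ≤ e) (he1 : e < 1) (ϖ k : ℝ) :
    (meanAverage e fun E => ‖orbit a e ϖ E‖ ^ 2 / k) = a ^ 2 * (1 + 3 / 2 * e ^ 2) / k := by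
  have hder : ∀ E : ℝ, HasDerivAt (fun E => a ^ 2 / k * (E - 3 * e * Real.sin E
      + 3 * e ^ 2 * ((E + Real.sin E * Real.cos E) / 2)
      - e ^ 3 * (Real.sin E - Real.sin E ^ 3 / 3)))
      (‖orbit a e ϖ E‖ ^ 2 / k * (1 - e * Real.cos E)) E := fun E => by
    have hs := Real.hasDerivAt_sin E
    have h := (((((hasDerivAt_id E).sub (hs.const_mul (3 * e))).add
      ((((hasDerivAt_id E).add (hs.mul (Real.hasDerivAt_cos E))).div_const 2).const_mul
        (3 * e ^ 2))).sub ((hs.sub ((hs.pow 3).div_const 3)).const_mul (e ^ 3))).const_mul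
          (a ^ 2 / k))
    refine h.congr_deriv ?_
    have hsc := Real.sin_sq_add_cos_sq E
    have hS : Real.sin E ^ 2 = 1 - Real.cos E ^ 2 := by linarith
    rw [norm_orbit ha.le he0 he1]
    push_cast
    linear_combination (a ^ 2 / k) * (-(3 / 2) * e ^ 2 + e ^ 3 * Real.cos E) * hS
  have hcont : Continuous fun E : ℝ => ‖orbit a e ϖ E‖ ^ 2 / k * (1 - e * Real.cos E) := by
    unfold orbit; fun_prop
  rw [meanAverage, intervalIntegral.integral_eq_sub_of_hasDerivAt (fun E _ => hder E)
    (hcont.intervalIntegrable _ _)]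
  simp only [Real.sin_two_pi, Real.cos_two_pi, Real.sin_zero, Real.cos_zero]
  have := Real.pi_pos
  field_simp
  ring

lemma secular2_eq {a₁ e₁ a₂ e₂ : ℝ} (ha₁ : 0 < a₁) (he₁ : 0 ≤ e₁) (he₁' : e₁ < 1)
    (ha₂ : 0 < a₂) (he₂ : 0 ≤ e₂) (he₂' : e₂ < 1) (ϖ₁ ϖ₂ : ℝ) :
    secular2 a₁ e₁ ϖ₁ a₂ e₂ ϖ₂
      = a₁ ^ 2 * (1 + 3 / 2 * e₁ ^ 2) / (4 * a₂ ^ 3 * √(1 - e₂ ^ 2) ^ 3) := by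
  simp only [secular2, meanAverage_quadrupole ha₂ he₂ he₂', meanAverage_norm_orbit_sq ha₁ he₁ he₁']

lemma eccentricity_sq {L t : ℝ} (hL : 0 < L) (ht : 0 ≤ t) (htL : t < L) :
    eccentricity L t ^ 2 = 1 - (1 - t / L) ^ 2 ∧ 0 ≤ eccentricity L t ∧ eccentricity L t < 1 := by
  have h1 : 0 < 1 - t / L := by rw [sub_pos, div_lt_one hL]; exact htL
  have h2 : 0 ≤ t / L := by positivity
  refine ⟨Real.sq_sqrt (by nlinarith), Real.sqrt_nonneg _, ?_⟩
  rw [eccentricity, Real.sqrt_lt' one_pos]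
  nlinarith

/-- The secular function in closed form. -/
lemma Nhat_eq {mb : Fin 3 → ℝ} {μ G ψ : ℝ} {Λ : Fin 2 → ℝ} {t : ℝ} (hmb : ∀ i, 0 < mb i)
    (hμ : 0 < μ) (hΛ : ∀ i, 0 < Λ i) (ht : 0 ≤ t) (htL : t < Λ 1) (ht1 : 0 ≤ Λ 0 + Λ 1 - G - t)
    (htL1 : Λ 0 + Λ 1 - G - t < Λ 0) :
    Nhat mb μ G ψ Λ t = -(mb 1 * mb 2 * (redMass mb μ 1 ^ 2 * bigMass mb μ 1)) / Λ 1 ^ 2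
      - mb 1 * mb 2 * redMass mb μ 1 ^ 6 * bigMass mb μ 1 ^ 3
        / (8 * redMass mb μ 0 ^ 4 * bigMass mb μ 0 ^ 2)
        * ((5 * Λ 0 ^ 4 - 3 * Λ 0 ^ 2 * (t - Λ 1 + G) ^ 2) / (Λ 1 * (Λ 1 - t)) ^ 3) := by
  have hM : ∀ i, 0 < bigMass mb μ i := fun i => by
    have := hmb 0; have := hmb i.succ; unfold bigMass; positivity
  have hm : ∀ i, 0 < redMass mb μ i := fun i => by
    have := hmb 0; have := hmb i.succ; unfold redMass; positivity
  have ha : ∀ i, 0 < semiAxis mb μ Λ i := fun i => by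
    have := hM i; have := hm i; have := hΛ i; unfold semiAxis; positivity
  obtain ⟨h1, h2, h3⟩ := eccentricity_sq (hΛ 1) ht htL
  obtain ⟨k1, k2, k3⟩ := eccentricity_sq (hΛ 0) ht1 htL1
  rw [Nhat, secularN, secular0_eq (ha 1) h2 h3, secular2_eq (ha 0) k2 k3 (ha 1) h2 h3, k1, h1]
  have h4 : √(1 - (1 - (1 - t / Λ 1) ^ 2)) = 1 - t / Λ 1 := by
    rw [sub_sub_cancel, Real.sqrt_sq]
    rw [sub_nonneg, div_le_one (hΛ 1)]
    exact htL.le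
  have h0 := hΛ 0
  have h1' := hΛ 1
  have hM0 := hM 0
  have hM1 := hM 1
  have hm0 := hm 0
  have hm1 := hm 1
  have htp : 0 < Λ 1 - t := by linarith
  have h5 : 1 - t / Λ 1 = (Λ 1 - t) / Λ 1 := by field_simp
  -- `t - Λ 1 + G = Λ 0 - t₁` is the angular momentum of the inner planet.
  have h6 : 1 - (Λ 0 + Λ 1 - G - t) / Λ 0 = (t - Λ 1 + G) / Λ 0 := by field_simp; ring
  rw [h4, h5, h6]
  unfold semiAxis
  field_simp
  ring

/-! ### Cauchy estimates -/

section Schwarz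

variable {E F : Type*} [NormedAddCommGroup E] [NormedSpace ℂ E] [NormedAddCommGroup F]
  [NormedSpace ℂ F]

/-- Schwarz lemma on the ball of radius `ρ` about `z`, which is mapped into the closed ball of
radius `2 * M` about `f z`. -/
lemma norm_fderiv_le_of_mem_ball {f : E → F} {M ρ R : ℝ} {c z : E} (hρ : 0 < ρ)
    (hd : DifferentiableOn ℂ f (Metric.ball c R)) (hM : ∀ w ∈ Metric.ball c R, ‖f w‖ ≤ M)
    (hz : dist z c + ρ ≤ R) : ‖fderiv ℂ f z‖ ≤ 2 * M / ρ := by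
  have hsub : Metric.ball z ρ ⊆ Metric.ball c R := Metric.ball_subset_ball' (by linarith)
  refine Complex.norm_fderiv_le_div_of_mapsTo_ball (hd.mono hsub) (fun w hw => ?_) hρ
  rw [mem_closedBall_iff_norm]
  have h1 := hM w (hsub hw)
  have h2 := hM z (hsub (Metric.mem_ball_self hρ))
  linarith [norm_sub_le (f w) (f z)]

/-- Schwarz lemma again, now for the derivative: on the half ball it stays within `8 * M` of its
value at the centre. -/
lemma norm_fderiv_sub_le_of_mem_ball [CompleteSpace F] {f : E → F} {M : ℝ} {c z : E}
    (hd : AnalyticOnNhd ℂ f (Metric.ball c 1)) (hM : ∀ w ∈ Metric.ball c 1, ‖f w‖ ≤ M)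
    (hz : dist z c < 1 / 2) : ‖fderiv ℂ f z - fderiv ℂ f c‖ ≤ 16 * M * dist z c := by
  have hb : ∀ w ∈ Metric.ball c (1 / 2 : ℝ), ‖fderiv ℂ f w‖ ≤ 4 * M := fun w hw => by
    have := norm_fderiv_le_of_mem_ball (z := w) (ρ := 1 / 2) (by norm_num) hd.differentiableOn hM
      (by rw [Metric.mem_ball] at hw; linarith)
    linarith
  have h := Complex.dist_le_div_mul_dist_of_mapsTo_ball (f := fderiv ℂ f) (c := c) (R₁ := 1 / 2)
    (R₂ := 8 * M)
    (hd.fderiv.differentiableOn.mono (Metric.ball_subset_ball (by norm_num)))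
    (fun w hw => by
      rw [mem_closedBall_iff_norm]
      have h1 := hb w hw
      have h2 := hb c (Metric.mem_ball_self (by norm_num))
      linarith [norm_sub_le (fderiv ℂ f w) (fderiv ℂ f c)]) hz
  rw [dist_eq_norm] at h
  calc _ ≤ _ := h
    _ = _ := by ring

/-- Second order Taylor estimate for the derivative of a bounded holomorphic function. -/
lemma norm_deriv_taylor_le {f : ℂ → ℂ} {M : ℝ} {s : ℂ}
    (hd : DifferentiableOn ℂ f (Metric.ball 0 1)) (hM : ∀ w ∈ Metric.ball (0 : ℂ) 1, ‖f w‖ ≤ M)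
    (hs : ‖s‖ < 1 / 2) :
    ‖deriv f s - deriv f 0 - s * deriv (deriv f) 0‖ ≤ 64 * M * ‖s‖ ^ 2 := by
  have hb : ∀ w ∈ Metric.ball (0 : ℂ) (1 / 2 : ℝ), ‖deriv f w‖ ≤ 4 * M := fun w hw => by
    have := norm_fderiv_le_of_mem_ball (z := w) (ρ := 1 / 2) (by norm_num) hd hM
      (by rw [Metric.mem_ball] at hw; linarith)
    rw [norm_deriv_eq_norm_fderiv]
    linarith
  have h0 : (0 : ℂ) ∈ Metric.ball (0 : ℂ) (1 / 2 : ℝ) := Metric.mem_ball_self (by norm_num)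
  have hd' : DifferentiableOn ℂ (deriv f) (Metric.ball 0 (1 / 2 : ℝ)) :=
    (hd.mono (Metric.ball_subset_ball (by norm_num))).deriv Metric.isOpen_ball
  have hdd : ‖deriv (deriv f) 0‖ ≤ 16 * M := by
    rw [norm_deriv_eq_norm_fderiv]
    have := norm_fderiv_le_of_mem_ball (z := 0) (ρ := 1 / 2) (R := 1 / 2) (by norm_num) hd' hb
      (by simp)
    linarith
  -- Once its linear part is removed, `deriv f` differs from its value at 0 by `o(w)`, and by at
  -- most `4M + 4M + 8M` on the half disc. The Schwarz lemma of order `n + 1 = 2` then gives `16M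
  -- (2‖s‖)²`.
  have h := Complex.dist_le_mul_div_pow_of_mapsTo_ball_of_isLittleO
    (f := fun w => deriv f w - w * deriv (deriv f) 0) (c := 0) (z := s) (R₁ := 1 / 2)
    (R₂ := 16 * M) (n := 1) (hd'.sub (by fun_prop)) (fun w hw => ?_) ?_ (by simpa using hs)
  · rw [dist_eq_norm] at h
    simp only [zero_mul, sub_zero, dist_zero_right] at h
    rw [show deriv f s - deriv f 0 - s * deriv (deriv f) 0
      = deriv f s - s * deriv (deriv f) 0 - deriv f 0 by ring]
    refine h.trans (le_of_eq ?_)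
    ring
  · rw [mem_closedBall_iff_norm]
    have h1 := hb w hw
    have h2 := hb 0 h0
    have h3 : ‖w * deriv (deriv f) 0‖ ≤ 8 * M := by
      rw [norm_mul]
      rw [Metric.mem_ball, dist_zero_right] at hw
      nlinarith [norm_nonneg (deriv (deriv f) 0), norm_nonneg w]
    simp only [zero_mul, sub_zero]
    linarith [norm_sub_le (deriv f w - w * deriv (deriv f) 0) (deriv f 0),
      norm_sub_le (deriv f w) (w * deriv (deriv f) 0)]
  · have hda : HasDerivAt (deriv f) (deriv (deriv f) 0) 0 :=
      (hd'.differentiableAt (Metric.isOpen_ball.mem_nhds h0)).hasDerivAt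
    have := hda.isLittleO
    simp only [sub_zero, smul_eq_mul, pow_one, zero_mul] at this ⊢
    refine (this.norm_right).congr_left fun w => ?_
    ring

end Schwarz

/-! ### Anisotropic polydiscs -/

/-- Complex actions `(Λ₁, Λ₂, t)`. -/
abbrev ActC := (Fin 2 → ℂ) × ℂ

/-- The polydisc of radius `r` in `Λ` and `1` in `t`. -/
def polydisc (p : ActC) (r : ℝ) : Set ActC := {q | ‖q.1 - p.1‖ < r ∧ ‖q.2 - p.2‖ < 1}

/-- The norm for which the polydisc of radius `r` contains the unit ball. -/
noncomputable def wnorm (r : ℝ) (v : ActC) : ℝ := ‖v.1‖ / r + ‖v.2‖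

lemma wnorm_nonneg {r : ℝ} (hr : 0 < r) (v : ActC) : 0 ≤ wnorm r v := by
  unfold wnorm; positivity

/-- The linear map that takes the unit ball to the polydisc of radius `r`. -/
noncomputable def rescale (r : ℝ) : ActC →L[ℂ] ActC :=
  ((r : ℂ) • ContinuousLinearMap.fst ℂ (Fin 2 → ℂ) ℂ).prod (ContinuousLinearMap.snd ℂ _ ℂ)

/-- The inverse of `rescale r`. -/
noncomputable def unscale (r : ℝ) (v : ActC) : ActC := ((r : ℂ)⁻¹ • v.1, v.2)

lemma rescale_unscale {r : ℝ} (hr : 0 < r) (v : ActC) : rescale r (unscale r v) = v := by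
  have : (r : ℂ) ≠ 0 := by exact_mod_cast hr.ne'
  ext1 <;> simp [rescale, unscale, smul_smul, this]

lemma norm_unscale_le {r : ℝ} (hr : 0 < r) (v : ActC) : ‖unscale r v‖ ≤ wnorm r v := by
  rw [Prod.norm_def]
  simp only [unscale, norm_smul, norm_inv, Complex.norm_real, Real.norm_eq_abs, abs_of_pos hr,
    wnorm]
  refine max_le ?_ ?_
  · have := norm_nonneg v.2
    rw [div_eq_inv_mul]; linarith
  · have : 0 ≤ ‖v.1‖ / r := by positivity
    linarith

lemma mapsTo_rescale {r : ℝ} (hr : 0 < r) (p : ActC) :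
    Set.MapsTo (fun z => p + rescale r z) (Metric.ball 0 1) (polydisc p r) := by
  intro z hz
  rw [mem_ball_zero_iff, Prod.norm_def, max_lt_iff] at hz
  refine ⟨?_, ?_⟩
  · simp only [rescale, Prod.fst_add, add_sub_cancel_left]
    change ‖(r : ℂ) • z.1‖ < r
    rw [norm_smul, Complex.norm_real, Real.norm_eq_abs, abs_of_pos hr]
    nlinarith [hz.1]
  · simpa [rescale] using hz.2

lemma hasFDerivAt_rescale (r : ℝ) (p z : ActC) :
    HasFDerivAt (fun z => p + rescale r z) (rescale r) z :=
  (rescale r).hasFDerivAt.const_add p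

section Bounds

variable {f : ActC → ℂ} {p q : ActC} {r M : ℝ}

/-- Pulling back by `rescale r` makes the two radii equal, so that the estimate on the unit ball
applies and vectors are measured by `wnorm r`. -/
lemma norm_fderiv_apply_le_of_polydisc (hr : 0 < r) (hf : AnalyticOnNhd ℂ f (polydisc p r))
    (hM : ∀ w ∈ polydisc p r, ‖f w‖ ≤ M) (v : ActC) :
    ‖fderiv ℂ f p v‖ ≤ 4 * M * wnorm r v := by
  have hmem := mapsTo_rescale hr p
  set g : ActC → ℂ := fun z => f (p + rescale r z) with hg
  have hga : ∀ z ∈ Metric.ball (0 : ActC) 1,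
      HasFDerivAt g ((fderiv ℂ f (p + rescale r z)).comp (rescale r)) z := fun z hz =>
    ((hf _ (hmem hz)).differentiableAt.hasFDerivAt).comp z (hasFDerivAt_rescale r p z)
  have h := norm_fderiv_le_of_mem_ball (f := g) (M := M) (z := 0) (ρ := 1) (c := 0) (R := 1)
    one_pos (fun z hz => (hga z hz).differentiableAt.differentiableWithinAt)
    (fun w hw => hM _ (hmem hw)) (by simp)
  rw [(hga 0 (Metric.mem_ball_self one_pos)).fderiv, map_zero, add_zero] at h
  have h2 := ((fderiv ℂ f p).comp (rescale r)).le_opNorm (unscale r v)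
  rw [ContinuousLinearMap.comp_apply, rescale_unscale hr] at h2
  have h3 := norm_unscale_le hr v
  have h4 := norm_nonneg (unscale r v)
  have hM0 : 0 ≤ M := (norm_nonneg _).trans (hM p ⟨by simpa using hr, by simp⟩)
  calc _ ≤ _ := h2
    _ ≤ (2 * M / 1) * wnorm r v := by gcongr
    _ ≤ _ := by nlinarith [mul_nonneg hM0 (h4.trans h3)]

lemma norm_fderiv_apply_sub_le_of_polydisc_of_near (hr : 0 < r)
    (hf : AnalyticOnNhd ℂ f (polydisc p r))
    (hM : ∀ w ∈ polydisc p r, ‖f w‖ ≤ M) (hq : wnorm r (q - p) < 1 / 2) (v : ActC) :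
    ‖fderiv ℂ f q v - fderiv ℂ f p v‖ ≤ 16 * M * wnorm r v * wnorm r (q - p) := by
  have hmem := mapsTo_rescale hr p
  set g : ActC → ℂ := fun z => f (p + rescale r z) with hg
  have hga : ∀ z ∈ Metric.ball (0 : ActC) 1,
      HasFDerivAt g ((fderiv ℂ f (p + rescale r z)).comp (rescale r)) z := fun z hz =>
    ((hf _ (hmem hz)).differentiableAt.hasFDerivAt).comp z (hasFDerivAt_rescale r p z)
  have han : AnalyticOnNhd ℂ g (Metric.ball 0 1) :=
    hf.comp (g := f) (f := fun z => p + rescale r z)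
      (fun z _ => analyticAt_const.add ((rescale r).analyticAt z)) hmem
  set z := unscale r (q - p) with hz
  have hzn : ‖z‖ ≤ wnorm r (q - p) := norm_unscale_le hr _
  have hzd : dist z 0 < 1 / 2 := by rw [dist_zero_right]; linarith
  have hpz : p + rescale r z = q := by rw [hz, rescale_unscale hr, add_sub_cancel]
  have h := norm_fderiv_sub_le_of_mem_ball han (fun w hw => hM _ (hmem hw)) hzd
  rw [(hga 0 (Metric.mem_ball_self one_pos)).fderiv, map_zero, add_zero,
    (hga z (Metric.mem_ball.2 (hzd.trans (by norm_num)))).fderiv, hpz,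
    ← ContinuousLinearMap.sub_comp, dist_zero_right] at h
  have h2 := ((fderiv ℂ f q - fderiv ℂ f p).comp (rescale r)).le_opNorm (unscale r v)
  rw [ContinuousLinearMap.comp_apply, rescale_unscale hr] at h2
  have h3 := norm_unscale_le hr v
  have h4 := norm_nonneg (unscale r v)
  have hM0 : 0 ≤ M := (norm_nonneg _).trans (hM p ⟨by simpa using hr, by simp⟩)
  calc _ ≤ _ := h2
    _ ≤ (16 * M * wnorm r (q - p)) * wnorm r v := by
      have h5 : 16 * M * ‖z‖ ≤ 16 * M * wnorm r (q - p) := by gcongr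
      exact mul_le_mul (h.trans h5) h3 h4 ((norm_nonneg _).trans (h.trans h5))
    _ = _ := by ring

/-- The derivative is Lipschitz between any two points that are centres of polydiscs in which the
function is bounded, however far apart they are. -/
lemma norm_fderiv_apply_sub_le_of_polydisc (hr : 0 < r)
    (hf : AnalyticOnNhd ℂ f (polydisc p r)) (hM : ∀ w ∈ polydisc p r, ‖f w‖ ≤ M)
    (hf' : AnalyticOnNhd ℂ f (polydisc q r)) (hM' : ∀ w ∈ polydisc q r, ‖f w‖ ≤ M) (v : ActC) :
    ‖fderiv ℂ f q v - fderiv ℂ f p v‖ ≤ 16 * M * wnorm r v * wnorm r (q - p) := by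
  rcases lt_or_ge (wnorm r (q - p)) (1 / 2) with h | h
  · exact norm_fderiv_apply_sub_le_of_polydisc_of_near hr hf hM h v
  -- For distant points the two first derivative bounds add up to `8 * M * wnorm r v`, and `1 ≤ 2 *
  -- wnorm r (q - p)`.
  · have h1 := norm_fderiv_apply_le_of_polydisc hr hf hM v
    have h2 := norm_fderiv_apply_le_of_polydisc hr hf' hM' v
    have hM0 : 0 ≤ M := (norm_nonneg _).trans (hM p ⟨by simpa using hr, by simp⟩)
    have h3 : 0 ≤ M * wnorm r v := mul_nonneg hM0 (wnorm_nonneg hr v)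
    calc _ ≤ _ := norm_sub_le _ _
      _ ≤ _ := by nlinarith

end Bounds

/-! ### The quadrupole term in complex actions -/

/-- Lower second order Taylor estimate on `[0, 1]`. -/
lemma half_le_taylor_of_le {φ φ' φ'' : ℝ → ℝ} {m : ℝ}
    (h1 : ∀ s ∈ Set.Icc (0 : ℝ) 1, HasDerivAt φ (φ' s) s)
    (h2 : ∀ s ∈ Set.Icc (0 : ℝ) 1, HasDerivAt φ' (φ'' s) s)
    (hm : ∀ s ∈ Set.Icc (0 : ℝ) 1, m ≤ φ'' s) : m / 2 ≤ φ 1 - φ 0 - φ' 0 := by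
  have hmono : MonotoneOn (fun s => φ' s - m * s) (Set.Icc 0 1) := by
    have hd : ∀ s ∈ Set.Icc (0 : ℝ) 1, HasDerivAt (fun s => φ' s - m * s) (φ'' s - m) s :=
      fun s hs => ((h2 s hs).sub ((hasDerivAt_id s).const_mul m)).congr_deriv (by ring)
    refine monotoneOn_of_deriv_nonneg (convex_Icc 0 1)
      (fun s hs => (hd s hs).continuousAt.continuousWithinAt)
      (fun s hs => (hd s (interior_subset hs)).differentiableAt.differentiableWithinAt)
      (fun s hs => ?_)
    rw [(hd s (interior_subset hs)).deriv]
    linarith [hm s (interior_subset hs)]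
  have hmono2 : MonotoneOn (fun s => φ s - φ' 0 * s - m / 2 * s ^ 2) (Set.Icc 0 1) := by
    have hd : ∀ s ∈ Set.Icc (0 : ℝ) 1,
        HasDerivAt (fun s => φ s - φ' 0 * s - m / 2 * s ^ 2) (φ' s - φ' 0 - m * s) s :=
      fun s hs => by
        refine (((h1 s hs).sub ((hasDerivAt_id s).const_mul (φ' 0))).sub
          (((hasDerivAt_id s).pow 2).const_mul (m / 2))).congr_deriv ?_
        simp; ring
    refine monotoneOn_of_deriv_nonneg (convex_Icc 0 1)
      (fun s hs => (hd s hs).continuousAt.continuousWithinAt)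
      (fun s hs => (hd s (interior_subset hs)).differentiableAt.differentiableWithinAt)
      (fun s hs => ?_)
    have hs' := interior_subset hs
    rw [(hd s hs').deriv]
    have := hmono (Set.left_mem_Icc.2 zero_le_one) hs' hs'.1
    simp only [mul_zero, sub_zero] at this
    linarith
  have := hmono2 (Set.left_mem_Icc.2 zero_le_one) (Set.right_mem_Icc.2 zero_le_one) zero_le_one
  simp only at this
  linarith

/-- Second order Taylor estimate with a remainder between given bounds. -/
lemma exists_taylor_remainder {g g' g'' : ℝ → ℝ} {t h m₁ m₂ a b : ℝ} (ht : t ∈ Set.Ioo a b)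
    (hth : t + h ∈ Set.Ioo a b) (h1 : ∀ s ∈ Set.Ioo a b, HasDerivAt g (g' s) s)
    (h2 : ∀ s ∈ Set.Ioo a b, HasDerivAt g' (g'' s) s)
    (hm₁ : ∀ s ∈ Set.Ioo a b, m₁ ≤ g'' s) (hm₂ : ∀ s ∈ Set.Ioo a b, g'' s ≤ m₂) :
    ∃ R, m₁ ≤ R ∧ R ≤ m₂ ∧ g (t + h) - g t = g' t * h + h ^ 2 * (R / 2) := by
  rcases eq_or_ne h 0 with rfl | hh
  · exact ⟨m₁, le_rfl, (hm₁ t ht).trans (hm₂ t ht), by simp⟩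
  have hseg : ∀ s ∈ Set.Icc (0 : ℝ) 1, t + s * h ∈ Set.Ioo a b := fun s hs => by
    have := (convex_Ioo a b).add_smul_sub_mem ht hth hs
    simpa using this
  have hin : ∀ s : ℝ, HasDerivAt (fun s => t + s * h) h s := fun s => by
    simpa using ((hasDerivAt_id s).mul_const h).const_add t
  have d1 : ∀ s ∈ Set.Icc (0 : ℝ) 1,
      HasDerivAt (fun s => g (t + s * h)) (g' (t + s * h) * h) s :=
    fun s hs => (h1 _ (hseg s hs)).comp s (hin s)
  have d2 : ∀ s ∈ Set.Icc (0 : ℝ) 1,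
      HasDerivAt (fun s => g' (t + s * h) * h) (g'' (t + s * h) * h * h) s :=
    fun s hs => ((h2 _ (hseg s hs)).comp s (hin s)).mul_const h
  have lo := half_le_taylor_of_le (m := m₁ * h ^ 2) d1 d2 (fun s hs => by
    nlinarith [hm₁ _ (hseg s hs), sq_nonneg h])
  have hi := half_le_taylor_of_le (m := -(m₂ * h ^ 2)) (fun s hs => (d1 s hs).neg)
    (fun s hs => (d2 s hs).neg) (fun s hs => by
    nlinarith [hm₂ _ (hseg s hs), sq_nonneg h])
  simp only [one_mul, zero_mul, add_zero, Pi.neg_apply] at lo hi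
  have hh2 : 0 < h ^ 2 := by positivity
  -- The remainder is defined by solving for it; `lo` and `hi` hold for either sign of `h`, since
  -- the segment is parametrised by `[0, 1]`.
  refine ⟨2 * (g (t + h) - g t - g' t * h) / h ^ 2, ?_, ?_, ?_⟩
  · rw [le_div_iff₀ hh2]; linarith
  · rw [div_le_iff₀ hh2]; linarith
  · field_simp; ring

/-- The holomorphic extension of the quadrupole part of `N̂`. -/
@[irreducible] noncomputable def secN2 (P G : ℝ) (p : ActC) : ℂ :=
  -((P : ℂ) * ((5 * p.1 0 ^ 4 - 3 * p.1 0 ^ 2 * (p.2 - p.1 1 + G) ^ 2)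
    / (p.1 1 * (p.1 1 - p.2)) ^ 3))

/-- The first derivative of the quadrupole part with respect to `t`. -/
noncomputable def quadD1 (P G L₀ L₁ t : ℝ) : ℝ :=
  -(P * L₀ ^ 2 / L₁ ^ 3) * (3 * (5 * L₀ ^ 2 - 3 * G ^ 2) / (L₁ - t) ^ 4 + 12 * G / (L₁ - t) ^ 3
    - 3 / (L₁ - t) ^ 2)

/-- The second derivative of the quadrupole part with respect to `t`. -/
noncomputable def quadD2 (P G L₀ L₁ t : ℝ) : ℝ :=
  -(P * L₀ ^ 2 / L₁ ^ 3) * (12 * (5 * L₀ ^ 2 - 3 * G ^ 2) / (L₁ - t) ^ 5 + 36 * G / (L₁ - t) ^ 4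
    - 6 / (L₁ - t) ^ 3)

/-- The third derivative of the quadrupole part with respect to `t`. -/
noncomputable def quadD3 (P G L₀ L₁ t : ℝ) : ℝ :=
  -(P * L₀ ^ 2 / L₁ ^ 3) * (60 * (5 * L₀ ^ 2 - 3 * G ^ 2) / (L₁ - t) ^ 6 + 144 * G / (L₁ - t) ^ 5
    - 18 / (L₁ - t) ^ 4)

/-- With `u = L₁ - t` one has `(t - L₁ + G)² = (G - u)²`, so the quadrupole is a combination of
`u⁻³`, `u⁻²`, `u⁻¹`, and this rule gives all its derivatives in `t`. -/
lemma hasDerivAt_const_div_sub_pow (a L : ℝ) {t : ℝ} (h : L - t ≠ 0) (n : ℕ) :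
    HasDerivAt (fun t => a / (L - t) ^ n) (n * a / (L - t) ^ (n + 1)) t := by
  have h1 := (((hasDerivAt_id t).const_sub L).pow n).inv (pow_ne_zero n h)
  have h2 := h1.const_mul a
  refine (h2.congr_deriv ?_).congr_of_eventuallyEq (Filter.Eventually.of_forall fun s => ?_)
  · rcases n with _ | n
    · simp
    · simp only [id, Nat.add_sub_cancel, Pi.pow_apply]
      field_simp
      ring
  · simp [div_eq_mul_inv]

lemma hasDerivAt_quadD1 (P G L₀ L₁ : ℝ) {t : ℝ} (h : L₁ - t ≠ 0) :
    HasDerivAt (quadD1 P G L₀ L₁) (quadD2 P G L₀ L₁ t) t := by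
  have h1 := ((hasDerivAt_const_div_sub_pow (3 * (5 * L₀ ^ 2 - 3 * G ^ 2)) L₁ h 4).add
    (hasDerivAt_const_div_sub_pow (12 * G) L₁ h 3)).sub (hasDerivAt_const_div_sub_pow 3 L₁ h 2)
  refine (h1.const_mul (-(P * L₀ ^ 2 / L₁ ^ 3))).congr_deriv ?_
  simp only [quadD2]; push_cast; ring

lemma hasDerivAt_quadD2 (P G L₀ L₁ : ℝ) {t : ℝ} (h : L₁ - t ≠ 0) :
    HasDerivAt (quadD2 P G L₀ L₁) (quadD3 P G L₀ L₁ t) t := by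
  have h1 := ((hasDerivAt_const_div_sub_pow (12 * (5 * L₀ ^ 2 - 3 * G ^ 2)) L₁ h 5).add
    (hasDerivAt_const_div_sub_pow (36 * G) L₁ h 4)).sub (hasDerivAt_const_div_sub_pow 6 L₁ h 3)
  refine (h1.const_mul (-(P * L₀ ^ 2 / L₁ ^ 3))).congr_deriv ?_
  simp only [quadD3]; push_cast; ring

/-- With `u = L₁ - t` and `G = u + x`, the numerator is `6 u²` plus terms with a factor `x` or `L₀`,
which are small since `u` is large against `X` and `L₀`. The surviving term comes from the
eccentricity of the outer planet. -/
lemma quadD2_bounds {P G L₀ L₁ t X : ℝ} (hP : 0 < P) (hL₀ : 0 < L₀) (hX : 0 ≤ X)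
    (hx : |t - L₁ + G| ≤ X) (ht : 0 ≤ t) (hu : 24 * X + 8 * L₀ ≤ L₁ - t) :
    3 * P * L₀ ^ 2 / L₁ ^ 6 ≤ quadD2 P G L₀ L₁ t := by
  set u := L₁ - t with hud
  set x := t - L₁ + G with hxd
  have hG : G = u + x := by rw [hud, hxd]; ring
  have hu0 : 0 < u := by linarith
  have hL₁ : 0 < L₁ := by linarith
  have hx' := abs_le.1 hx
  have h : quadD2 P G L₀ L₁ t = P * L₀ ^ 2 / L₁ ^ 3 * ((6 * u ^ 2 + 36 * u * x + 36 * x ^ 2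
      - 60 * L₀ ^ 2) / u ^ 5) := by
    rw [quadD2, ← hud, hG]; field_simp; ring
  have h2 : 3 * u ^ 2 ≤ 6 * u ^ 2 + 36 * u * x + 36 * x ^ 2 - 60 * L₀ ^ 2 := by
    nlinarith [mul_le_mul_of_nonneg_left hx'.1 hu0.le, sq_nonneg x,
      mul_le_mul_of_nonneg_left hu hu0.le]
  rw [h]
  calc 3 * P * L₀ ^ 2 / L₁ ^ 6 = P * L₀ ^ 2 / L₁ ^ 3 * (3 / L₁ ^ 3) := by field_simp
    _ ≤ P * L₀ ^ 2 / L₁ ^ 3 * (3 / u ^ 3) := by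
      have : u ≤ L₁ := by linarith
      gcongr
    _ = P * L₀ ^ 2 / L₁ ^ 3 * (3 * u ^ 2 / u ^ 5) := by field_simp
    _ ≤ _ := by gcongr

/-- Same mechanism, with dominant numerator `54 u²`. The upper bound uses `u ≥ L₁ / 2`, whence `100
* 2 ^ 4 = 1600`. -/
lemma quadD3_bounds {P G L₀ L₁ t X : ℝ} (hP : 0 < P) (hL₀ : 0 < L₀) (hX : 0 ≤ X)
    (hx : |t - L₁ + G| ≤ X) (ht : 0 ≤ t) (hu : 24 * X + 8 * L₀ ≤ L₁ - t)
    (htL : L₁ / 2 ≤ L₁ - t) :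
    27 * P * L₀ ^ 2 / L₁ ^ 7 ≤ quadD3 P G L₀ L₁ t ∧
      quadD3 P G L₀ L₁ t ≤ 1600 * P * L₀ ^ 2 / L₁ ^ 7 := by
  set u := L₁ - t with hud
  set x := t - L₁ + G with hxd
  have hG : G = u + x := by rw [hud, hxd]; ring
  have hu0 : 0 < u := by linarith
  have hL₁ : 0 < L₁ := by linarith
  have hx' := abs_le.1 hx
  have h : quadD3 P G L₀ L₁ t = P * L₀ ^ 2 / L₁ ^ 3 * ((54 * u ^ 2 + 216 * u * x + 180 * x ^ 2
      - 300 * L₀ ^ 2) / u ^ 6) := by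
    rw [quadD3, ← hud, hG]; field_simp; ring
  have hx2 : x ^ 2 ≤ X ^ 2 := sq_le_sq' hx'.1 hx'.2
  have hXu : X ^ 2 ≤ u ^ 2 / 24 ^ 2 := by nlinarith
  have h2 : 27 * u ^ 2 ≤ 54 * u ^ 2 + 216 * u * x + 180 * x ^ 2 - 300 * L₀ ^ 2 := by
    nlinarith [mul_le_mul_of_nonneg_left hx'.1 hu0.le, sq_nonneg x,
      mul_le_mul_of_nonneg_left hu hu0.le]
  have h3 : 54 * u ^ 2 + 216 * u * x + 180 * x ^ 2 - 300 * L₀ ^ 2 ≤ 100 * u ^ 2 := by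
    nlinarith [mul_le_mul_of_nonneg_left hx'.2 hu0.le,
      mul_le_mul_of_nonneg_left hu hu0.le]
  rw [h]
  constructor
  · calc 27 * P * L₀ ^ 2 / L₁ ^ 7 = P * L₀ ^ 2 / L₁ ^ 3 * (27 / L₁ ^ 4) := by field_simp
      _ ≤ P * L₀ ^ 2 / L₁ ^ 3 * (27 / u ^ 4) := by
        have : u ≤ L₁ := by linarith
        gcongr
      _ = P * L₀ ^ 2 / L₁ ^ 3 * (27 * u ^ 2 / u ^ 6) := by field_simp
      _ ≤ _ := by gcongr
  · calc _ ≤ P * L₀ ^ 2 / L₁ ^ 3 * (100 * u ^ 2 / u ^ 6) := by gcongr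
      _ = P * L₀ ^ 2 / L₁ ^ 3 * (100 / u ^ 4) := by field_simp
      _ ≤ P * L₀ ^ 2 / L₁ ^ 3 * (100 / (L₁ / 2) ^ 4) := by gcongr
      _ = _ := by field_simp; norm_num

/-- A real point as a point of the complex action space. -/
noncomputable def cpt (L₀ L₁ t : ℝ) : ActC := (![(L₀ : ℂ), (L₁ : ℂ)], (t : ℂ))

@[simp] lemma cpt_fst_zero (L₀ L₁ t : ℝ) : (cpt L₀ L₁ t).1 0 = L₀ := rfl
@[simp] lemma cpt_fst_one (L₀ L₁ t : ℝ) : (cpt L₀ L₁ t).1 1 = L₁ := rfl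
@[simp] lemma cpt_snd (L₀ L₁ t : ℝ) : (cpt L₀ L₁ t).2 = t := rfl

/-! ### Complex bounds of the quadrupole near real actions. -/

/-- Range of the actions on which the quadrupole term is controlled. -/
structure QuadRange (W X T G L₀ L₁ t : ℝ) : Prop where
  L₀_pos : 0 < L₀
  L₀_le : L₀ ≤ W
  t_pos : 0 < t
  t_lt : t < T
  abs_le : |t - L₁ + G| ≤ X
  le_L₁ : 2 * (24 * X + 8 * W + T + 4) ≤ L₁

namespace QuadRange

variable {P W X T G L₀ L₁ t : ℝ}

lemma X_nonneg (h : QuadRange W X T G L₀ L₁ t) : 0 ≤ X := (abs_nonneg _).trans h.abs_le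

lemma L₁_pos (h : QuadRange W X T G L₀ L₁ t) : 0 < L₁ := by
  have := h.X_nonneg; have := h.L₀_pos; have := h.L₀_le; have := h.t_pos; have := h.t_lt
  have := h.le_L₁
  linarith

/-- The size of `L₁` required by `le_L₁` leaves room for perturbations by 1 in every variable, so
neither factor of the denominator can vanish on the polydisc of radius 1. -/
lemma norm_le (h : QuadRange W X T G L₀ L₁ t) {q : ActC} (hq : q ∈ polydisc (cpt L₀ L₁ t) 1) :
    ‖q.1 0‖ ≤ W + 1 ∧ ‖q.2 - q.1 1 + G‖ ≤ X + 2 ∧ L₁ / 2 ≤ ‖q.1 1‖ ∧ L₁ / 2 ≤ ‖q.1 1 - q.2‖ := by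
  obtain ⟨h1, h2⟩ := hq
  have a0 : ‖q.1 0 - L₀‖ ≤ 1 := (norm_le_pi_norm (q.1 - (cpt L₀ L₁ t).1) 0).trans h1.le
  have a1 : ‖q.1 1 - L₁‖ ≤ 1 := (norm_le_pi_norm (q.1 - (cpt L₀ L₁ t).1) 1).trans h1.le
  rw [cpt_snd] at h2
  have hX := h.X_nonneg
  have hL := h.le_L₁
  have e0 := h.L₀_pos
  have e1 := h.L₀_le
  have e2 := h.t_pos
  have e3 := h.t_lt
  refine ⟨?_, ?_, ?_, ?_⟩
  · calc ‖q.1 0‖ = ‖(q.1 0 - L₀) + (L₀ : ℂ)‖ := by rw [sub_add_cancel]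
      _ ≤ ‖q.1 0 - L₀‖ + ‖(L₀ : ℂ)‖ := norm_add_le _ _
      _ ≤ W + 1 := by
        rw [Complex.norm_real, Real.norm_eq_abs, abs_of_pos h.L₀_pos]; linarith [h.L₀_le]
  · calc ‖q.2 - q.1 1 + G‖ = ‖(q.2 - t) - (q.1 1 - L₁) + ((t - L₁ + G : ℝ) : ℂ)‖ := by
          congr 1; push_cast; ring
      _ ≤ ‖q.2 - t‖ + ‖q.1 1 - L₁‖ + ‖((t - L₁ + G : ℝ) : ℂ)‖ :=
        (norm_add_le _ _).trans (by gcongr; exact norm_sub_le _ _)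
      _ ≤ X + 2 := by
        rw [Complex.norm_real, Real.norm_eq_abs]; linarith [h.abs_le]
  · have := norm_sub_norm_le (L₁ : ℂ) (L₁ - q.1 1)
    rw [sub_sub_cancel, Complex.norm_real, Real.norm_eq_abs, abs_of_pos h.L₁_pos,
      norm_sub_rev] at this
    linarith
  · have := norm_sub_norm_le (L₁ : ℂ) ((L₁ - q.1 1) + ((q.2 - t) + t))
    have h3 : ‖(L₁ - q.1 1) + ((q.2 - t) + t)‖ ≤ 1 + (1 + t) :=
      (norm_add_le _ _).trans (add_le_add (by rwa [norm_sub_rev]) ((norm_add_le _ _).trans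
        (add_le_add h2.le (by rw [Complex.norm_real, Real.norm_eq_abs, abs_of_pos h.t_pos]))))
    rw [show (L₁ : ℂ) - ((L₁ - q.1 1) + ((q.2 - t) + t)) = q.1 1 - q.2 by ring,
      Complex.norm_real, Real.norm_eq_abs, abs_of_pos h.L₁_pos] at this
    linarith

lemma analyticOnNhd_secN2 (h : QuadRange W X T G L₀ L₁ t) :
    AnalyticOnNhd ℂ (secN2 P G) (polydisc (cpt L₀ L₁ t) 1) := by
  intro q hq
  obtain ⟨-, -, h1, h2⟩ := h.norm_le hq
  have hL := h.L₁_pos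
  have k1 : q.1 1 ≠ 0 := norm_pos_iff.1 (by linarith)
  have k2 : q.1 1 - q.2 ≠ 0 := norm_pos_iff.1 (by linarith)
  have p0 : ∀ i, AnalyticAt ℂ (fun q : ActC => q.1 i) q := fun i =>
    ((ContinuousLinearMap.proj (R := ℂ) (φ := fun _ : Fin 2 => ℂ) i).comp
      (ContinuousLinearMap.fst ℂ (Fin 2 → ℂ) ℂ)).analyticAt q
  have p2 : AnalyticAt ℂ (fun q : ActC => q.2) q := analyticAt_snd
  unfold secN2
  have hp0 := p0 0
  have hp1 := p0 1
  have hden : (q.1 1 * (q.1 1 - q.2)) ^ 3 ≠ 0 := pow_ne_zero _ (mul_ne_zero k1 k2)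
  fun_prop (disch := assumption)

lemma norm_secN2_le (h : QuadRange W X T G L₀ L₁ t) (hP : 0 < P) :
    ∀ q ∈ polydisc (cpt L₀ L₁ t) 1, ‖secN2 P G q‖
      ≤ 64 * P * (5 * (W + 1) ^ 4 + 3 * (W + 1) ^ 2 * (X + 2) ^ 2) / L₁ ^ 6 := by
  intro q hq
  obtain ⟨h0, hx, h1, h2⟩ := h.norm_le hq
  have hL := h.L₁_pos
  have hX := h.X_nonneg
  have hW : 0 < W := h.L₀_pos.trans_le h.L₀_le
  have hnum : ‖5 * q.1 0 ^ 4 - 3 * q.1 0 ^ 2 * (q.2 - q.1 1 + G) ^ 2‖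
      ≤ 5 * (W + 1) ^ 4 + 3 * (W + 1) ^ 2 * (X + 2) ^ 2 := by
    refine (norm_sub_le _ _).trans ?_
    simp only [norm_mul, norm_pow, Complex.norm_ofNat]
    gcongr
  have hden : (L₁ / 2 * (L₁ / 2)) ^ 3 ≤ ‖(q.1 1 * (q.1 1 - q.2)) ^ 3‖ := by
    rw [norm_pow, norm_mul]
    gcongr
  rw [secN2, norm_neg, norm_mul, norm_div, Complex.norm_real, Real.norm_eq_abs, abs_of_pos hP]
  calc _ ≤ P * ((5 * (W + 1) ^ 4 + 3 * (W + 1) ^ 2 * (X + 2) ^ 2) / (L₁ / 2 * (L₁ / 2)) ^ 3) := by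
        gcongr
    _ = _ := by field_simp; norm_num

/-- The derivative in `t` at a real point. -/
lemma hasDerivAt_secN2 {L₀ L₁ t : ℝ} (h0 : L₁ ≠ 0) (h1 : L₁ - t ≠ 0) (w : Fin 2 → ℂ)
    (hw0 : w 0 = L₀) (hw1 : w 1 = L₁) :
    HasDerivAt (fun τ : ℂ => secN2 P G (w, τ)) (quadD1 P G L₀ L₁ t : ℂ) (t : ℂ) := by
  have k0 : (L₁ : ℂ) ≠ 0 := by exact_mod_cast h0
  have k1 : (L₁ : ℂ) - t ≠ 0 := by exact_mod_cast h1
  have hx : HasDerivAt (fun τ : ℂ => 5 * (L₀ : ℂ) ^ 4 - 3 * (L₀ : ℂ) ^ 2 * (τ - L₁ + G) ^ 2)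
      (-(3 * (L₀ : ℂ) ^ 2 * (2 * (t - L₁ + G)))) (t : ℂ) := by
    have := (((((hasDerivAt_id (t : ℂ)).sub_const (L₁ : ℂ)).add_const (G : ℂ)).pow 2).const_mul
      (3 * (L₀ : ℂ) ^ 2)).const_sub (5 * (L₀ : ℂ) ^ 4)
    refine this.congr_deriv ?_
    simp
  have hy : HasDerivAt (fun τ : ℂ => ((L₁ : ℂ) * (L₁ - τ)) ^ 3)
      (-(3 * ((L₁ : ℂ) * (L₁ - t)) ^ 2 * L₁)) (t : ℂ) := by
    have := (((hasDerivAt_id (t : ℂ)).const_sub (L₁ : ℂ)).const_mul (L₁ : ℂ)).pow 3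
    refine this.congr_deriv ?_
    simp
  have h := ((hx.div hy (pow_ne_zero _ (mul_ne_zero k0 k1))).const_mul (P : ℂ)).neg
  simp only [secN2, hw0, hw1]
  refine h.congr_deriv ?_
  simp only [quadD1]
  push_cast
  field_simp
  ring

end QuadRange

/-! ### Second order expansions of directional derivatives -/

lemma norm_cpt_fst (v₀ v₁ v₂ : ℝ) : ‖(cpt v₀ v₁ v₂).1‖ = max |v₀| |v₁| := by
  refine le_antisymm ?_ (max_le ?_ ?_)
  · refine (pi_norm_le_iff_of_nonneg (le_max_of_le_left (abs_nonneg _))).2 fun i => ?_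
    fin_cases i
    · simp
    · simp
  · have := norm_le_pi_norm (cpt v₀ v₁ v₂).1 0
    simpa using this
  · have := norm_le_pi_norm (cpt v₀ v₁ v₂).1 1
    simpa using this

lemma norm_cpt_snd (v₀ v₁ v₂ : ℝ) : ‖(cpt v₀ v₁ v₂).2‖ = |v₂| := by simp

lemma add_smul_mem_polydisc {p v : ActC} {r : ℝ} (hr : 0 < r) (hv1 : ‖v.1‖ ≤ r) (hv2 : ‖v.2‖ ≤ 1)
    {z : ℂ} (hz : ‖z‖ < 1) : p + z • v ∈ polydisc p r := by
  refine ⟨?_, ?_⟩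
  · simp only [Prod.fst_add, Prod.smul_fst, add_sub_cancel_left, norm_smul]
    nlinarith [norm_nonneg z]
  · simp only [Prod.snd_add, Prod.smul_snd, add_sub_cancel_left, norm_smul]
    nlinarith [norm_nonneg z]

lemma hasDerivAt_line {f : ActC → ℂ} {p v : ActC} {z : ℂ} (hf : AnalyticAt ℂ f (p + z • v)) :
    HasDerivAt (fun z : ℂ => f (p + z • v)) (fderiv ℂ f (p + z • v) v) z := by
  have h1 : HasDerivAt (fun z : ℂ => p + z • v) v z := by
    simpa using ((hasDerivAt_id z).smul_const v).const_add p
  exact hf.differentiableAt.hasFDerivAt.comp_hasDerivAt z h1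

/-- The expansion is that of a function of one complex variable on the disc `p + z • v`. Only the
polydisc at `p` matters: no real segment has to stay in the domain. -/
lemma exists_quadratic_expansion {f : ActC → ℂ} {p v : ActC} {r M : ℝ} (hr : 0 < r)
    (hf : AnalyticOnNhd ℂ f (polydisc p r)) (hM : ∀ w ∈ polydisc p r, ‖f w‖ ≤ M)
    (hv1 : ‖v.1‖ ≤ r) (hv2 : ‖v.2‖ ≤ 1) :
    ∃ Q : ℝ, ∀ s : ℝ, |s| < 1 / 2 →
      |(fderiv ℂ f (p + (s : ℂ) • v) v).re - (fderiv ℂ f p v).re - s * Q| ≤ 64 * M * s ^ 2 := by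
  have hmem : ∀ z ∈ Metric.ball (0 : ℂ) 1, p + z • v ∈ polydisc p r := fun z hz =>
    add_smul_mem_polydisc hr hv1 hv2 (by simpa using hz)
  have hder : ∀ z ∈ Metric.ball (0 : ℂ) 1,
      HasDerivAt (fun z : ℂ => f (p + z • v)) (fderiv ℂ f (p + z • v) v) z :=
    fun z hz => hasDerivAt_line (hf _ (hmem z hz))
  refine ⟨(deriv (deriv fun z : ℂ => f (p + z • v)) 0).re, fun s hs => ?_⟩
  have hs' : ‖(s : ℂ)‖ < 1 / 2 := by rwa [Complex.norm_real]
  have h := norm_deriv_taylor_le (f := fun z : ℂ => f (p + z • v))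
    (fun z hz => (hder z hz).differentiableAt.differentiableWithinAt)
    (fun z hz => hM _ (hmem z hz)) hs'
  rw [(hder s (by rw [mem_ball_zero_iff]; linarith)).deriv,
    (hder 0 (Metric.mem_ball_self one_pos)).deriv, zero_smul, add_zero, Complex.norm_real,
    Real.norm_eq_abs, sq_abs] at h
  refine le_trans ?_ h
  refine le_trans (le_of_eq ?_) (Complex.abs_re_le_norm _)
  simp

variable {P W X T G L₀ L₁ t : ℝ}

/-- Schwarz lemma in the Λ-variables at frozen `t`. It is what lets a small horizontal part of the
direction enter the cubic term with a small factor. -/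
lemma secN2_line_sub_le (h : QuadRange W X T G L₀ L₁ t) {M : ℝ}
    (hM : ∀ q ∈ polydisc (cpt L₀ L₁ t) 1, ‖secN2 P G q‖ ≤ M) {v : ActC} (hv1 : ‖v.1‖ ≤ 1)
    (hv2 : ‖v.2‖ ≤ 1) {z : ℂ} (hz : ‖z‖ < 1) :
    ‖secN2 P G (cpt L₀ L₁ t + z • v) - secN2 P G (cpt L₀ L₁ t + z • (0, v.2))‖
      ≤ 2 * M * ‖v.1‖ := by
  set p := cpt L₀ L₁ t
  have hz2 : ‖z * v.2‖ < 1 := by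
    rw [norm_mul]; nlinarith [norm_nonneg z]
  have hmem : ∀ w ∈ Metric.ball (0 : Fin 2 → ℂ) 1, (p.1 + w, p.2 + z * v.2) ∈ polydisc p 1 :=
    fun w hw => ⟨by simpa using hw, by simpa using hz2⟩
  have hg : DifferentiableOn ℂ (fun w : Fin 2 → ℂ => secN2 P G (p.1 + w, p.2 + z * v.2))
      (Metric.ball 0 1) := fun w hw => by
    refine DifferentiableAt.differentiableWithinAt ?_
    exact DifferentiableAt.comp (g := secN2 P G) w
      (h.analyticOnNhd_secN2 _ (hmem w hw)).differentiableAt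
      (by fun_prop : DifferentiableAt ℂ (fun w : Fin 2 → ℂ => (p.1 + w, p.2 + z * v.2)) w)
  have hzv : ‖z • v.1‖ < 1 := by
    rw [norm_smul]; nlinarith [norm_nonneg z]
  have h0 : (0 : Fin 2 → ℂ) ∈ Metric.ball (0 : Fin 2 → ℂ) 1 := Metric.mem_ball_self one_pos
  have := Complex.dist_le_div_mul_dist_of_mapsTo_ball (R₂ := 2 * M) hg
    (fun w hw => by
      rw [mem_closedBall_iff_norm]
      have h1 := hM _ (hmem w hw)
      have h2 := hM _ (hmem 0 h0)
      exact (norm_sub_le _ _).trans (by linarith)) (z := z • v.1) (by simpa using hzv)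
  rw [dist_eq_norm, dist_zero_right, norm_smul, add_zero] at this
  have e1 : p + z • v = (p.1 + z • v.1, p.2 + z * v.2) := by ext1 <;> simp
  have e2 : p + z • ((0, v.2) : ActC) = (p.1, p.2 + z * v.2) := by ext1 <;> simp
  rw [e1, e2]
  have hM0 : 0 ≤ M := (norm_nonneg _).trans (hM _ (hmem 0 h0))
  refine this.trans ?_
  rw [div_one]
  gcongr
  nlinarith [norm_nonneg z, norm_nonneg v.1]

lemma hasDerivAt_secN2_vertical {s v₂ : ℝ} (hL : L₁ ≠ 0) (hs : L₁ - (t + s * v₂) ≠ 0) :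
    HasDerivAt (fun z : ℂ => secN2 P G (cpt L₀ L₁ t + z • ((0, (v₂ : ℂ)) : ActC)))
      ((quadD1 P G L₀ L₁ (t + s * v₂) * v₂ : ℝ) : ℂ) (s : ℂ) := by
  have h1 : HasDerivAt (fun z : ℂ => (t : ℂ) + z * (v₂ : ℂ)) (v₂ : ℂ) (s : ℂ) := by
    simpa using ((hasDerivAt_id (s : ℂ)).mul_const (v₂ : ℂ)).const_add (t : ℂ)
  have h2 := QuadRange.hasDerivAt_secN2 (P := P) (G := G) (L₀ := L₀) hL hs (cpt L₀ L₁ t).1 rfl rfl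
  have h3 : ((t + s * v₂ : ℝ) : ℂ) = (t : ℂ) + s * v₂ := by push_cast; rfl
  rw [h3] at h2
  have h4 := HasDerivAt.comp (h₂ := fun τ : ℂ => secN2 P G ((cpt L₀ L₁ t).1, τ)) (s : ℂ) h2 h1
  rw [Complex.ofReal_mul]
  refine h4.congr_of_eventuallyEq (Filter.Eventually.of_forall fun z => ?_)
  simp only [Function.comp]
  congr 1
  ext1 <;> simp

/-- Expansion of the derivative of the quadrupole term along a line almost parallel to the
`t`-axis. -/
lemma exists_quadratic_expansion_secN2 (hP : 0 < P)
    (h : ∀ t ∈ Set.Ioo 0 T, QuadRange W X T G L₀ L₁ t) (ht : t ∈ Set.Ioo 0 T) {M : ℝ}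
    (hM : ∀ q ∈ polydisc (cpt L₀ L₁ t) 1, ‖secN2 P G q‖ ≤ M) {v₀ v₁ v₂ : ℝ}
    (hv0 : |v₀| ≤ 1) (hv1 : |v₁| ≤ 1) (hv2 : |v₂| ≤ 1) :
    ∃ Q : ℝ, ∀ s : ℝ, |s| < 1 / 2 → t + s * v₂ ∈ Set.Ioo 0 T → ∃ R₁ : ℝ,
      27 * P * L₀ ^ 2 / L₁ ^ 7 ≤ R₁ ∧ R₁ ≤ 1600 * P * L₀ ^ 2 / L₁ ^ 7 ∧
      |(fderiv ℂ (secN2 P G) (cpt L₀ L₁ t + (s : ℂ) • cpt v₀ v₁ v₂) (cpt v₀ v₁ v₂)).re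
        - (fderiv ℂ (secN2 P G) (cpt L₀ L₁ t) (cpt v₀ v₁ v₂)).re - s * Q
        - s ^ 2 * (v₂ ^ 3 * (R₁ / 2))| ≤ 128 * M * max |v₀| |v₁| * s ^ 2 := by
  have hq := h t ht
  obtain ⟨v, hv⟩ : ∃ v, v = cpt v₀ v₁ v₂ := ⟨_, rfl⟩
  obtain ⟨p, hp⟩ : ∃ p, p = cpt L₀ L₁ t := ⟨_, rfl⟩
  have hvn : ‖v.1‖ = max |v₀| |v₁| := hv ▸ norm_cpt_fst _ _ _
  have hv22 : v.2 = v₂ := hv ▸ rfl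
  have hv2n : ‖v.2‖ = |v₂| := hv ▸ norm_cpt_snd _ _ _
  rw [← hp] at hM
  rw [← hv, ← hp]
  have hv1' : ‖v.1‖ ≤ 1 := by rw [hvn]; exact max_le hv0 hv1
  have hv2' : ‖v.2‖ ≤ 1 := by rw [hv2n]; exact hv2
  have hqa : AnalyticOnNhd ℂ (secN2 P G) (polydisc p 1) := hp ▸ hq.analyticOnNhd_secN2
  have hmem : ∀ z ∈ Metric.ball (0 : ℂ) 1, p + z • v ∈ polydisc p 1 := fun z hz =>
    add_smul_mem_polydisc one_pos hv1' hv2' (by simpa using hz)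
  have hmem' : ∀ z ∈ Metric.ball (0 : ℂ) 1, p + z • ((0, v.2) : ActC) ∈ polydisc p 1 :=
    fun z hz => add_smul_mem_polydisc (v := ((0, v.2) : ActC)) one_pos
      (norm_zero.trans_le zero_le_one) hv2' (by simpa using hz)
  have hder : ∀ z ∈ Metric.ball (0 : ℂ) 1, HasDerivAt (fun z : ℂ => secN2 P G (p + z • v))
      (fderiv ℂ (secN2 P G) (p + z • v) v) z :=
    fun z hz => hasDerivAt_line (hqa _ (hmem z hz))
  have hder' : ∀ z ∈ Metric.ball (0 : ℂ) 1,
      DifferentiableAt ℂ (fun z : ℂ => secN2 P G (p + z • ((0, v.2) : ActC))) z :=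
    fun z hz => (hasDerivAt_line (hqa _ (hmem' z hz))).differentiableAt
  have hne : ∀ t ∈ Set.Ioo 0 T, L₁ - t ≠ 0 := fun t ht => by
    have := (h t ht).le_L₁; have := (h t ht).X_nonneg; have := (h t ht).L₀_pos
    have := (h t ht).L₀_le; have := ht.1; have := ht.2
    intro; linarith
  have hm : ∀ s : ℝ, t + s * v₂ ∈ Set.Ioo 0 T →
      HasDerivAt (fun z : ℂ => secN2 P G (p + z • ((0, v.2) : ActC)))
        ((quadD1 P G L₀ L₁ (t + s * v₂) * v₂ : ℝ) : ℂ) (s : ℂ) := fun s hs => by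
    rw [hv22, hp]
    exact hasDerivAt_secN2_vertical hq.L₁_pos.ne' (hne _ hs)
  have hq3 : ∀ s ∈ Set.Ioo 0 T, 27 * P * L₀ ^ 2 / L₁ ^ 7 ≤ quadD3 P G L₀ L₁ s ∧
      quadD3 P G L₀ L₁ s ≤ 1600 * P * L₀ ^ 2 / L₁ ^ 7 := fun s hs => by
    have hh := h s hs
    have := hh.X_nonneg; have := hh.L₀_le; have := hh.L₀_pos; have := hh.t_lt; have := hh.le_L₁
    have := hh.t_pos
    exact quadD3_bounds hP hh.L₀_pos hh.X_nonneg hh.abs_le hh.t_pos.le (by linarith)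
      (by linarith)
  -- Difference between the function on the line and on its vertical projection. The vertical part
  -- is expanded with the explicit derivatives in `t`; `d` is bounded by `2 * M * max |v₀| |v₁|`,
  -- whence the constant `128 = 64 * 2`.
  set d : ℂ → ℂ := fun z => secN2 P G (p + z • v) - secN2 P G (p + z • ((0, v.2) : ActC)) with hd
  refine ⟨(deriv (deriv d) 0).re + quadD2 P G L₀ L₁ t * v₂ * v₂, fun s hs hts => ?_⟩
  obtain ⟨R₁, hR1, hR2, hR⟩ := exists_taylor_remainder (g := quadD1 P G L₀ L₁)
    (g' := quadD2 P G L₀ L₁) (g'' := quadD3 P G L₀ L₁) (m₁ := 27 * P * L₀ ^ 2 / L₁ ^ 7)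
    (m₂ := 1600 * P * L₀ ^ 2 / L₁ ^ 7) ht hts
    (fun s hs => hasDerivAt_quadD1 P G L₀ L₁ (hne s hs))
    (fun s hs => hasDerivAt_quadD2 P G L₀ L₁ (hne s hs))
    (fun s hs => (hq3 s hs).1) (fun s hs => (hq3 s hs).2)
  refine ⟨R₁, hR1, hR2, ?_⟩
  have hs' : ‖(s : ℂ)‖ < 1 / 2 := by rwa [Complex.norm_real]
  have hsb : (s : ℂ) ∈ Metric.ball (0 : ℂ) 1 := by rw [mem_ball_zero_iff]; linarith
  have h0b : (0 : ℂ) ∈ Metric.ball (0 : ℂ) 1 := Metric.mem_ball_self one_pos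
  have htay := norm_deriv_taylor_le (f := d) (M := 2 * M * max |v₀| |v₁|)
    (fun z hz => ((hder z hz).differentiableAt.sub (hder' z hz)).differentiableWithinAt)
    (fun z hz => by
      have := secN2_line_sub_le (z := z) hq (hp ▸ hM) hv1' hv2' (by simpa using hz)
      rwa [hvn, ← hp] at this) hs'
  have hm0 := hm 0 (by simpa using ht)
  rw [Complex.ofReal_zero, zero_mul, add_zero] at hm0
  have hds := ((hder s hsb).sub (hm s hts)).deriv
  have hd0 := ((hder 0 h0b).sub hm0).deriv
  change deriv d s = _ at hds
  change deriv d 0 = _ at hd0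
  rw [hds, hd0, zero_smul, add_zero,
    Complex.norm_real, Real.norm_eq_abs, sq_abs] at htay
  have hre := (Complex.abs_re_le_norm _).trans htay
  simp only [Complex.sub_re, Complex.ofReal_re, Complex.re_ofReal_mul] at hre
  have hR' : quadD1 P G L₀ L₁ (t + s * v₂) = quadD1 P G L₀ L₁ t
      + quadD2 P G L₀ L₁ t * (s * v₂) + (s * v₂) ^ 2 * (R₁ / 2) := by linarith
  rw [hR'] at hre
  refine le_trans (le_of_eq ?_) (hre.trans (le_of_eq ?_))
  · congr 1; ring
  · ring

/-! ### Steepness from estimates on the gradient -/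

/-- The space of the actions `(Λ₁, Λ₂, t)`. -/
abbrev ActR := EuclideanSpace ℝ (Fin 3)

/-- Estimates on a gradient field `g` that imply steepness: `ω₀`, `ω₁` are Keplerian frequencies
and `n` is the gradient of the secular perturbation; `b` and `ν` stand for `√α` and `μ^(1/4)`. -/
structure SteepEstimates (V : Set ActR) (g : ActR → ActR) (ω₀ ω₁ : ℝ → ℝ)
    (n : ActR → ActR →ₗ[ℝ] ℝ) (b ν c B D θ : ℝ) : Prop where
  inner_eq : ∀ I ∈ V, ∀ v, inner ℝ (g I) v = ω₀ (I 0) * v 0 + ω₁ (I 1) * v 1 + n I v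
  abs_le_of_orthogonal : ∀ I ∈ V, ∀ v, inner ℝ (g I) v = 0 →
    |v 0| ≤ D * (b ^ 3 * |v 1| + ν ^ 4 * b ^ 6 * |v 2|)
  lip₀ : ∀ I ∈ V, ∀ J ∈ V, |ω₀ (J 0) - ω₀ (I 0)| ≤ B * |J 0 - I 0|
  concave₁ : ∀ I ∈ V, ∀ J ∈ V,
    c * b ^ 4 * (J 1 - I 1) ^ 2 ≤ -((J 1 - I 1) * (ω₁ (J 1) - ω₁ (I 1)))
  taylor₀ : ∀ I ∈ V, ∃ q, ∀ J ∈ V,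
    |ω₀ (J 0) - ω₀ (I 0) - q * (J 0 - I 0)| ≤ B * (J 0 - I 0) ^ 2
  taylor₁ : ∀ I ∈ V, ∃ q, ∀ J ∈ V,
    |ω₁ (J 1) - ω₁ (I 1) - q * (J 1 - I 1)| ≤ B * b ^ 5 * (J 1 - I 1) ^ 2
  lip : ∀ I ∈ V, ∀ J ∈ V, ∀ v, |n J v - n I v| ≤ B * (ν ^ 4 * b ^ 6) *
    ((|v 0| + |v 1|) / ν + |v 2|) * ((|J 0 - I 0| + |J 1 - I 1|) / ν + |J 2 - I 2|)
  convex : ∀ I ∈ V, ∀ J ∈ V, c * (ν ^ 4 * b ^ 6) * (J 2 - I 2) ^ 2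
    - B * (ν ^ 3 * b ^ 6) * (|J 0 - I 0| + |J 1 - I 1|) * |J 2 - I 2|
      ≤ (J 2 - I 2) * (n J (EuclideanSpace.single 2 1) - n I (EuclideanSpace.single 2 1))
  taylor : ∀ I ∈ V, ∀ v : ActR, |v 0| + |v 1| ≤ θ * b * ν → 1 / 2 ≤ |v 2| → |v 2| ≤ 1 →
    ∃ Q : ℝ, ∀ s : ℝ, |s| < 1 / 2 → I + s • v ∈ V → ∃ R : ℝ, c * (ν ^ 4 * b ^ 7) ≤ |R| ∧
      |R| ≤ B * (ν ^ 4 * b ^ 7) ∧ n (I + s • v) v - n I v = s * Q + s ^ 2 * R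

section Scalar

variable {b ν c B D X Y Z Z' : ℝ}

/-- Gathers the errors of the gradient expansion: the inner Kepler term, and the mixed secular
terms, where `2 * X + ν ^ 4 * Y` bounds a horizontal displacement. The cross term splits as `2ν³XY ≤
νX² + ν⁵Y²`, which leaves a spare factor `ν` against both main forms. -/
lemma error_le (hb : 0 < b) (hν : 0 < ν) (hc : 0 < c) (hc1 : c ≤ 1) (hB : 1 ≤ B) (hD : 1 ≤ D)
    (hbc : 100 * (B * D ^ 2) * b ≤ c) (hνc : 100 * (B * D ^ 2) * ν ≤ c) :
    B * (D * (b ^ 3 * X + ν ^ 4 * b ^ 6 * Y)) ^ 2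
      + B * b ^ 6 * (ν ^ 2 * (2 * X + ν ^ 4 * Y) ^ 2 + 2 * ν ^ 3 * (2 * X + ν ^ 4 * Y) * Y)
      ≤ c / 2 * (b ^ 4 * X ^ 2 + ν ^ 4 * b ^ 6 * Y ^ 2) := by
  have hBD : 1 ≤ B * D ^ 2 := one_le_mul_of_one_le_of_one_le hB (one_le_pow₀ hD)
  have hBBD : B ≤ B * D ^ 2 := le_mul_of_one_le_right (by linarith) (one_le_pow₀ hD)
  have hb1 : b ≤ 1 := by nlinarith
  have hν1 : ν ≤ 1 := by nlinarith
  have hb2 : b ^ 2 ≤ b := by nlinarith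
  have hν2 : ν ^ 2 ≤ ν := by nlinarith
  have hν4 : ν ^ 4 ≤ ν := by
    calc ν ^ 4 ≤ ν ^ 1 := pow_le_pow_of_le_one hν.le hν1 (by norm_num)
      _ = ν := pow_one ν
  have hb6 : b ^ 6 ≤ 1 := pow_le_one₀ hb.le hb1
  have hZ : B * (D * (b ^ 3 * X + ν ^ 4 * b ^ 6 * Y)) ^ 2
      ≤ c / 50 * (b ^ 4 * X ^ 2 + ν ^ 4 * b ^ 6 * Y ^ 2) := by
    have h1 : (b ^ 3 * X + ν ^ 4 * b ^ 6 * Y) ^ 2 ≤ 2 * (b ^ 3 * X) ^ 2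
        + 2 * (ν ^ 4 * b ^ 6 * Y) ^ 2 := by nlinarith [sq_nonneg (b ^ 3 * X - ν ^ 4 * b ^ 6 * Y)]
    have h2 : (B * D ^ 2) * b ^ 2 ≤ c / 100 := by
      have := mul_le_mul_of_nonneg_left hb2 (by linarith : 0 ≤ B * D ^ 2)
      linarith
    have h3 : (B * D ^ 2) * (ν ^ 4 * b ^ 6) ≤ c / 100 := by
      have : ν ^ 4 * b ^ 6 ≤ ν := by
        calc _ ≤ ν * 1 := mul_le_mul hν4 hb6 (by positivity) hν.le
          _ = ν := mul_one ν
      have := mul_le_mul_of_nonneg_left this (by linarith : 0 ≤ B * D ^ 2)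
      linarith
    calc _ = B * D ^ 2 * (b ^ 3 * X + ν ^ 4 * b ^ 6 * Y) ^ 2 := by ring
      _ ≤ B * D ^ 2 * (2 * (b ^ 3 * X) ^ 2 + 2 * (ν ^ 4 * b ^ 6 * Y) ^ 2) := by gcongr
      _ = 2 * (B * D ^ 2 * b ^ 2) * (b ^ 4 * X ^ 2)
          + 2 * (B * D ^ 2 * (ν ^ 4 * b ^ 6)) * (ν ^ 4 * b ^ 6 * Y ^ 2) := by ring
      _ ≤ 2 * (c / 100) * (b ^ 4 * X ^ 2) + 2 * (c / 100) * (ν ^ 4 * b ^ 6 * Y ^ 2) := by gcongr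
      _ = _ := by ring
  have hT : ν ^ 2 * (2 * X + ν ^ 4 * Y) ^ 2 + 2 * ν ^ 3 * (2 * X + ν ^ 4 * Y) * Y
      ≤ 10 * ν * X ^ 2 + 6 * ν ^ 5 * Y ^ 2 := by
    have h1 : (2 * X + ν ^ 4 * Y) ^ 2 ≤ 8 * X ^ 2 + 2 * ν ^ 8 * Y ^ 2 := by
      nlinarith [sq_nonneg (2 * X - ν ^ 4 * Y)]
    have h2 : 2 * ν ^ 3 * X * Y ≤ ν * X ^ 2 + ν ^ 5 * Y ^ 2 := by
      nlinarith [mul_nonneg hν.le (sq_nonneg (X - ν ^ 2 * Y))]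
    have h3 : ν ^ 7 ≤ ν ^ 5 := pow_le_pow_of_le_one hν.le hν1 (by norm_num)
    have h4 : ν ^ 10 ≤ ν ^ 5 := pow_le_pow_of_le_one hν.le hν1 (by norm_num)
    have h5 := mul_le_mul_of_nonneg_right h3 (sq_nonneg Y)
    have h6 := mul_le_mul_of_nonneg_right h4 (sq_nonneg Y)
    have h7 := mul_le_mul_of_nonneg_right hν2 (sq_nonneg X)
    have h8 := mul_le_mul_of_nonneg_left h1 (sq_nonneg ν)
    nlinarith
  have hE : B * b ^ 6 * (ν ^ 2 * (2 * X + ν ^ 4 * Y) ^ 2 + 2 * ν ^ 3 * (2 * X + ν ^ 4 * Y) * Y)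
      ≤ c / 10 * (b ^ 4 * X ^ 2 + ν ^ 4 * b ^ 6 * Y ^ 2) := by
    have h2 : B * ν ≤ c / 100 := by
      have := mul_le_mul_of_nonneg_right hBBD hν.le
      linarith
    have h3 : b ^ 6 ≤ b ^ 4 := pow_le_pow_of_le_one hb.le hb1 (by norm_num)
    calc _ ≤ B * b ^ 6 * (10 * ν * X ^ 2 + 6 * ν ^ 5 * Y ^ 2) := by gcongr
      _ = 10 * (B * ν) * (b ^ 6 * X ^ 2) + 6 * (B * ν) * (ν ^ 4 * b ^ 6 * Y ^ 2) := by ring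
      _ ≤ 10 * (c / 100) * (b ^ 4 * X ^ 2) + 10 * (c / 100) * (ν ^ 4 * b ^ 6 * Y ^ 2) := by
        gcongr
        norm_num
      _ = _ := by ring
  have h0 : 0 ≤ c * (b ^ 4 * X ^ 2 + ν ^ 4 * b ^ 6 * Y ^ 2) := by positivity
  linarith

/-- The first component of a vector orthogonal to the gradient is small. -/
lemma add_le_of_le (hb : 0 < b) (hν : 0 < ν) (hc1 : c ≤ 1) (hB : 1 ≤ B) (hD : 1 ≤ D)
    (hbc : 100 * (B * D ^ 2) * b ≤ c) (hX : 0 ≤ X) (hY : 0 ≤ Y)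
    (hZ : Z ≤ D * (b ^ 3 * X + ν ^ 4 * b ^ 6 * Y)) : Z ≤ b * (X + ν ^ 4 * Y) ∧ 100 * b ≤ 1 := by
  have hDB : D ≤ B * D ^ 2 := by nlinarith
  have hb1 : 100 * (D * b) ≤ 1 := by
    have := mul_le_mul_of_nonneg_right hDB hb.le
    linarith
  have hb0 : 100 * b ≤ 1 := by nlinarith
  refine ⟨hZ.trans ?_, hb0⟩
  have h1 : D * b ^ 3 ≤ b := by
    have : D * b ^ 3 = (D * b) * b * b := by ring
    rw [this]
    have : (D * b) * b ≤ 1 := by nlinarith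
    nlinarith
  have h2 : D * b ^ 6 ≤ b := by
    have h3 : b ^ 3 ≤ 1 := pow_le_one₀ hb.le (by linarith)
    have : D * b ^ 6 = (D * b ^ 3) * b ^ 3 := by ring
    rw [this]
    have : 0 ≤ D * b ^ 3 := by positivity
    nlinarith
  have h3 : 0 ≤ ν ^ 4 * Y := by positivity
  calc _ = D * b ^ 3 * X + D * b ^ 6 * (ν ^ 4 * Y) := by ring
    _ ≤ b * X + b * (ν ^ 4 * Y) := by gcongr
    _ = _ := by ring

/-- Among two radii there is one at which a quadratic polynomial without constant term is large. -/
lemma exists_radius {c₀ C₀ ξ Q : ℝ} (hc₀ : 0 < c₀) (hC₀ : c₀ ≤ C₀) (hξ : 0 < ξ) :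
    ∃ η, 0 ≤ η ∧ η ≤ ξ ∧ ∀ s R : ℝ, |s| = η → c₀ ≤ |R| → |R| ≤ C₀ →
      c₀ ^ 2 / (16 * C₀) * ξ ^ 2 ≤ |s * Q + s ^ 2 * R| := by
  have hC : 0 < C₀ := hc₀.trans_le hC₀
  -- If the slope is small the quadratic term dominates at radius `ξ`. Otherwise, at radius `ξ * (c₀
  -- / (4 * C₀))`, the quadratic term is at most half of the linear one.
  rcases le_or_gt |Q| (c₀ * ξ / 2) with h | h
  · refine ⟨ξ, hξ.le, le_rfl, fun s R hs hR _ => ?_⟩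
    rw [show s * Q + s ^ 2 * R = s * (s * R - -Q) by ring, abs_mul, hs]
    have h1 := abs_sub_abs_le_abs_sub (s * R) (-Q)
    rw [abs_mul, hs, abs_neg] at h1
    have h2 : c₀ ^ 2 / (16 * C₀) ≤ c₀ / 2 := by
      rw [div_le_div_iff₀ (by positivity) two_pos]; nlinarith
    have h3 : c₀ * ξ / 2 ≤ |s * R - -Q| := by nlinarith
    calc _ ≤ c₀ / 2 * ξ ^ 2 := by gcongr
      _ = ξ * (c₀ * ξ / 2) := by ring
      _ ≤ _ := by gcongr
  · have hle : c₀ / (4 * C₀) ≤ 1 := by rw [div_le_one (by positivity)]; linarith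
    refine ⟨ξ * (c₀ / (4 * C₀)), by positivity, by nlinarith, fun s R hs _ hR => ?_⟩
    rw [show s * Q + s ^ 2 * R = s * (Q - -(s * R)) by ring, abs_mul, hs]
    have h1 := abs_sub_abs_le_abs_sub Q (-(s * R))
    rw [abs_neg, abs_mul, hs] at h1
    have h2 : ξ * (c₀ / (4 * C₀)) * |R| ≤ c₀ * ξ / 4 := by
      calc _ ≤ ξ * (c₀ / (4 * C₀)) * C₀ := by gcongr
        _ = _ := by field_simp
    have h3 : c₀ * ξ / 4 ≤ |Q - -(s * R)| := by linarith
    calc _ = ξ * (c₀ / (4 * C₀)) * (c₀ * ξ / 4) := by field_simp; norm_num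
      _ ≤ _ := by gcongr

end Scalar

/-- A test vector in `L` sees only the projection, so a single well chosen `u` bounds the projected
gradient from below. -/
lemma inner_le_norm_starProjection_mul {L : Submodule ℝ ActR} {u : ActR} (hu : u ∈ L) (x : ActR) :
    |inner ℝ x u| ≤ ‖L.starProjection x‖ * ‖u‖ := by
  have h : inner ℝ (L.starProjection x) u = inner ℝ x u := by
    rw [Submodule.inner_starProjection_left_eq_right, Submodule.starProjection_eq_self_iff.2 hu]
  rw [← h]
  exact abs_real_inner_le_norm _ _

lemma norm_sq_actR (v : ActR) : ‖v‖ ^ 2 = v 0 ^ 2 + v 1 ^ 2 + v 2 ^ 2 := by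
  rw [EuclideanSpace.norm_sq_eq, Fin.sum_univ_three]; simp

lemma eq_horizontal_add_vertical (v : ActR) :
    v = !₂[v 0, v 1, 0] + v 2 • EuclideanSpace.single 2 (1 : ℝ) := by
  ext i; fin_cases i <;> simp

/-! ### Planes and lines on which the Kepler part decides. -/

namespace SteepEstimates

variable {V : Set ActR} {g : ActR → ActR} {ω₀ ω₁ : ℝ → ℝ} {n : ActR → ActR →ₗ[ℝ] ℝ}
  {b ν c B D θ : ℝ} {I J u v : ActR}

lemma abs_zero_le (h : SteepEstimates V g ω₀ ω₁ n b ν c B D θ) (hb : 0 < b) (hν : 0 < ν)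
    (hc1 : c ≤ 1) (hB : 1 ≤ B) (hD : 1 ≤ D) (hbc : 100 * (B * D ^ 2) * b ≤ c) (hI : I ∈ V)
    (hv : inner ℝ (g I) v = 0) : |v 0| ≤ b * (|v 1| + ν ^ 4 * |v 2|) ∧ 100 * b ≤ 1 :=
  add_le_of_le hb hν hc1 hB hD hbc (abs_nonneg _) (abs_nonneg _) (h.abs_le_of_orthogonal I hI v hv)

/-- Orthogonality to the gradient makes `v 0` negligible, so lengths can be measured by the last two
coordinates. -/
lemma norm_sq_le (h : SteepEstimates V g ω₀ ω₁ n b ν c B D θ) (hb : 0 < b) (hν : 0 < ν)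
    (hν1 : ν ≤ 1) (hc1 : c ≤ 1) (hB : 1 ≤ B) (hD : 1 ≤ D) (hbc : 100 * (B * D ^ 2) * b ≤ c)
    (hI : I ∈ V) (hv : inner ℝ (g I) v = 0) : ‖v‖ ^ 2 ≤ 2 * (v 1 ^ 2 + v 2 ^ 2) := by
  obtain ⟨h1, h2⟩ := h.abs_zero_le hb hν hc1 hB hD hbc hI hv
  have h3 : |v 0| ≤ (|v 1| + |v 2|) / 2 := by
    have h4 : ν ^ 4 * |v 2| ≤ |v 2| := mul_le_of_le_one_left (abs_nonneg _) (pow_le_one₀ hν.le hν1)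
    have h5 : b * (|v 1| + ν ^ 4 * |v 2|) ≤ 1 / 2 * (|v 1| + |v 2|) := by
      have := abs_nonneg (v 1)
      have := abs_nonneg (v 2)
      have : 0 ≤ ν ^ 4 * |v 2| := by positivity
      nlinarith
    linarith
  have h4 : v 0 ^ 2 ≤ ((|v 1| + |v 2|) / 2) ^ 2 := by
    rw [← sq_abs (v 0)]; exact pow_le_pow_left₀ (abs_nonneg _) h3 2
  rw [norm_sq_actR]
  nlinarith [sq_nonneg (|v 1| - |v 2|), sq_abs (v 1), sq_abs (v 2)]

/-- Expansion of the gradient at `J` along a vector orthogonal to the gradient at `I`. -/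
lemma exists_inner_eq (h : SteepEstimates V g ω₀ ω₁ n b ν c B D θ) (hb : 0 < b) (hν : 0 < ν)
    (hc : 0 < c) (hc1 : c ≤ 1) (hB : 1 ≤ B) (hD : 1 ≤ D) (hbc : 100 * (B * D ^ 2) * b ≤ c)
    (hνc : 100 * (B * D ^ 2) * ν ≤ c) (hI : I ∈ V) (hJ : J ∈ V) (hu : inner ℝ (g I) u = 0)
    (hJI : inner ℝ (g I) (J - I) = 0) (hu1 : |u 1| = |J 1 - I 1|) (hu2 : u 2 = J 2 - I 2) :
    ∃ E : ℝ, inner ℝ (g J) u = u 1 * (ω₁ (J 1) - ω₁ (I 1))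
        + (J 2 - I 2) * (n J (EuclideanSpace.single 2 1) - n I (EuclideanSpace.single 2 1)) + E ∧
      |E| + B * (ν ^ 3 * b ^ 6) * (|J 0 - I 0| + |J 1 - I 1|) * |J 2 - I 2|
        ≤ c / 2 * (b ^ 4 * (J 1 - I 1) ^ 2 + ν ^ 4 * b ^ 6 * (J 2 - I 2) ^ 2) := by
  obtain ⟨a1, hb1⟩ := h.abs_zero_le hb hν hc1 hB hD hbc hI hu
  obtain ⟨a2, -⟩ := h.abs_zero_le hb hν hc1 hB hD hbc hI hJI
  have z1 := h.abs_le_of_orthogonal I hI u hu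
  have z2 := h.abs_le_of_orthogonal I hI _ hJI
  simp only [PiLp.sub_apply] at a2 z2
  rw [hu1, hu2] at a1 z1
  set X := |J 1 - I 1| with hX
  set Y := |J 2 - I 2| with hY
  set d := |J 0 - I 0| with hd
  have hX0 : 0 ≤ X := abs_nonneg _
  have hY0 : 0 ≤ Y := abs_nonneg _
  have hd0 : 0 ≤ d := abs_nonneg _
  set w : ActR := !₂[u 0, u 1, 0] with hw
  -- The vanishing product with the gradient at `I` is subtracted. The remainder is the inner Kepler
  -- increment and the secular increment along the horizontal part `w` of `u`. Since only `|u 1|` is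
  -- prescribed, `u` may be `J - I` or its reflection.
  refine ⟨u 0 * (ω₀ (J 0) - ω₀ (I 0)) + (n J w - n I w), ?_, ?_⟩
  · have e1 := h.inner_eq J hJ u
    have e2 := h.inner_eq I hI u
    have e3 : ∀ K, n K u = n K w + u 2 * n K (EuclideanSpace.single 2 1) := fun K => by
      conv_lhs => rw [eq_horizontal_add_vertical u, map_add, map_smul, smul_eq_mul]
    rw [e3] at e1 e2
    rw [← hu2]
    linear_combination e1 - e2 + hu
  · have k1 : |u 0 * (ω₀ (J 0) - ω₀ (I 0))|
        ≤ B * (D * (b ^ 3 * X + ν ^ 4 * b ^ 6 * Y)) ^ 2 := by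
      rw [abs_mul]
      have := h.lip₀ I hI J hJ
      calc _ ≤ (D * (b ^ 3 * X + ν ^ 4 * b ^ 6 * Y)) *
            (B * (D * (b ^ 3 * X + ν ^ 4 * b ^ 6 * Y))) := by
            refine mul_le_mul z1 (this.trans ?_) (abs_nonneg _) (by positivity)
            gcongr
        _ = _ := by ring
    have t1 : b * (X + ν ^ 4 * Y) ≤ X + ν ^ 4 * Y := by
      have : 0 ≤ X + ν ^ 4 * Y := by positivity
      nlinarith
    set T := 2 * X + ν ^ 4 * Y with hT
    have t2 : |u 0| + X ≤ T := by linarith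
    have t3 : d + X ≤ T := by linarith
    have hT0 : 0 ≤ T := by positivity
    have k2 : |n J w - n I w| ≤ B * b ^ 6 * (ν ^ 2 * T ^ 2 + ν ^ 3 * T * Y) := by
      have := h.lip I hI J hJ w
      have hw0 : w 0 = u 0 := rfl
      have hw1 : w 1 = u 1 := rfl
      have hw2 : w 2 = 0 := rfl
      rw [hw0, hw1, hw2, abs_zero, add_zero, hu1] at this
      calc _ ≤ _ := this
        _ ≤ B * (ν ^ 4 * b ^ 6) * (T / ν) * (T / ν + Y) := by gcongr
        _ = _ := by field_simp
    have k3 : B * (ν ^ 3 * b ^ 6) * (d + X) * Y ≤ B * b ^ 6 * (ν ^ 3 * T * Y) := by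
      calc _ ≤ B * (ν ^ 3 * b ^ 6) * T * Y := by gcongr
        _ = _ := by ring
    have k4 := error_le (X := X) (Y := Y) hb hν hc hc1 hB hD hbc hνc
    rw [← hT] at k4
    rw [← sq_abs (J 1 - I 1), ← sq_abs (J 2 - I 2), ← hX, ← hY]
    have := abs_add_le (u 0 * (ω₀ (J 0) - ω₀ (I 0))) (n J w - n I w)
    linarith

/-- A lower bound for the gradient along a vector of `L` gives one for the projected gradient. -/
lemma lt_norm_starProjection {k m S ξ : ℝ} {L : Submodule ℝ ActR} {x : ActR} (hb : 0 < b)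
    (hb1 : b ≤ 1) (hk : 0 < k) (hm : 0 < m) (hu : u ∈ L) (huS : ‖u‖ ^ 2 ≤ 2 * S)
    (hξS : ξ ^ 2 ≤ 2 * S) (hξ : 0 < ξ) (hξb : ξ ≤ b)
    (hx : 4 * k * (m * b ^ 2) * S ≤ |inner ℝ x u|) : m * k * ξ ^ 5 < ‖L.starProjection x‖ := by
  have hS : 0 < S := by nlinarith
  by_contra hcon
  push Not at hcon
  have h1 := hx.trans (inner_le_norm_starProjection_mul hu x)
  -- The natural bound here is linear in `ξ` with coefficient of order `m * b ^ 2`; it is weakened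
  -- to the exponent 5 imposed by the resonant lines.
  have h2 : ξ ^ 5 ≤ b ^ 2 * ξ := by
    have h3 : ξ ^ 2 ≤ b ^ 2 := pow_le_pow_left₀ hξ.le hξb 2
    have h4 : ξ ^ 2 ≤ 1 := pow_le_one₀ hξ.le (hξb.trans hb1)
    calc ξ ^ 5 = ξ ^ 2 * ξ ^ 2 * ξ := by ring
      _ ≤ 1 * b ^ 2 * ξ := by gcongr
      _ = _ := by ring
  have h3 : ξ * ‖u‖ ≤ 2 * S := by nlinarith [sq_nonneg (ξ - ‖u‖)]
  have h4 : ‖L.starProjection x‖ * ‖u‖ ≤ k * (m * b ^ 2) * (2 * S) := by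
    calc _ ≤ (m * k * ξ ^ 5) * ‖u‖ := by gcongr
      _ ≤ (m * k * (b ^ 2 * ξ)) * ‖u‖ := by gcongr
      _ = k * (m * b ^ 2) * (ξ * ‖u‖) := by ring
      _ ≤ _ := by gcongr
  have h5 : 0 < k * (m * b ^ 2) * S := by positivity
  nlinarith

/-- Flipping the sign of the second component turns the indefinite form into a definite one, and a
plane always contains the flipped vector. -/
lemma steep_two (h : SteepEstimates V g ω₀ ω₁ n b ν c B D θ) (hb : 0 < b) (hν : 0 < ν)
    (hc : 0 < c) (hc1 : c ≤ 1) (hB : 1 ≤ B) (hD : 1 ≤ D) (hbc : 100 * (B * D ^ 2) * b ≤ c)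
    (hνc : 100 * (B * D ^ 2) * ν ≤ c) (hI : I ∈ V) {L : Submodule ℝ ActR}
    (hL : Module.finrank ℝ L = 2) (hLg : ∀ v ∈ L, inner ℝ (g I) v = 0) {ξ : ℝ} (hξ : 0 < ξ)
    (hξb : ξ ≤ b) (hJ : J ∈ V) (hJL : J - I ∈ L) (hJξ : ‖J - I‖ = ξ) :
    ν ^ 4 * b ^ 4 * (c / 8) * ξ ^ 5 < ‖L.starProjection (g J)‖ := by
  have hBD : 1 ≤ B * D ^ 2 := one_le_mul_of_one_le_of_one_le hB (one_le_pow₀ hD)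
  have hν1 : ν ≤ 1 := by nlinarith
  have hb1 : b ≤ 1 := by nlinarith
  -- Projection to the last two coordinates. It is injective because `v 0` is controlled by them,
  -- hence bijective by dimension.
  let A : L →ₗ[ℝ] (Fin 2 → ℝ) :=
    { toFun := fun v => ![v.1 1, v.1 2]
      map_add' := fun v w => by ext i; fin_cases i <;> simp
      map_smul' := fun r v => by ext i; fin_cases i <;> simp }
  have hA : Function.Injective A := by
    rw [← LinearMap.ker_eq_bot, LinearMap.ker_eq_bot']
    intro v hv
    have e1 : v.1 1 = 0 := congrFun hv 0
    have e2 : v.1 2 = 0 := congrFun hv 1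
    have := h.norm_sq_le hb hν hν1 hc1 hB hD hbc hI (hLg v v.2)
    rw [e1, e2] at this
    have h0 : ‖v.1‖ ^ 2 = 0 := le_antisymm (by simpa using this) (sq_nonneg _)
    exact Subtype.ext (norm_eq_zero.1 (pow_eq_zero_iff two_ne_zero |>.1 h0))
  obtain ⟨⟨u, huL⟩, hu⟩ := (LinearMap.injective_iff_surjective_of_finrank_eq_finrank
    (by rw [hL]; simp)).1 hA ![-(J 1 - I 1), J 2 - I 2]
  have hu1 : u 1 = -(J 1 - I 1) := congrFun hu 0
  have hu2 : u 2 = J 2 - I 2 := congrFun hu 1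
  obtain ⟨E, hE1, hE2⟩ := h.exists_inner_eq hb hν hc hc1 hB hD hbc hνc hI hJ (hLg u huL)
    (hLg _ hJL) (by rw [hu1, abs_neg]) hu2
  have c1 := h.concave₁ I hI J hJ
  have c2 := h.convex I hI J hJ
  have hν4 : ν ^ 4 * b ^ 6 ≤ b ^ 4 := by
    calc _ ≤ 1 * b ^ 4 := mul_le_mul (pow_le_one₀ hν.le hν1)
          (pow_le_pow_of_le_one hb.le hb1 (by norm_num)) (by positivity) zero_le_one
      _ = _ := one_mul _
  refine lt_norm_starProjection (S := (J 1 - I 1) ^ 2 + (J 2 - I 2) ^ 2) hb hb1 (by positivity)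
    (by positivity) huL ?_ ?_ hξ hξb ?_
  · have := h.norm_sq_le hb hν hν1 hc1 hB hD hbc hI (hLg u huL)
    rwa [hu1, hu2, neg_sq] at this
  · rw [← hJξ]
    exact h.norm_sq_le hb hν hν1 hc1 hB hD hbc hI (hLg _ hJL)
  · refine le_trans ?_ (le_abs_self _)
    rw [hE1, hu1]
    have := neg_abs_le E
    have h5 := mul_le_mul_of_nonneg_left (mul_le_mul_of_nonneg_right hν4 (sq_nonneg (J 1 - I 1)))
      hc.le
    have h6 : 0 ≤ c * (ν ^ 4 * b ^ 6 * (J 2 - I 2) ^ 2) := by positivity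
    linarith

/-- The factor `16 * B / c` makes the concave Kepler form at least 16 times the whole secular term
of order `B * ν ^ 4 * b ^ 6`, so no cancellation can occur. -/
lemma steep_one_of_le (h : SteepEstimates V g ω₀ ω₁ n b ν c B D θ) (hb : 0 < b) (hν : 0 < ν)
    (hc : 0 < c) (hc1 : c ≤ 1) (hB : 1 ≤ B) (hD : 1 ≤ D) (hbc : 100 * (B * D ^ 2) * b ≤ c)
    (hνc : 100 * (B * D ^ 2) * ν ≤ c) (hI : I ∈ V) {L : Submodule ℝ ActR}
    (hLg : ∀ v ∈ L, inner ℝ (g I) v = 0) {ξ : ℝ} (hξ : 0 < ξ)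
    (hξb : ξ ≤ b) (hJ : J ∈ V) (hJL : J - I ∈ L) (hJξ : ‖J - I‖ = ξ)
    (hle : 16 * B / c * ν ^ 2 * b * |J 2 - I 2| ≤ |J 1 - I 1|) :
    ν ^ 4 * b ^ 4 * (c / 32) * ξ ^ 5 < ‖L.starProjection (g J)‖ := by
  have hBD : 1 ≤ B * D ^ 2 := one_le_mul_of_one_le_of_one_le hB (one_le_pow₀ hD)
  have hν1 : ν ≤ 1 := by nlinarith
  have hb1 : b ≤ 1 := by nlinarith
  obtain ⟨E, hE1, hE2⟩ := h.exists_inner_eq (u := J - I) hb hν hc hc1 hB hD hbc hνc hI hJ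
    (hLg _ hJL) (hLg _ hJL) (by simp) (by simp)
  have c1 := h.concave₁ I hI J hJ
  have c2 : |(J 2 - I 2) * (n J (EuclideanSpace.single 2 1) - n I (EuclideanSpace.single 2 1))|
      ≤ B * (ν ^ 3 * b ^ 6) * (|J 0 - I 0| + |J 1 - I 1|) * |J 2 - I 2|
        + B * (ν ^ 4 * b ^ 6) * (J 2 - I 2) ^ 2 := by
    have := h.lip I hI J hJ (EuclideanSpace.single 2 1)
    have h0 : (EuclideanSpace.single 2 (1 : ℝ) : ActR) 0 = 0 := by simp
    have h1 : (EuclideanSpace.single 2 (1 : ℝ) : ActR) 1 = 0 := by simp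
    have h2 : (EuclideanSpace.single 2 (1 : ℝ) : ActR) 2 = 1 := by simp
    rw [h0, h1, h2, abs_zero, abs_one, zero_add, zero_div, zero_add, mul_one] at this
    rw [abs_mul, ← sq_abs (J 2 - I 2)]
    calc _ ≤ |J 2 - I 2| * (B * (ν ^ 4 * b ^ 6) *
          ((|J 0 - I 0| + |J 1 - I 1|) / ν + |J 2 - I 2|)) := by gcongr
      _ = _ := by field_simp
  have hν4 : ν ^ 4 * b ^ 6 ≤ b ^ 4 := by
    calc _ ≤ 1 * b ^ 4 := mul_le_mul (pow_le_one₀ hν.le hν1)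
          (pow_le_pow_of_le_one hb.le hb1 (by norm_num)) (by positivity) zero_le_one
      _ = _ := one_mul _
  have h5 := mul_le_mul_of_nonneg_right hν4 (sq_nonneg (J 1 - I 1))
  have h6 : 16 * B * (ν ^ 4 * b ^ 6 * (J 2 - I 2) ^ 2) ≤ c * (b ^ 4 * (J 1 - I 1) ^ 2) := by
    have hκ : 1 ≤ 16 * B / c := by rw [le_div_iff₀ hc]; linarith
    have h7 := pow_le_pow_left₀ (by positivity) hle 2
    rw [sq_abs, mul_pow, sq_abs] at h7
    have h8 : 16 * B / c * (ν ^ 4 * b ^ 2) ≤ (16 * B / c * ν ^ 2 * b) ^ 2 := by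
      calc 16 * B / c * (ν ^ 4 * b ^ 2) ≤ (16 * B / c) ^ 2 * (ν ^ 4 * b ^ 2) := by
            gcongr; nlinarith
        _ = _ := by ring
    calc _ = c * b ^ 4 * (16 * B / c * (ν ^ 4 * b ^ 2) * (J 2 - I 2) ^ 2) := by field_simp
      _ ≤ c * b ^ 4 * ((16 * B / c * ν ^ 2 * b) ^ 2 * (J 2 - I 2) ^ 2) := by gcongr
      _ ≤ c * b ^ 4 * (J 1 - I 1) ^ 2 := by gcongr
      _ = _ := by ring
  refine lt_norm_starProjection (S := (J 1 - I 1) ^ 2 + (J 2 - I 2) ^ 2) hb hb1 (by positivity)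
    (by positivity) hJL ?_ ?_ hξ hξb ?_
  · exact h.norm_sq_le hb hν hν1 hc1 hB hD hbc hI (hLg _ hJL)
  · rw [← hJξ]
    exact h.norm_sq_le hb hν hν1 hc1 hB hD hbc hI (hLg _ hJL)
  · refine le_trans ?_ (neg_le_abs _)
    rw [hE1, PiLp.sub_apply]
    have q1 := le_abs_self E
    have q2 := (le_abs_self _).trans c2
    have q3 : c * (ν ^ 4 * b ^ 6 * (J 2 - I 2) ^ 2)
        ≤ B * (ν ^ 4 * b ^ 6 * (J 2 - I 2) ^ 2) := by
      gcongr; linarith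
    have q4 := mul_le_mul_of_nonneg_left h5 hc.le
    have q5 : 0 ≤ c * (b ^ 4 * (J 1 - I 1) ^ 2) := by positivity
    linarith

end SteepEstimates

/-! ### Resonant lines and the conclusion of the steepness argument. -/

namespace SteepEstimates

variable {V : Set ActR} {g : ActR → ActR} {ω₀ ω₁ : ℝ → ℝ} {n : ActR → ActR →ₗ[ℝ] ℝ}
  {b ν c B D θ : ℝ} {I J u v : ActR}

/-- The gradient along a resonant direction, expanded to second order. -/
lemma exists_resonant_expansion (h : SteepEstimates V g ω₀ ω₁ n b ν c B D θ) (hb : 0 < b)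
    (hν : 0 < ν) (hc : 0 < c) (hc1 : c ≤ 1) (hB : 1 ≤ B) (hD : 1 ≤ D)
    (hbc : 100 * (B * D ^ 2) * b ≤ c) (hνc : 100 * (B * D ^ 2) * ν ≤ c)
    (hνθ : (32 * B / c + 1) * ν ≤ θ)
    (hν2 : B * ((16 * B / c) ^ 3 + (D * (16 * B / c + 1)) ^ 3) * ν ≤ c / 2)
    (hI : I ∈ V) (hv : inner ℝ (g I) v = 0) (hv1 : ‖v‖ = 1)
    (hlt : |v 1| ≤ 16 * B / c * ν ^ 2 * b * |v 2|) :
    ∃ Q : ℝ, ∀ s : ℝ, |s| < 1 / 2 → I + s • v ∈ V → ∃ R : ℝ, c / 2 * (ν ^ 4 * b ^ 7) ≤ |R| ∧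
      |R| ≤ 2 * B * (ν ^ 4 * b ^ 7) ∧ inner ℝ (g (I + s • v)) v = s * Q + s ^ 2 * R := by
  have hBD : 1 ≤ B * D ^ 2 := one_le_mul_of_one_le_of_one_le hB (one_le_pow₀ hD)
  have hBBD : B ≤ B * D ^ 2 := le_mul_of_one_le_right (by linarith) (one_le_pow₀ hD)
  have hν1 : ν ≤ 1 := by nlinarith
  have hb1 : b ≤ 1 := by nlinarith
  have hb100 : 100 * b ≤ 1 := by nlinarith
  set κ := 16 * B / c with hκ
  have hκ0 : 0 ≤ κ := by positivity
  have hκν : κ * ν ≤ 1 / 4 := by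
    rw [hκ, div_mul_eq_mul_div, div_le_iff₀ hc]
    have := mul_le_mul_of_nonneg_right hBBD hν.le
    linarith
  have n2 := norm_sq_actR v
  rw [hv1] at n2
  have hv2 : |v 2| ≤ 1 := by
    rw [← sq_le_one_iff_abs_le_one]; nlinarith [sq_nonneg (v 0), sq_nonneg (v 1)]
  have hνb : ν * b ≤ 1 := by nlinarith
  have hv1' : |v 1| ≤ κ * ν ^ 2 * b := hlt.trans (mul_le_of_le_one_right (by positivity) hv2)
  have hv1'' : |v 1| ≤ 1 / 4 * |v 2| := by
    refine hlt.trans (mul_le_mul_of_nonneg_right ?_ (abs_nonneg _))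
    calc κ * ν ^ 2 * b = (κ * ν) * (ν * b) := by ring
      _ ≤ 1 / 4 * 1 := by gcongr
      _ = _ := mul_one _
  -- A unit vector with negligible `v 0` and with `|v 1| ≤ |v 2| / 4` is almost vertical, so the
  -- cubic coefficient keeps a factor `|v 2| ^ 3 ≥ 1 / 8`.
  have hv2' : 1 / 2 ≤ |v 2| := by
    have h1 := h.norm_sq_le hb hν hν1 hc1 hB hD hbc hI hv
    rw [hv1] at h1
    by_contra hcon
    push Not at hcon
    have h2 : v 2 ^ 2 < 1 / 4 := by
      rw [← sq_abs]; nlinarith [abs_nonneg (v 2)]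
    have h3 : v 1 ^ 2 ≤ 1 / 16 * v 2 ^ 2 := by
      rw [← sq_abs, ← sq_abs (v 2)]
      calc _ ≤ (1 / 4 * |v 2|) ^ 2 := pow_le_pow_left₀ (abs_nonneg _) hv1'' 2
        _ = _ := by ring
    linarith
  have hv0 : |v 0| ≤ D * (κ + 1) * (ν ^ 2 * b ^ 4) := by
    refine (h.abs_le_of_orthogonal I hI v hv).trans ?_
    have h1 : ν ^ 4 * b ^ 6 * |v 2| ≤ ν ^ 2 * b ^ 4 := by
      calc _ ≤ ν ^ 4 * b ^ 6 * 1 := by gcongr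
        _ = ν ^ 4 * b ^ 6 := mul_one _
        _ ≤ ν ^ 2 * b ^ 4 := mul_le_mul (pow_le_pow_of_le_one hν.le hν1 (by norm_num))
            (pow_le_pow_of_le_one hb.le hb1 (by norm_num)) (by positivity) (by positivity)
    calc _ ≤ D * (b ^ 3 * (κ * ν ^ 2 * b) + ν ^ 2 * b ^ 4) := by gcongr
      _ = _ := by ring
  have hsum : |v 0| + |v 1| ≤ θ * b * ν := by
    obtain ⟨h1, -⟩ := h.abs_zero_le hb hν hc1 hB hD hbc hI hv
    have h2 : ν ^ 4 * |v 2| ≤ ν ^ 2 := by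
      calc _ ≤ ν ^ 4 * 1 := by gcongr
        _ = ν ^ 4 := mul_one _
        _ ≤ _ := pow_le_pow_of_le_one hν.le hν1 (by norm_num)
    have h3 : b * |v 1| ≤ |v 1| := mul_le_of_le_one_left (abs_nonneg _) hb1
    calc |v 0| + |v 1| ≤ 2 * |v 1| + b * (ν ^ 4 * |v 2|) := by linarith
      _ ≤ 2 * (κ * ν ^ 2 * b) + b * ν ^ 2 := by gcongr
      _ = ((32 * B / c + 1) * ν) * b * ν := by rw [hκ]; ring
      _ ≤ θ * b * ν := by gcongr
  obtain ⟨Q, hQ⟩ := h.taylor I hI v hsum hv2' hv2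
  obtain ⟨q₀, hq₀⟩ := h.taylor₀ I hI
  obtain ⟨q₁, hq₁⟩ := h.taylor₁ I hI
  -- Linear Kepler increments only change the slope, which is arbitrary in `exists_radius`.
  refine ⟨Q + q₀ * v 0 ^ 2 + q₁ * v 1 ^ 2, fun s hs hsV => ?_⟩
  obtain ⟨R, hR1, hR2, hR⟩ := hQ s hs hsV
  have e0 := hq₀ _ hsV
  have e1 := hq₁ _ hsV
  have i1 := h.inner_eq _ hsV v
  have i2 := h.inner_eq I hI v
  simp only [PiLp.add_apply, PiLp.smul_apply, smul_eq_mul, add_sub_cancel_left] at e0 e1 i1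
  rcases eq_or_ne s 0 with rfl | hs0
  -- At `s = 0` the quotient by `s ^ 2` carries no information; the secular `R` serves.
  · refine ⟨R, ?_, ?_, ?_⟩
    · exact le_trans (by gcongr; linarith) hR1
    · refine hR2.trans ?_
      gcongr
      linarith
    · rw [zero_smul, add_zero, hv]; ring
  have hs2 : 0 < s ^ 2 := by positivity
  set x₀ := ω₀ (I 0 + s * v 0) - ω₀ (I 0) - q₀ * (s * v 0) with hx₀
  set x₁ := ω₁ (I 1 + s * v 1) - ω₁ (I 1) - q₁ * (s * v 1) with hx₁
  -- The quadratic Kepler remainders are of order `|v 0| ^ 3` and `b ^ 5 * |v 1| ^ 3`, that is `ν^6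
  -- b^12` and `ν^6 b^8`: smaller than `ν^4 b^7` by at least a factor `ν`.
  have herr : |(x₀ * v 0 + x₁ * v 1) / s ^ 2| ≤ c / 2 * (ν ^ 4 * b ^ 7) := by
    rw [abs_div, abs_of_pos hs2, div_le_iff₀ hs2]
    have f0 : |x₀ * v 0| ≤ B * (D * (κ + 1)) ^ 3 * ν * (ν ^ 4 * b ^ 7) * s ^ 2 := by
      rw [abs_mul]
      calc |x₀| * |v 0| ≤ B * (s * v 0) ^ 2 * |v 0| := by gcongr
        _ = B * s ^ 2 * |v 0| ^ 3 := by rw [mul_pow, ← sq_abs (v 0)]; ring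
        _ ≤ B * s ^ 2 * (D * (κ + 1) * (ν ^ 2 * b ^ 4)) ^ 3 := by gcongr
        _ = B * (D * (κ + 1)) ^ 3 * (ν ^ 6 * b ^ 12) * s ^ 2 := by ring
        _ ≤ B * (D * (κ + 1)) ^ 3 * (ν ^ 5 * b ^ 7) * s ^ 2 := by
          have g1 : ν ^ 6 ≤ ν ^ 5 := pow_le_pow_of_le_one hν.le hν1 (by norm_num)
          have g2 : b ^ 12 ≤ b ^ 7 := pow_le_pow_of_le_one hb.le hb1 (by norm_num)
          gcongr
        _ = _ := by ring
    have f1 : |x₁ * v 1| ≤ B * κ ^ 3 * ν * (ν ^ 4 * b ^ 7) * s ^ 2 := by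
      rw [abs_mul]
      calc |x₁| * |v 1| ≤ B * b ^ 5 * (s * v 1) ^ 2 * |v 1| := by gcongr
        _ = B * b ^ 5 * s ^ 2 * |v 1| ^ 3 := by rw [mul_pow, ← sq_abs (v 1)]; ring
        _ ≤ B * b ^ 5 * s ^ 2 * (κ * ν ^ 2 * b) ^ 3 := by gcongr
        _ = B * κ ^ 3 * (ν ^ 6 * b ^ 8) * s ^ 2 := by ring
        _ ≤ B * κ ^ 3 * (ν ^ 5 * b ^ 7) * s ^ 2 := by
          have g1 : ν ^ 6 ≤ ν ^ 5 := pow_le_pow_of_le_one hν.le hν1 (by norm_num)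
          have g2 : b ^ 8 ≤ b ^ 7 := pow_le_pow_of_le_one hb.le hb1 (by norm_num)
          gcongr
        _ = _ := by ring
    calc _ ≤ _ := abs_add_le _ _
      _ ≤ _ := add_le_add f0 f1
      _ = B * (κ ^ 3 + (D * (κ + 1)) ^ 3) * ν * (ν ^ 4 * b ^ 7 * s ^ 2) := by ring
      _ ≤ c / 2 * (ν ^ 4 * b ^ 7 * s ^ 2) := by gcongr
      _ = _ := by ring
  refine ⟨R + (x₀ * v 0 + x₁ * v 1) / s ^ 2, ?_, ?_, ?_⟩
  · have := abs_sub_abs_le_abs_add R ((x₀ * v 0 + x₁ * v 1) / s ^ 2)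
    linarith
  · have := abs_add_le R ((x₀ * v 0 + x₁ * v 1) / s ^ 2)
    have g : c / 2 * (ν ^ 4 * b ^ 7) ≤ B * (ν ^ 4 * b ^ 7) := by gcongr; linarith
    linarith
  · have : s ^ 2 * (R + (x₀ * v 0 + x₁ * v 1) / s ^ 2) = s ^ 2 * R + (x₀ * v 0 + x₁ * v 1) := by
      field_simp
    rw [this, hx₀, hx₁]
    linear_combination i1 - i2 + hR + hv

/-- Steepness. -/
lemma exists_lt_norm_starProjection (h : SteepEstimates V g ω₀ ω₁ n b ν c B D θ) (hb : 0 < b)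
    (hν : 0 < ν) (hc : 0 < c) (hc1 : c ≤ 1) (hB : 1 ≤ B) (hD : 1 ≤ D)
    (hbc : 100 * (B * D ^ 2) * b ≤ c) (hνc : 100 * (B * D ^ 2) * ν ≤ c)
    (hνθ : (32 * B / c + 1) * ν ≤ θ)
    (hν2 : B * ((16 * B / c) ^ 3 + (D * (16 * B / c + 1)) ^ 3) * ν ≤ c / 2)
    (hI : I ∈ V) (j : Fin 2) {L : Submodule ℝ ActR} (hL : Module.finrank ℝ L = (j : ℕ) + 1)
    (hLg : ∀ v ∈ L, inner ℝ (g I) v = 0) {ξ : ℝ} (hξ : 0 < ξ) (hξb : ξ ≤ b) :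
    ∃ η : ℝ, 0 ≤ η ∧ η ≤ ξ ∧ ∀ J ∈ V, J - I ∈ L → ‖J - I‖ = η →
      ν ^ 4 * b ^ 4 * (c ^ 2 / (256 * B)) * ξ ^ 5 < ‖L.starProjection (g J)‖ := by
  have hBD : 1 ≤ B * D ^ 2 := one_le_mul_of_one_le_of_one_le hB (one_le_pow₀ hD)
  have hb100 : 100 * b ≤ 1 := by nlinarith
  have hB0 : 0 < B := by linarith
  -- `c ^ 2 / (256 * B)` is half the constant that `exists_radius` yields for resonant lines; the
  -- half makes the inequality strict. The other cases have better constants.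
  have hCle : c ^ 2 / (256 * B) ≤ c / 32 := by
    rw [div_le_div_iff₀ (by positivity) (by norm_num)]; nlinarith
  have hnonres : ∀ k, c / 32 ≤ k → ∀ J, ν ^ 4 * b ^ 4 * k * ξ ^ 5 < ‖L.starProjection (g J)‖ →
      ν ^ 4 * b ^ 4 * (c ^ 2 / (256 * B)) * ξ ^ 5 < ‖L.starProjection (g J)‖ := fun k hk J hJ => by
    refine lt_of_le_of_lt ?_ hJ
    gcongr
    exact hCle.trans hk
  fin_cases j
  · rw [show ((⟨0, by norm_num⟩ : Fin 2) : ℕ) + 1 = 1 from rfl] at hL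
    obtain ⟨⟨v', hv'L⟩, hv'0, hv's⟩ := finrank_eq_one_iff'.1 hL
    have hv'0 : v' ≠ 0 := fun h0 => hv'0 (Subtype.ext h0)
    set v := ‖v'‖⁻¹ • v' with hv
    have hvn : ‖v‖ = 1 := norm_smul_inv_norm hv'0
    have hvL : v ∈ L := L.smul_mem _ hv'L
    have hspan : ∀ w ∈ L, ∃ s : ℝ, w = s • v := fun w hw => by
      obtain ⟨r, hr⟩ := hv's ⟨w, hw⟩
      refine ⟨r * ‖v'‖, ?_⟩
      rw [hv, smul_smul, mul_assoc, mul_inv_cancel₀ (norm_ne_zero_iff.2 hv'0), mul_one]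
      exact (congrArg Subtype.val hr).symm
    rcases le_or_gt (16 * B / c * ν ^ 2 * b * |v 2|) |v 1| with hle | hlt
    · refine ⟨ξ, hξ.le, le_rfl, fun J hJ hJL hJξ => ?_⟩
      refine hnonres _ le_rfl J (h.steep_one_of_le hb hν hc hc1 hB hD hbc hνc hI hLg hξ hξb hJ hJL
        hJξ ?_)
      obtain ⟨s, hs⟩ := hspan _ hJL
      have h1 : J 1 - I 1 = s * v 1 := by rw [← PiLp.sub_apply, hs]; rfl
      have h2 : J 2 - I 2 = s * v 2 := by rw [← PiLp.sub_apply, hs]; rfl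
      rw [h1, h2, abs_mul, abs_mul]
      nlinarith [abs_nonneg s]
    · obtain ⟨Q, hQ⟩ := h.exists_resonant_expansion hb hν hc hc1 hB hD hbc hνc hνθ hν2 hI
        (hLg v hvL) hvn hlt.le
      obtain ⟨η, hη0, hηξ, hη⟩ := exists_radius (c₀ := c / 2 * (ν ^ 4 * b ^ 7))
        (C₀ := 2 * B * (ν ^ 4 * b ^ 7)) (Q := Q) (by positivity) (by gcongr; linarith) hξ
      refine ⟨η, hη0, hηξ, fun J hJ hJL hJη => ?_⟩
      obtain ⟨s, hs⟩ := hspan _ hJL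
      have hJs : J = I + s • v := by rw [← hs]; abel
      have hsη : |s| = η := by rw [← hJη, hs, norm_smul, hvn, mul_one, Real.norm_eq_abs]
      obtain ⟨R, hR1, hR2, hR⟩ := hQ s (by rw [hsη]; linarith) (hJs ▸ hJ)
      have h1 := hη s R hsη hR1 hR2
      have h2 := inner_le_norm_starProjection_mul hvL (g J)
      rw [hvn, mul_one, hJs, hR, ← hJs] at h2
      refine lt_of_lt_of_le ?_ (h1.trans h2)
      -- This fixes the exponent: `b ^ 7 * ξ ^ 2` must dominate `b ^ 4 * ξ ^ 5`.
      have h3 : ξ ^ 5 ≤ b ^ 3 * ξ ^ 2 := by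
        calc ξ ^ 5 = ξ ^ 3 * ξ ^ 2 := by ring
          _ ≤ _ := by gcongr
      calc _ ≤ ν ^ 4 * b ^ 4 * (c ^ 2 / (256 * B)) * (b ^ 3 * ξ ^ 2) := by gcongr
        _ < ν ^ 4 * b ^ 4 * (c ^ 2 / (128 * B)) * (b ^ 3 * ξ ^ 2) := by
          gcongr; norm_num
        _ = _ := by field_simp; norm_num
  · refine ⟨ξ, hξ.le, le_rfl, fun J hJ hJL hJξ => ?_⟩
    exact hnonres _ (by gcongr; norm_num) J
      (h.steep_two hb hν hc hc1 hB hD hbc hνc hI hL hLg hξ hξb hJ hJL hJξ)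

end SteepEstimates

/-! ### Keplerian frequencies -/

/-- The increment is factored exactly, so the slope is controlled between any two points of the
range without a path joining them. -/
lemma exists_inv_cube_sub_eq {w W x y : ℝ} (hw : 0 < w) (hx : w ≤ x) (hxW : x ≤ W) (hy : w ≤ y)
    (hyW : y ≤ W) : ∃ k, 1 / y ^ 3 - 1 / x ^ 3 = -(k * (y - x)) ∧ 3 * w ^ 2 / W ^ 6 ≤ k ∧
      k ≤ 3 * W ^ 2 / w ^ 6 := by
  have hx0 : 0 < x := hw.trans_le hx
  have hy0 : 0 < y := hw.trans_le hy
  have hW0 : 0 < W := hx0.trans_le hxW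
  refine ⟨(x ^ 2 + x * y + y ^ 2) / (x ^ 3 * y ^ 3), by field_simp; ring, ?_, ?_⟩
  · calc 3 * w ^ 2 / W ^ 6 = (w ^ 2 + w * w + w ^ 2) / (W ^ 3 * W ^ 3) := by ring
      _ ≤ _ := by gcongr
  · calc _ ≤ (W ^ 2 + W * W + W ^ 2) / (w ^ 3 * w ^ 3) := by gcongr
      _ = _ := by ring

lemma abs_inv_cube_taylor_le {w W x y : ℝ} (hw : 0 < w) (hx : w ≤ x) (hxW : x ≤ W) (hy : w ≤ y)
    (hyW : y ≤ W) :
    |1 / y ^ 3 - 1 / x ^ 3 - -(3 / x ^ 4) * (y - x)| ≤ 6 * W ^ 2 / w ^ 7 * (y - x) ^ 2 := by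
  have hx0 : 0 < x := hw.trans_le hx
  have hy0 : 0 < y := hw.trans_le hy
  have hW0 : 0 < W := hx0.trans_le hxW
  have h : 1 / y ^ 3 - 1 / x ^ 3 - -(3 / x ^ 4) * (y - x)
      = (x ^ 2 + 2 * (x * y) + 3 * y ^ 2) / (x ^ 4 * y ^ 3) * (y - x) ^ 2 := by
    field_simp; ring
  rw [h, abs_of_nonneg (by positivity)]
  refine mul_le_mul_of_nonneg_right ?_ (sq_nonneg _)
  calc _ ≤ (W ^ 2 + 2 * (W * W) + 3 * W ^ 2) / (w ^ 4 * w ^ 3) := by gcongr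
    _ = _ := by ring

variable {A b w W x y : ℝ}

/-- Scaling `z` to `b * z` brings the outer action into a fixed range; the slope picks up `b ^ 4`.
The case `b = 1` serves the inner planet. -/
lemma exists_freq_sub_eq (hA : 0 < A) (hb : 0 < b) (hw : 0 < w) (hx : w ≤ b * x)
    (hxW : b * x ≤ W) (hy : w ≤ b * y) (hyW : b * y ≤ W) :
    ∃ k, A / y ^ 3 - A / x ^ 3 = -(k * (y - x)) ∧ A * (3 * w ^ 2 / W ^ 6) * b ^ 4 ≤ k ∧
      k ≤ A * (3 * W ^ 2 / w ^ 6) * b ^ 4 := by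
  obtain ⟨k, hk, hk1, hk2⟩ := exists_inv_cube_sub_eq hw hx hxW hy hyW
  refine ⟨A * k * b ^ 4, ?_, by gcongr, by gcongr⟩
  have hx0 : x ≠ 0 := by rintro rfl; linarith
  have hy0 : y ≠ 0 := by rintro rfl; linarith
  have e : ∀ z : ℝ, z ≠ 0 → A / z ^ 3 = A * b ^ 3 * (1 / (b * z) ^ 3) := fun z hz => by field_simp
  rw [e x hx0, e y hy0]
  linear_combination A * b ^ 3 * hk

lemma exists_freq_taylor (hA : 0 < A) (hb : 0 < b) (hw : 0 < w) (hx : w ≤ b * x)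
    (hxW : b * x ≤ W) : ∃ q, ∀ y, w ≤ b * y → b * y ≤ W →
      |A / y ^ 3 - A / x ^ 3 - q * (y - x)| ≤ A * (6 * W ^ 2 / w ^ 7) * b ^ 5 * (y - x) ^ 2 := by
  refine ⟨-(A * b ^ 4 * (3 / (b * x) ^ 4)), fun y hy hyW => ?_⟩
  have h := abs_inv_cube_taylor_le hw hx hxW hy hyW
  have hx0 : x ≠ 0 := by rintro rfl; linarith
  have hy0 : y ≠ 0 := by rintro rfl; linarith
  have e : ∀ z : ℝ, z ≠ 0 → A / z ^ 3 = A * b ^ 3 * (1 / (b * z) ^ 3) := fun z hz => by field_simp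
  rw [e x hx0, e y hy0, show A * b ^ 3 * (1 / (b * y) ^ 3) - A * b ^ 3 * (1 / (b * x) ^ 3)
    - -(A * b ^ 4 * (3 / (b * x) ^ 4)) * (y - x)
    = A * b ^ 3 * (1 / (b * y) ^ 3 - 1 / (b * x) ^ 3 - -(3 / (b * x) ^ 4) * (b * y - b * x)) by ring,
    abs_mul, abs_of_pos (by positivity)]
  calc _ ≤ A * b ^ 3 * (6 * W ^ 2 / w ^ 7 * (b * y - b * x) ^ 2) := by gcongr
    _ = _ := by ring

/-! ### The model Hamiltonian and its gradient -/

/-- The inclusion of the real action space into the complex one. -/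
noncomputable def toC : ActR →L[ℝ] ActC :=
  (ContinuousLinearMap.pi fun i : Fin 2 =>
    Complex.ofRealCLM.comp (EuclideanSpace.proj (𝕜 := ℝ) (i.castSucc : Fin 3))).prod
    (Complex.ofRealCLM.comp (EuclideanSpace.proj (𝕜 := ℝ) (2 : Fin 3)))

lemma toC_eq (I : ActR) : toC I = cpt (I 0) (I 1) (I 2) := by
  ext1
  · ext i; fin_cases i <;> rfl
  · rfl

/-- The real differential of `μ Re f` on the real action space. -/
noncomputable def reDeriv (μ : ℝ) (f : ActC → ℂ) (I : ActR) : ActR →L[ℝ] ℝ :=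
  μ • Complex.reCLM.comp (((fderiv ℂ f (toC I)).restrictScalars ℝ).comp toC)

lemma reDeriv_apply (μ : ℝ) (f : ActC → ℂ) (I v : ActR) :
    reDeriv μ f I v = μ * (fderiv ℂ f (toC I) (toC v)).re := rfl

lemma hasFDerivAt_re_comp_toC {f : ActC → ℂ} {I : ActR} (hf : AnalyticAt ℂ f (toC I)) (μ : ℝ) :
    HasFDerivAt (fun J => μ * (f (toC J)).re) (reDeriv μ f I) I :=
  ((Complex.reCLM.hasFDerivAt.comp I ((hf.differentiableAt.hasFDerivAt.restrictScalars ℝ).comp I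
    toC.hasFDerivAt)).const_mul μ)

lemma hasFDerivAt_kepler {A : ℝ} {I : ActR} (i : Fin 3) (h : I i ≠ 0) :
    HasFDerivAt (fun J : ActR => -(A / (2 * J i ^ 2)))
      ((A / I i ^ 3) • (EuclideanSpace.proj (𝕜 := ℝ) i : ActR →L[ℝ] ℝ)) I := by
  have h1 : HasDerivAt (fun x : ℝ => -(A / (2 * x ^ 2))) (A / I i ^ 3) (I i) := by
    have := (((((hasDerivAt_id (I i)).pow 2).const_mul 2).inv (by simpa using h)).const_mul A).neg
    refine this.congr_deriv ?_
    simp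
    field_simp
  exact HasDerivAt.comp_hasFDerivAt (h₂ := fun x : ℝ => -(A / (2 * x ^ 2))) I h1
    (EuclideanSpace.proj (𝕜 := ℝ) i : ActR →L[ℝ] ℝ).hasFDerivAt

/-- `H` agrees near `I` with a Keplerian Hamiltonian plus the real part of an analytic function. -/
structure IsModelAt (H : ActR → ℝ) (A₀ A₁ μ : ℝ) (f : ActC → ℂ) (I : ActR) : Prop where
  eventually_eq : ∀ᶠ J in nhds I,
    H J = -(A₀ / (2 * J 0 ^ 2)) + -(A₁ / (2 * J 1 ^ 2)) + μ * (f (toC J)).re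
  ne_zero₀ : I 0 ≠ 0
  ne_zero₁ : I 1 ≠ 0
  analyticAt : AnalyticAt ℂ f (toC I)

namespace IsModelAt

variable {H : ActR → ℝ} {A₀ A₁ μ : ℝ} {f : ActC → ℂ} {I : ActR}

lemma eventually (h : IsModelAt H A₀ A₁ μ f I) : ∀ᶠ J in nhds I, IsModelAt H A₀ A₁ μ f J := by
  have c0 : Continuous fun J : ActR => J 0 := by fun_prop
  have c1 : Continuous fun J : ActR => J 1 := by fun_prop
  filter_upwards [h.eventually_eq.eventually_nhds, c0.continuousAt.eventually_ne h.ne_zero₀,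
    c1.continuousAt.eventually_ne h.ne_zero₁,
    toC.continuous.continuousAt.eventually h.analyticAt.eventually_analyticAt] with J a b c d
  exact ⟨a, b, c, d⟩

lemma inner_gradient (h : IsModelAt H A₀ A₁ μ f I) (v : ActR) :
    inner ℝ (gradient H I) v = A₀ / I 0 ^ 3 * v 0 + A₁ / I 1 ^ 3 * v 1 + reDeriv μ f I v := by
  have hd := ((hasFDerivAt_kepler (A := A₀) 0 h.ne_zero₀).add
    (hasFDerivAt_kepler (A := A₁) 1 h.ne_zero₁)).add (hasFDerivAt_re_comp_toC h.analyticAt μ)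
  have hd' : HasFDerivAt H _ I := hd.congr_of_eventuallyEq h.eventually_eq
  rw [inner_gradient_left, hd'.fderiv]
  simp

lemma contDiffAt (h : IsModelAt H A₀ A₁ μ f I) : ContDiffAt ℝ ∞ H I := by
  refine ContDiffAt.congr_of_eventuallyEq ?_ h.eventually_eq
  have h0 := h.ne_zero₀
  have h1 := h.ne_zero₁
  have hf : ContDiffAt ℝ ∞ (fun J : ActR => (f (toC J)).re) I :=
    Complex.reCLM.contDiff.contDiffAt.comp I
      ((h.analyticAt.contDiffAt.restrict_scalars ℝ).comp I toC.contDiff.contDiffAt)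
  have c0 : ContDiffAt ℝ ∞ (fun J : ActR => J 0) I := by fun_prop
  have c1 : ContDiffAt ℝ ∞ (fun J : ActR => J 1) I := by fun_prop
  exact (((contDiffAt_const.div (contDiffAt_const.mul (c0.pow 2)) (by simpa using h0)).neg).add
    ((contDiffAt_const.div (contDiffAt_const.mul (c1.pow 2)) (by simpa using h1)).neg)).add
    (contDiffAt_const.mul hf)

end IsModelAt

/-! ### Steepness estimates for the secular model -/

section ReDeriv

variable {μ r M : ℝ} {f g : ActC → ℂ} {I J : ActR}

lemma wnorm_toC (r : ℝ) (v : ActR) : wnorm r (toC v) = max |v 0| |v 1| / r + |v 2| := by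
  rw [wnorm, toC_eq, norm_cpt_fst, norm_cpt_snd]

/-- `Q` compensates for `q`, so that the analyticity radius `q * ν` can be treated as `ν`. -/
lemma wnorm_toC_le {q ν Q : ℝ} (hq : 0 < q) (hν : 0 < ν) (hQ : 1 ≤ Q) (hqQ : 1 ≤ q * Q)
    (v : ActR) : wnorm (q * ν) (toC v) ≤ Q * ((|v 0| + |v 1|) / ν + |v 2|) := by
  rw [wnorm_toC, mul_add]
  have h0 := abs_nonneg (v 0)
  have h1 := abs_nonneg (v 1)
  have h2 := abs_nonneg (v 2)
  refine add_le_add ?_ (by nlinarith)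
  calc max |v 0| |v 1| / (q * ν) ≤ (|v 0| + |v 1|) / (q * ν) := by
        gcongr; exact max_le (by linarith) (by linarith)
    _ ≤ Q * ((|v 0| + |v 1|) / ν) := by
        rw [← mul_div_assoc, div_le_div_iff₀ (by positivity) hν]
        have : 0 ≤ (|v 0| + |v 1|) * ν := by positivity
        nlinarith

lemma reDeriv_add (hf : AnalyticAt ℂ f (toC I)) (hg : AnalyticAt ℂ g (toC I)) (v : ActR) :
    reDeriv μ (f + g) I v = reDeriv μ f I v + reDeriv μ g I v := by
  simp only [reDeriv_apply]
  rw [fderiv_add hf.differentiableAt hg.differentiableAt, add_apply, Complex.add_re, mul_add]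

lemma abs_reDeriv_le (hμ : 0 ≤ μ) (hr : 0 < r) (hf : AnalyticOnNhd ℂ f (polydisc (toC I) r))
    (hM : ∀ w ∈ polydisc (toC I) r, ‖f w‖ ≤ M) (v : ActR) :
    |reDeriv μ f I v| ≤ μ * (4 * M * wnorm r (toC v)) := by
  rw [reDeriv_apply, abs_mul, abs_of_nonneg hμ]
  gcongr
  exact (Complex.abs_re_le_norm _).trans (norm_fderiv_apply_le_of_polydisc hr hf hM _)

lemma abs_reDeriv_sub_le (hμ : 0 ≤ μ) (hr : 0 < r) (hf : AnalyticOnNhd ℂ f (polydisc (toC I) r))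
    (hM : ∀ w ∈ polydisc (toC I) r, ‖f w‖ ≤ M) (hf' : AnalyticOnNhd ℂ f (polydisc (toC J) r))
    (hM' : ∀ w ∈ polydisc (toC J) r, ‖f w‖ ≤ M) (v : ActR) :
    |reDeriv μ f J v - reDeriv μ f I v|
      ≤ μ * (16 * M * wnorm r (toC v) * wnorm r (toC (J - I))) := by
  rw [reDeriv_apply, reDeriv_apply, ← mul_sub, ← Complex.sub_re, abs_mul, abs_of_nonneg hμ,
    map_sub]
  gcongr
  exact (Complex.abs_re_le_norm _).trans
    (norm_fderiv_apply_sub_le_of_polydisc hr hf hM hf' hM' _)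

end ReDeriv

lemma polydisc_subset_polydisc (p : ActC) {r s : ℝ} (h : r ≤ s) : polydisc p r ⊆ polydisc p s :=
  fun _ hq => ⟨hq.1.trans_le h, hq.2⟩

/-- The bound of the quadrupole part over `b ^ 6`. -/
noncomputable def quadBound (P w W : ℝ) : ℝ :=
  64 * P * (5 * (W + 1) ^ 4 + 3 * (W + 1) ^ 2 * (W + 2) ^ 2) / w ^ 6

/-- The ranges of the actions, the uniform bounds of the coefficients, and the smallness of the
correction `f` on a set `V` of actions. -/
structure SecularModel (a A p P' w W T q δ b ν : ℝ) (V : Set ActR) (A₀ A₁ P G : ℝ)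
    (f : ActC → ℂ) : Prop where
  a_le₀ : a ≤ A₀
  le_A₀ : A₀ ≤ A
  a_le₁ : a ≤ A₁
  le_A₁ : A₁ ≤ A
  p_le : p ≤ P
  le_P : P ≤ P'
  le₀ : ∀ I ∈ V, w ≤ I 0
  le₁ : ∀ I ∈ V, w ≤ b * I 1
  le_W₁ : ∀ I ∈ V, b * I 1 ≤ W
  mem_Ioo : ∀ I ∈ V, I 2 ∈ Set.Ioo 0 T
  quad : ∀ I ∈ V, ∀ t ∈ Set.Ioo 0 T, QuadRange W W T G (I 0) (I 1) t
  exists_mem : ∀ I ∈ V, ∀ J ∈ V, ∃ K ∈ V, K 0 = I 0 ∧ K 1 = I 1 ∧ K 2 = J 2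
  analytic : ∀ I ∈ V, AnalyticOnNhd ℂ f (polydisc (toC I) (q * ν))
  bound : ∀ I ∈ V, ∀ z ∈ polydisc (toC I) (q * ν), ‖f z‖ ≤ δ * b ^ 7

namespace SecularModel

variable {a A p P' w W T q δ b ν A₀ A₁ P G : ℝ} {V : Set ActR} {f : ActC → ℂ} {I J : ActR}

lemma le_W₀ (h : SecularModel a A p P' w W T q δ b ν V A₀ A₁ P G f) (hI : I ∈ V) : I 0 ≤ W :=
  (h.quad I hI _ (h.mem_Ioo I hI)).L₀_le

lemma analyticOnNhd_secN2 (h : SecularModel a A p P' w W T q δ b ν V A₀ A₁ P G f) (hI : I ∈ V) :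
    AnalyticOnNhd ℂ (secN2 P G) (polydisc (toC I) 1) := by
  rw [toC_eq]; exact (h.quad I hI _ (h.mem_Ioo I hI)).analyticOnNhd_secN2

lemma one_div_le (h : SecularModel a A p P' w W T q δ b ν V A₀ A₁ P G f) (hw : 0 < w)
    (hI : I ∈ V) : 1 / I 1 ≤ b / w := by
  have h1 := (h.quad I hI _ (h.mem_Ioo I hI)).L₁_pos
  rw [div_le_div_iff₀ h1 hw]
  linarith [h.le₁ I hI]

lemma le_one_div (h : SecularModel a A p P' w W T q δ b ν V A₀ A₁ P G f) (hw : 0 < w)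
    (hI : I ∈ V) : b / W ≤ 1 / I 1 := by
  have h1 := (h.quad I hI _ (h.mem_Ioo I hI)).L₁_pos
  have hW : 0 < W := hw.trans_le ((h.le₀ I hI).trans (h.le_W₀ hI))
  rw [div_le_div_iff₀ hW h1]
  linarith [h.le_W₁ I hI]

lemma norm_secN2_le (h : SecularModel a A p P' w W T q δ b ν V A₀ A₁ P G f) (hw : 0 < w)
    (hb : 0 < b) (hp : 0 < p) (hI : I ∈ V) :
    ∀ z ∈ polydisc (toC I) 1, ‖secN2 P G z‖ ≤ quadBound P' w W * b ^ 6 := by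
  intro z hz
  have hq := h.quad I hI _ (h.mem_Ioo I hI)
  have hW : 0 < W := hw.trans_le ((h.le₀ I hI).trans (h.le_W₀ hI))
  have hP : 0 < P := hp.trans_le h.p_le
  have h1 := hq.L₁_pos
  rw [toC_eq] at hz
  refine (hq.norm_secN2_le hP z hz).trans ?_
  calc _ = 64 * P * (5 * (W + 1) ^ 4 + 3 * (W + 1) ^ 2 * (W + 2) ^ 2) * (1 / I 1) ^ 6 := by
        rw [div_pow, one_pow, mul_one_div]
    _ ≤ 64 * P' * (5 * (W + 1) ^ 4 + 3 * (W + 1) ^ 2 * (W + 2) ^ 2) * (b / w) ^ 6 := by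
        have hP' : 0 < P' := hP.trans_le h.le_P
        refine mul_le_mul ?_ (pow_le_pow_left₀ (by positivity) (h.one_div_le hw hI) 6)
          (by positivity) (by positivity)
        exact mul_le_mul_of_nonneg_right (by linarith [h.le_P]) (by positivity)
    _ = _ := by rw [quadBound]; field_simp

lemma quadBound_nonneg (hP : 0 < P') (hw : 0 < w) (hW : 0 < W) : 0 ≤ quadBound P' w W := by
  rw [quadBound]; positivity

lemma analyticAt (h : SecularModel a A p P' w W T q δ b ν V A₀ A₁ P G f) (hq : 0 < q)
    (hν : 0 < ν) (hI : I ∈ V) : AnalyticAt ℂ f (toC I) :=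
  h.analytic I hI _ ⟨by simpa using mul_pos hq hν, by simp⟩

lemma analyticAt_secN2 (h : SecularModel a A p P' w W T q δ b ν V A₀ A₁ P G f) (hI : I ∈ V) :
    AnalyticAt ℂ (secN2 P G) (toC I) :=
  h.analyticOnNhd_secN2 hI _ ⟨by simp, by simp⟩

lemma analyticOnNhd_add (h : SecularModel a A p P' w W T q δ b ν V A₀ A₁ P G f) (hqν : q * ν ≤ 1)
    (hI : I ∈ V) : AnalyticOnNhd ℂ (secN2 P G + f) (polydisc (toC I) (q * ν)) :=
  ((h.analyticOnNhd_secN2 hI).mono (polydisc_subset_polydisc _ hqν)).add (h.analytic I hI)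

lemma norm_add_le (h : SecularModel a A p P' w W T q δ b ν V A₀ A₁ P G f) (hw : 0 < w)
    (hb : 0 < b) (hb1 : b ≤ 1) (hδ1 : δ ≤ 1) (hp : 0 < p) (hqν : q * ν ≤ 1)
    (hI : I ∈ V) : ∀ z ∈ polydisc (toC I) (q * ν),
      ‖(secN2 P G + f) z‖ ≤ (quadBound P' w W + 1) * b ^ 6 := by
  intro z hz
  refine (_root_.norm_add_le _ _).trans ?_
  have h1 := h.norm_secN2_le hw hb hp hI z (polydisc_subset_polydisc _ hqν hz)
  have h2 := h.bound I hI z hz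
  have h3 : δ * b ^ 7 ≤ 1 * b ^ 6 :=
    mul_le_mul hδ1 (pow_le_pow_of_le_one hb.le hb1 (by norm_num)) (by positivity) (by norm_num)
  linarith

lemma abs_reDeriv_le (h : SecularModel a A p P' w W T q δ b ν V A₀ A₁ P G f) (hw : 0 < w)
    (hb : 0 < b) (hb1 : b ≤ 1) (hδ1 : δ ≤ 1) (hp : 0 < p) (hq : 0 < q) (hν : 0 < ν)
    (hqν : q * ν ≤ 1) {Q : ℝ} (hQ : 1 ≤ Q) (hqQ : 1 ≤ q * Q) {B : ℝ}
    (hB : 16 * (quadBound P' w W + 1) * Q ^ 2 ≤ B) (hI : I ∈ V) (v : ActR) :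
    |reDeriv (ν ^ 4) (secN2 P G + f) I v|
      ≤ B * (ν ^ 4 * b ^ 6) * ((|v 0| + |v 1|) / ν + |v 2|) := by
  have hM := h.norm_add_le hw hb hb1 hδ1 hp hqν hI
  have hm : 0 ≤ quadBound P' w W :=
    quadBound_nonneg (hp.trans_le (h.p_le.trans h.le_P)) hw
      (hw.trans_le ((h.le₀ I hI).trans (h.le_W₀ hI)))
  refine (PlanarThreeBody.abs_reDeriv_le (by positivity) (mul_pos hq hν)
    (h.analyticOnNhd_add hqν hI) hM v).trans ?_
  have h2 := wnorm_toC_le hq hν hQ hqQ v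
  have h3 : 4 * (quadBound P' w W + 1) * Q ≤ B := by
    refine le_trans ?_ hB
    have : Q ≤ Q ^ 2 := by nlinarith
    calc _ ≤ 16 * (quadBound P' w W + 1) * Q := by gcongr; norm_num
      _ ≤ _ := by gcongr
  calc _ ≤ ν ^ 4 * (4 * ((quadBound P' w W + 1) * b ^ 6)
        * (Q * ((|v 0| + |v 1|) / ν + |v 2|))) := by gcongr
    _ = (4 * (quadBound P' w W + 1) * Q) * (ν ^ 4 * b ^ 6) * ((|v 0| + |v 1|) / ν + |v 2|) := by
      ring
    _ ≤ _ := by gcongr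

lemma abs_reDeriv_sub_le (h : SecularModel a A p P' w W T q δ b ν V A₀ A₁ P G f) (hw : 0 < w)
    (hb : 0 < b) (hb1 : b ≤ 1) (hδ1 : δ ≤ 1) (hp : 0 < p) (hq : 0 < q) (hν : 0 < ν)
    (hqν : q * ν ≤ 1) {Q : ℝ} (hQ : 1 ≤ Q) (hqQ : 1 ≤ q * Q) {B : ℝ}
    (hB : 16 * (quadBound P' w W + 1) * Q ^ 2 ≤ B) (hI : I ∈ V) (hJ : J ∈ V) (v : ActR) :
    |reDeriv (ν ^ 4) (secN2 P G + f) J v - reDeriv (ν ^ 4) (secN2 P G + f) I v|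
      ≤ B * (ν ^ 4 * b ^ 6) * ((|v 0| + |v 1|) / ν + |v 2|) *
        ((|J 0 - I 0| + |J 1 - I 1|) / ν + |J 2 - I 2|) := by
  have hm : 0 ≤ quadBound P' w W :=
    quadBound_nonneg (hp.trans_le (h.p_le.trans h.le_P)) hw
      (hw.trans_le ((h.le₀ I hI).trans (h.le_W₀ hI)))
  refine (PlanarThreeBody.abs_reDeriv_sub_le (by positivity) (mul_pos hq hν)
    (h.analyticOnNhd_add hqν hI) (h.norm_add_le hw hb hb1 hδ1 hp hqν hI)
    (h.analyticOnNhd_add hqν hJ) (h.norm_add_le hw hb hb1 hδ1 hp hqν hJ) v).trans ?_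
  have h2 := wnorm_toC_le hq hν hQ hqQ v
  have h3 := wnorm_toC_le hq hν hQ hqQ (J - I)
  have h4 := wnorm_nonneg (mul_pos hq hν) (toC (J - I))
  simp only [PiLp.sub_apply] at h3
  calc _ ≤ ν ^ 4 * (16 * ((quadBound P' w W + 1) * b ^ 6)
        * (Q * ((|v 0| + |v 1|) / ν + |v 2|))
        * (Q * ((|J 0 - I 0| + |J 1 - I 1|) / ν + |J 2 - I 2|))) := by gcongr
    _ = (16 * (quadBound P' w W + 1) * Q ^ 2) * (ν ^ 4 * b ^ 6) * ((|v 0| + |v 1|) / ν + |v 2|)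
        * ((|J 0 - I 0| + |J 1 - I 1|) / ν + |J 2 - I 2|) := by ring
    _ ≤ _ := by gcongr

lemma reDeriv_secN2_single (h : SecularModel a A p P' w W T q δ b ν V A₀ A₁ P G f) (hI : I ∈ V) :
    reDeriv (ν ^ 4) (secN2 P G) I (EuclideanSpace.single 2 1)
      = ν ^ 4 * quadD1 P G (I 0) (I 1) (I 2) := by
  have hq := h.quad I hI _ (h.mem_Ioo I hI)
  have h1 := hq.L₁_pos
  have h2 : I 1 - I 2 ≠ 0 := by
    have := hq.le_L₁; have := hq.X_nonneg; have := hq.t_pos; have := hq.t_lt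
    intro; linarith
  have hd := QuadRange.hasDerivAt_secN2 (P := P) (G := G) (L₀ := I 0) h1.ne' h2
    (cpt (I 0) (I 1) (I 2)).1 rfl rfl
  have hl : HasDerivAt (fun τ : ℂ => (((cpt (I 0) (I 1) (I 2)).1, τ) : ActC)) (0, 1) (I 2 : ℂ) :=
    (hasDerivAt_const _ _).prodMk (hasDerivAt_id _)
  have hf : HasFDerivAt (secN2 P G) (fderiv ℂ (secN2 P G) (toC I))
      ((cpt (I 0) (I 1) (I 2)).1, (I 2 : ℂ)) := by
    have := (h.analyticAt_secN2 hI).differentiableAt.hasFDerivAt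
    rw [toC_eq] at this ⊢
    exact this
  have hu := (HasFDerivAt.comp_hasDerivAt (l := secN2 P G) (I 2 : ℂ) hf hl).unique hd
  have hs : toC (EuclideanSpace.single 2 1) = (0, 1) := by
    rw [toC_eq]
    ext1
    · ext i; fin_cases i <;> simp [cpt]
    · simp [cpt]
  rw [reDeriv_apply, hs, hu, Complex.ofReal_re]

end SecularModel

/-! ### Uniform constants and the verification of the steepness estimates. -/

/-- Relations between the uniform bounds of a secular model and the constants of the steepness
estimates. -/
structure ModelConstants (a A p P' w W q δ Q c B D θ : ℝ) : Prop where
  a_pos : 0 < a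
  p_pos : 0 < p
  w_pos : 0 < w
  q_pos : 0 < q
  one_le_Q : 1 ≤ Q
  one_le_q_mul_Q : 1 ≤ q * Q
  δ_nonneg : 0 ≤ δ
  δ_le : δ ≤ 1
  θ_nonneg : 0 ≤ θ
  θ_le : θ ≤ 1
  θ_le_q : θ ≤ q
  slope_le : A * (3 * W ^ 2 / w ^ 6) ≤ B
  taylor_le : A * (6 * W ^ 2 / w ^ 7) ≤ B
  lip_le : 16 * (quadBound P' w W + 1) * Q ^ 2 ≤ B
  cubic_le : 800 * P' * W ^ 2 / w ^ 7 + 128 * quadBound P' w W + 64 ≤ B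
  le_slope : c ≤ a * (3 * w ^ 2 / W ^ 6)
  le_convex : c + 16 * δ ≤ 3 * p * w ^ 2 / W ^ 6
  le_cubic : c + (128 * quadBound P' w W * θ + 64 * δ) ≤ 27 * p * w ^ 2 / (16 * W ^ 7)
  le_D : A / w ^ 3 + B ≤ D * (a / (2 * W ^ 3))

namespace SecularModel

variable {a A p P' w W T q δ b ν Q c B D θ A₀ A₁ P G : ℝ} {V : Set ActR} {f : ActC → ℂ}
  {I J : ActR}

/-- The path goes from `I` vertically to `K`, then horizontally to `J`. On the vertical leg the
second derivative of the quadrupole beats the Lipschitz bound `16 * δ` of the correction; the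
horizontal leg costs the subtracted mixed term. -/
lemma convex (h : SecularModel a A p P' w W T q δ b ν V A₀ A₁ P G f)
    (hc : ModelConstants a A p P' w W q δ Q c B D θ) (hb : 0 < b) (hb1 : b ≤ 1) (hν : 0 < ν)
    (hqν : q * ν ≤ 1) (hI : I ∈ V) (hJ : J ∈ V) :
    c * (ν ^ 4 * b ^ 6) * (J 2 - I 2) ^ 2
      - B * (ν ^ 3 * b ^ 6) * (|J 0 - I 0| + |J 1 - I 1|) * |J 2 - I 2|
      ≤ (J 2 - I 2) * (reDeriv (ν ^ 4) (secN2 P G + f) J (EuclideanSpace.single 2 1)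
        - reDeriv (ν ^ 4) (secN2 P G + f) I (EuclideanSpace.single 2 1)) := by
  obtain ⟨K, hK, hK0, hK1, hK2⟩ := h.exists_mem I hI J hJ
  set e : ActR := EuclideanSpace.single 2 1 with he
  have hv0 : e 0 = 0 := by simp [he]
  have hv1 : e 1 = 0 := by simp [he]
  have hv2 : e 2 = 1 := by simp [he]
  have h1 := h.abs_reDeriv_sub_le hc.w_pos hb hb1 hc.δ_le hc.p_pos hc.q_pos hν hqν hc.one_le_Q
    hc.one_le_q_mul_Q hc.lip_le hK hJ e
  rw [hv0, hv1, hv2, hK0, hK1, hK2, sub_self, abs_zero, abs_one, add_zero, add_zero, zero_div,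
    zero_add, mul_one] at h1
  have h2 := PlanarThreeBody.abs_reDeriv_sub_le (by positivity : 0 ≤ ν ^ 4)
    (mul_pos hc.q_pos hν) (h.analytic I hI) (h.bound I hI) (h.analytic K hK) (h.bound K hK) e
  rw [wnorm_toC, wnorm_toC] at h2
  simp only [PiLp.sub_apply, hv0, hv1, hv2, hK0, hK1, hK2, sub_self, abs_zero, max_self, zero_div,
    zero_add, abs_one, mul_one] at h2
  have eI := reDeriv_add (μ := ν ^ 4) (h.analyticAt_secN2 hI) (h.analyticAt hc.q_pos hν hI) e
  have eK := reDeriv_add (μ := ν ^ 4) (h.analyticAt_secN2 hK) (h.analyticAt hc.q_pos hν hK) e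
  rw [he, h.reDeriv_secN2_single hI, ← he] at eI
  rw [he, h.reDeriv_secN2_single hK, ← he, hK0, hK1, hK2] at eK
  have hx0 : 0 < I 0 := hc.w_pos.trans_le (h.le₀ I hI)
  have hx1 := (h.quad I hI _ (h.mem_Ioo I hI)).L₁_pos
  have hW : 0 < W := hx0.trans_le (h.le_W₀ hI)
  have hP : 0 < P := hc.p_pos.trans_le h.p_le
  have hlow : ∀ t ∈ Set.Ioo 0 T, 3 * p * w ^ 2 / W ^ 6 * b ^ 6 ≤ quadD2 P G (I 0) (I 1) t := by
    intro t ht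
    have hh := h.quad I hI t ht
    have := hh.X_nonneg; have := hh.t_lt; have := hh.le_L₁; have := hh.t_pos; have := hh.L₀_le
    refine le_trans ?_ (quadD2_bounds hP hx0 hh.X_nonneg hh.abs_le hh.t_pos.le (by linarith))
    calc _ = 3 * p * w ^ 2 * (b / W) ^ 6 := by field_simp
      _ ≤ 3 * P * I 0 ^ 2 * (1 / I 1) ^ 6 := by
        refine mul_le_mul ?_ (pow_le_pow_left₀ (by positivity) (h.le_one_div hc.w_pos hI) 6)
          (by positivity) (by positivity)
        refine mul_le_mul (by linarith [h.p_le])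
          (pow_le_pow_left₀ hc.w_pos.le (h.le₀ I hI) 2) (by positivity) (by positivity)
      _ = _ := by field_simp
  have hD : ∀ t ∈ Set.Ioo 0 T, HasDerivAt (quadD1 P G (I 0) (I 1)) (quadD2 P G (I 0) (I 1) t) t := by
    intro t ht
    refine hasDerivAt_quadD1 P G _ _ ?_
    have hh := h.quad I hI t ht
    have := hh.X_nonneg; have := hh.t_lt; have := hh.le_L₁; have := hh.t_pos; have := hh.L₀_le
    intro; linarith
  have hmono : MonotoneOn (fun t => quadD1 P G (I 0) (I 1) t - 3 * p * w ^ 2 / W ^ 6 * b ^ 6 * t)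
      (Set.Ioo 0 T) := by
    have hd : ∀ t ∈ Set.Ioo 0 T, HasDerivAt (fun t => quadD1 P G (I 0) (I 1) t
        - 3 * p * w ^ 2 / W ^ 6 * b ^ 6 * t)
        (quadD2 P G (I 0) (I 1) t - 3 * p * w ^ 2 / W ^ 6 * b ^ 6) t := fun t ht =>
      ((hD t ht).sub ((hasDerivAt_id t).const_mul _)).congr_deriv (by ring)
    refine monotoneOn_of_deriv_nonneg (convex_Ioo 0 T)
      (fun s hs => (hd s hs).continuousAt.continuousWithinAt)
      (fun s hs => (hd s (interior_subset hs)).differentiableAt.differentiableWithinAt)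
      (fun s hs => ?_)
    rw [(hd s (interior_subset hs)).deriv]
    linarith [hlow s (interior_subset hs)]
  have hquad : 3 * p * w ^ 2 / W ^ 6 * b ^ 6 * (J 2 - I 2) ^ 2
      ≤ (J 2 - I 2) * (quadD1 P G (I 0) (I 1) (J 2) - quadD1 P G (I 0) (I 1) (I 2)) := by
    rcases le_total (I 2) (J 2) with hle | hle
    · have := hmono (h.mem_Ioo I hI) (h.mem_Ioo J hJ) hle
      simp only at this
      nlinarith
    · have := hmono (h.mem_Ioo J hJ) (h.mem_Ioo I hI) hle
      simp only at this
      nlinarith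
  set d := J 2 - I 2 with hd
  set nJ := reDeriv (ν ^ 4) (secN2 P G + f) J e
  set nI := reDeriv (ν ^ 4) (secN2 P G + f) I e
  set nK := reDeriv (ν ^ 4) (secN2 P G + f) K e
  set fI := reDeriv (ν ^ 4) f I e
  set fK := reDeriv (ν ^ 4) f K e
  have s1 : -(B * (ν ^ 3 * b ^ 6) * (|J 0 - I 0| + |J 1 - I 1|) * |d|) ≤ d * (nJ - nK) := by
    have hh : |d * (nJ - nK)| ≤ |d| * (B * (ν ^ 4 * b ^ 6) * ((|J 0 - I 0| + |J 1 - I 1|) / ν)) := by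
      rw [abs_mul]; gcongr
    have e1 : |d| * (B * (ν ^ 4 * b ^ 6) * ((|J 0 - I 0| + |J 1 - I 1|) / ν))
        = B * (ν ^ 3 * b ^ 6) * (|J 0 - I 0| + |J 1 - I 1|) * |d| := by field_simp
    rw [e1] at hh
    exact (abs_le.1 hh).1
  have s2 : -(16 * δ * (ν ^ 4 * b ^ 6) * d ^ 2) ≤ d * (fK - fI) := by
    have hh : |d * (fK - fI)| ≤ |d| * (ν ^ 4 * (16 * (δ * b ^ 7) * |d|)) := by
      rw [abs_mul]; gcongr
    have e1 : |d| * (ν ^ 4 * (16 * (δ * b ^ 7) * |d|)) = 16 * δ * (ν ^ 4 * b ^ 7) * d ^ 2 := by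
      rw [← sq_abs d]; ring
    rw [e1] at hh
    have e2 : 16 * δ * (ν ^ 4 * b ^ 7) * d ^ 2 ≤ 16 * δ * (ν ^ 4 * b ^ 6) * d ^ 2 := by
      have := hc.δ_nonneg
      have : b ^ 7 ≤ b ^ 6 := pow_le_pow_of_le_one hb.le hb1 (by norm_num)
      gcongr
    linarith [(abs_le.1 hh).1]
  have s3 := mul_le_mul_of_nonneg_left hquad (by positivity : 0 ≤ ν ^ 4)
  have s4 := mul_le_mul_of_nonneg_right hc.le_convex (by positivity : 0 ≤ ν ^ 4 * b ^ 6 * d ^ 2)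
  have e1 : d * (nJ - nI) = d * (nJ - nK)
      + ν ^ 4 * (d * (quadD1 P G (I 0) (I 1) (J 2) - quadD1 P G (I 0) (I 1) (I 2)))
      + d * (fK - fI) := by rw [eI, eK]; ring
  rw [e1]
  linarith

/-- The main term is `v 2 ^ 3` times half a value of the third derivative in `t`. The horizontal
part of `v` contributes an error of order `b ^ 6 * (θ * b)`, the correction one of order `δ * b ^
7`; both have the order of the main term, with small factors `θ` and `δ`. -/
lemma taylor (h : SecularModel a A p P' w W T q δ b ν V A₀ A₁ P G f)
    (hc : ModelConstants a A p P' w W q δ Q c B D θ) (hb : 0 < b) (hb1 : b ≤ 1) (hν : 0 < ν)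
    (hν1 : ν ≤ 1) (hI : I ∈ V) (v : ActR) (hv : |v 0| + |v 1| ≤ θ * b * ν)
    (hv2 : 1 / 2 ≤ |v 2|) (hv2' : |v 2| ≤ 1) :
    ∃ Q : ℝ, ∀ s : ℝ, |s| < 1 / 2 → I + s • v ∈ V → ∃ R : ℝ, c * (ν ^ 4 * b ^ 7) ≤ |R| ∧
      |R| ≤ B * (ν ^ 4 * b ^ 7) ∧ reDeriv (ν ^ 4) (secN2 P G + f) (I + s • v) v
        - reDeriv (ν ^ 4) (secN2 P G + f) I v = s * Q + s ^ 2 * R := by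
  have hx0 : 0 < I 0 := hc.w_pos.trans_le (h.le₀ I hI)
  have hx1 := (h.quad I hI _ (h.mem_Ioo I hI)).L₁_pos
  have hW : 0 < W := hx0.trans_le (h.le_W₀ hI)
  have hw := hc.w_pos
  have hP : 0 < P := hc.p_pos.trans_le h.p_le
  have hP' : 0 < P' := hP.trans_le h.le_P
  have hθ := hc.θ_nonneg
  have hθb : θ * b ≤ θ := mul_le_of_le_one_right hθ hb1
  have hmax : max |v 0| |v 1| ≤ θ * b * ν :=
    (max_le (by linarith [abs_nonneg (v 1)]) (by linarith [abs_nonneg (v 0)])).trans hv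
  have hθν : θ * b * ν ≤ θ * ν := by gcongr
  have hmax1 : max |v 0| |v 1| ≤ 1 := by
    have : θ * ν ≤ 1 * 1 := mul_le_mul hc.θ_le hν1 hν.le zero_le_one
    linarith
  have hmaxq : max |v 0| |v 1| ≤ q * ν := by
    have : θ * ν ≤ q * ν := by gcongr; exact hc.θ_le_q
    linarith
  have hM := h.norm_secN2_le hw hb hc.p_pos hI
  rw [toC_eq] at hM
  obtain ⟨Q₁, hQ₁⟩ := exists_quadratic_expansion_secN2 hP (h.quad I hI) (h.mem_Ioo I hI) hM
    (v₀ := v 0) (v₁ := v 1) (v₂ := v 2) ((le_max_left _ _).trans hmax1)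
    ((le_max_right _ _).trans hmax1) hv2'
  obtain ⟨Q₂, hQ₂⟩ := exists_quadratic_expansion (p := toC I) (v := toC v)
    (mul_pos hc.q_pos hν) (h.analytic I hI) (h.bound I hI)
    (by rw [toC_eq, norm_cpt_fst]; exact hmaxq) (by rw [toC_eq, norm_cpt_snd]; exact hv2')
  refine ⟨ν ^ 4 * (Q₁ + Q₂), fun s hs hsV => ?_⟩
  have hts : I 2 + s * v 2 ∈ Set.Ioo 0 T := by simpa using h.mem_Ioo _ hsV
  obtain ⟨R₁, hR1, hR2, hR⟩ := hQ₁ s hs hts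
  have hF := hQ₂ s hs
  rw [← toC_eq, ← toC_eq] at hR
  have hline : toC I + (s : ℂ) • toC v = toC (I + s • v) := by
    rw [map_add, map_smul]
    rfl
  rw [hline] at hF hR
  set m2 := quadBound P' w W with hm2
  have hm : 0 ≤ m2 := quadBound_nonneg hP' hw hW
  have hδ := hc.δ_nonneg
  have hR1' : 27 * p * w ^ 2 / W ^ 7 * b ^ 7 ≤ R₁ := by
    refine le_trans ?_ hR1
    calc _ = 27 * p * w ^ 2 * (b / W) ^ 7 := by field_simp
      _ ≤ 27 * P * I 0 ^ 2 * (1 / I 1) ^ 7 := by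
        refine mul_le_mul ?_ (pow_le_pow_left₀ (by positivity) (h.le_one_div hw hI) 7)
          (by positivity) (by positivity)
        refine mul_le_mul (by linarith [h.p_le])
          (pow_le_pow_left₀ hw.le (h.le₀ I hI) 2) (by positivity) (by positivity)
      _ = _ := by field_simp
  have hR2' : R₁ ≤ 1600 * P' * W ^ 2 / w ^ 7 * b ^ 7 := by
    refine hR2.trans ?_
    calc _ = 1600 * P * I 0 ^ 2 * (1 / I 1) ^ 7 := by field_simp
      _ ≤ 1600 * P' * W ^ 2 * (b / w) ^ 7 := by
        refine mul_le_mul ?_ (pow_le_pow_left₀ (by positivity) (h.one_div_le hw hI) 7)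
          (by positivity) (by positivity)
        refine mul_le_mul (by linarith [h.le_P])
          (pow_le_pow_left₀ hx0.le (h.le_W₀ hI) 2) (by positivity) (by positivity)
      _ = _ := by field_simp
  have hp := hc.p_pos
  have hR0 : 0 ≤ R₁ := le_trans (by positivity) hR1'
  have hcub : |v 2 ^ 3 * (R₁ / 2)| = |v 2| ^ 3 * (R₁ / 2) := by
    rw [abs_mul, abs_pow, abs_of_nonneg (by positivity : 0 ≤ R₁ / 2)]
  have hlo : 27 * p * w ^ 2 / (16 * W ^ 7) * b ^ 7 ≤ |v 2 ^ 3 * (R₁ / 2)| := by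
    rw [hcub]
    calc _ = (1 / 2) ^ 3 * (27 * p * w ^ 2 / W ^ 7 * b ^ 7 / 2) := by field_simp; norm_num
      _ ≤ _ := by gcongr
  have hhi : |v 2 ^ 3 * (R₁ / 2)| ≤ 800 * P' * W ^ 2 / w ^ 7 * b ^ 7 := by
    rw [hcub]
    calc _ ≤ 1 ^ 3 * (1600 * P' * W ^ 2 / w ^ 7 * b ^ 7 / 2) := by gcongr
      _ = _ := by ring
  have herr : 128 * (m2 * b ^ 6) * max |v 0| |v 1| * s ^ 2 + 64 * (δ * b ^ 7) * s ^ 2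
      ≤ (128 * m2 * θ + 64 * δ) * b ^ 7 * s ^ 2 := by
    have : θ * b * ν ≤ θ * b := mul_le_of_le_one_right (by positivity) hν1
    calc _ ≤ 128 * (m2 * b ^ 6) * (θ * b) * s ^ 2 + 64 * (δ * b ^ 7) * s ^ 2 := by
          gcongr; linarith
      _ = _ := by ring
  have hsplit := reDeriv_add (μ := ν ^ 4) (h.analyticAt_secN2 hI) (h.analyticAt hc.q_pos hν hI) v
  have hsplit' := reDeriv_add (μ := ν ^ 4) (h.analyticAt_secN2 hsV)
    (h.analyticAt hc.q_pos hν hsV) v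
  have hcc := hc.le_cubic
  have hBB := hc.cubic_le
  rw [← hm2] at hcc hBB
  have hc2 := mul_le_mul_of_nonneg_right hcc (by positivity : 0 ≤ b ^ 7)
  have hB2 := mul_le_mul_of_nonneg_right hBB (by positivity : 0 ≤ b ^ 7)
  have herr2 : (128 * m2 * θ + 64 * δ) * b ^ 7 ≤ (128 * m2 + 64) * b ^ 7 := by
    have h1 := hc.θ_le
    have h2 := hc.δ_le
    have : 128 * m2 * θ ≤ 128 * m2 := mul_le_of_le_one_right (by positivity) h1
    gcongr; linarith
  obtain ⟨S, hS1, hS2, hS3⟩ : ∃ S, c * b ^ 7 ≤ |S| ∧ |S| ≤ B * b ^ 7 ∧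
      ((fderiv ℂ (secN2 P G) (toC (I + s • v)) (toC v)).re
        + (fderiv ℂ f (toC (I + s • v)) (toC v)).re)
      - ((fderiv ℂ (secN2 P G) (toC I) (toC v)).re + (fderiv ℂ f (toC I) (toC v)).re)
        = s * (Q₁ + Q₂) + s ^ 2 * S := by
    set X := ((fderiv ℂ (secN2 P G) (toC (I + s • v)) (toC v)).re
        + (fderiv ℂ f (toC (I + s • v)) (toC v)).re)
      - ((fderiv ℂ (secN2 P G) (toC I) (toC v)).re + (fderiv ℂ f (toC I) (toC v)).re) with hX
    have hdiff : |X - s * (Q₁ + Q₂) - s ^ 2 * (v 2 ^ 3 * (R₁ / 2))|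
        ≤ (128 * m2 * θ + 64 * δ) * b ^ 7 * s ^ 2 := by
      refine le_trans ?_ ((add_le_add hR hF).trans herr)
      refine le_trans (le_of_eq ?_) (abs_add_le _ _)
      rw [hX]; congr 1; ring
    rcases eq_or_ne s 0 with rfl | hs0
    · refine ⟨v 2 ^ 3 * (R₁ / 2), ?_, ?_, ?_⟩
      · have : 0 ≤ (128 * m2 * θ + 64 * δ) * b ^ 7 := by positivity
        linarith
      · have : 0 ≤ (128 * m2 + 64) * b ^ 7 := by positivity
        linarith
      · have h0 := abs_nonpos_iff.1 (hdiff.trans_eq (by ring))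
        linarith
    · have hs2 : 0 < s ^ 2 := by positivity
      refine ⟨(X - s * (Q₁ + Q₂)) / s ^ 2, ?_, ?_, by field_simp; ring⟩
      all_goals
        have hS : |(X - s * (Q₁ + Q₂)) / s ^ 2 - v 2 ^ 3 * (R₁ / 2)|
            ≤ (128 * m2 * θ + 64 * δ) * b ^ 7 := by
          rw [show (X - s * (Q₁ + Q₂)) / s ^ 2 - v 2 ^ 3 * (R₁ / 2)
            = (X - s * (Q₁ + Q₂) - s ^ 2 * (v 2 ^ 3 * (R₁ / 2))) / s ^ 2 by field_simp, abs_div,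
            abs_of_pos hs2, div_le_iff₀ hs2]
          exact hdiff
      · have := abs_sub_abs_le_abs_sub (v 2 ^ 3 * (R₁ / 2)) ((X - s * (Q₁ + Q₂)) / s ^ 2)
        rw [abs_sub_comm] at this
        linarith
      · have := abs_sub_abs_le_abs_sub ((X - s * (Q₁ + Q₂)) / s ^ 2) (v 2 ^ 3 * (R₁ / 2))
        linarith
  refine ⟨ν ^ 4 * S, ?_, ?_, ?_⟩
  · rw [abs_mul, abs_of_pos (by positivity : 0 < ν ^ 4)]
    calc _ = ν ^ 4 * (c * b ^ 7) := by ring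
      _ ≤ _ := by gcongr
  · rw [abs_mul, abs_of_pos (by positivity : 0 < ν ^ 4)]
    calc _ ≤ ν ^ 4 * (B * b ^ 7) := by gcongr
      _ = _ := by ring
  · rw [hsplit, hsplit']
    simp only [reDeriv_apply]
    linear_combination ν ^ 4 * hS3

theorem steepEstimates (h : SecularModel a A p P' w W T q δ b ν V A₀ A₁ P G f)
    (hc : ModelConstants a A p P' w W q δ Q c B D θ) (hb : 0 < b) (hb1 : b ≤ 1) (hν : 0 < ν)
    (hν1 : ν ≤ 1) (hqν : q * ν ≤ 1) (hBν : B * ν ≤ a / (2 * W ^ 3)) (g : ActR → ActR)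
    (hg : ∀ I ∈ V, ∀ v, inner ℝ (g I) v = A₀ / I 0 ^ 3 * v 0 + A₁ / I 1 ^ 3 * v 1
      + reDeriv (ν ^ 4) (secN2 P G + f) I v) :
    SteepEstimates V g (fun x => A₀ / x ^ 3) (fun x => A₁ / x ^ 3)
      (fun I => (reDeriv (ν ^ 4) (secN2 P G + f) I : ActR →ₗ[ℝ] ℝ)) b ν c B D θ := by
  have ha := hc.a_pos
  have hw := hc.w_pos
  have hA₀ : 0 < A₀ := ha.trans_le h.a_le₀
  have hA₁ : 0 < A₁ := ha.trans_le h.a_le₁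
  have hA : 0 < A := hA₀.trans_le h.le_A₀
  have hWpos : ∀ I ∈ V, 0 < W := fun I hI => hw.trans_le ((h.le₀ I hI).trans (h.le_W₀ hI))
  refine ⟨hg, ?_, ?_, ?_, ?_, ?_, ?_, ?_, ?_⟩
  · intro I hI v hv
    rw [hg I hI v] at hv
    have hW := hWpos I hI
    have hx0 := hw.trans_le (h.le₀ I hI)
    have hx1 := (h.quad I hI _ (h.mem_Ioo I hI)).L₁_pos
    have hB : 0 < B := lt_of_lt_of_le (by positivity) hc.slope_le
    have hn := h.abs_reDeriv_le hw hb hb1 hc.δ_le hc.p_pos hc.q_pos hν hqν hc.one_le_Q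
      hc.one_le_q_mul_Q hc.lip_le hI v
    set N := reDeriv (ν ^ 4) (secN2 P G + f) I v
    set p' := a / (2 * W ^ 3) with hp'
    have hp'0 : 0 < p' := by positivity
    have hlow : 2 * p' ≤ A₀ / I 0 ^ 3 := by
      calc 2 * p' = a / W ^ 3 := by rw [hp']; field_simp
        _ ≤ _ := by
          have := h.a_le₀; have := h.le_W₀ hI
          gcongr
    have hup : A₁ / I 1 ^ 3 ≤ A / w ^ 3 * b ^ 3 := by
      calc A₁ / I 1 ^ 3 = A₁ * (1 / I 1) ^ 3 := by field_simp
        _ ≤ A * (b / w) ^ 3 := by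
          refine mul_le_mul h.le_A₁ ?_ (by positivity) hA.le
          exact pow_le_pow_left₀ (by positivity) (h.one_div_le hw hI) 3
        _ = _ := by field_simp
    have hu1 : 0 ≤ A₁ / I 1 ^ 3 := by positivity
    have hmain : 2 * p' * |v 0| ≤ A / w ^ 3 * b ^ 3 * |v 1| + |N| := by
      calc 2 * p' * |v 0| ≤ A₀ / I 0 ^ 3 * |v 0| := by gcongr
        _ = |A₀ / I 0 ^ 3 * v 0| := by rw [abs_mul, abs_of_pos (by positivity : 0 < A₀ / I 0 ^ 3)]
        _ = |A₁ / I 1 ^ 3 * v 1 + N| := by rw [← abs_neg]; congr 1; linarith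
        _ ≤ |A₁ / I 1 ^ 3 * v 1| + |N| := abs_add_le _ _
        _ = A₁ / I 1 ^ 3 * |v 1| + |N| := by rw [abs_mul, abs_of_nonneg hu1]
        _ ≤ _ := by gcongr
    have e1 : B * (ν ^ 4 * b ^ 6) * ((|v 0| + |v 1|) / ν + |v 2|)
        = B * ν * (ν ^ 2 * b ^ 6) * |v 0| + B * (ν ^ 3 * b ^ 6) * |v 1|
          + B * (ν ^ 4 * b ^ 6) * |v 2| := by field_simp
    -- The secular contribution along `v 0` uses at most half of the inner frequency and is absorbed
    -- on the left.
    have e2 : B * ν * (ν ^ 2 * b ^ 6) * |v 0| ≤ p' * |v 0| := by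
      have : ν ^ 2 * b ^ 6 ≤ 1 := mul_le_one₀ (pow_le_one₀ hν.le hν1) (by positivity)
        (pow_le_one₀ hb.le hb1)
      calc _ ≤ p' * 1 * |v 0| := by gcongr
        _ = _ := by ring
    have e3 : B * (ν ^ 3 * b ^ 6) * |v 1| ≤ B * b ^ 3 * |v 1| := by
      have : ν ^ 3 * b ^ 6 ≤ 1 * b ^ 3 := mul_le_mul (pow_le_one₀ hν.le hν1)
        (pow_le_pow_of_le_one hb.le hb1 (by norm_num)) (by positivity) zero_le_one
      gcongr; linarith
    have e4 := mul_le_mul_of_nonneg_right hc.le_D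
      (by positivity : 0 ≤ b ^ 3 * |v 1| + ν ^ 4 * b ^ 6 * |v 2|)
    have e5 : 0 ≤ A / w ^ 3 * (ν ^ 4 * b ^ 6 * |v 2|) := by positivity
    rw [← hp'] at e4
    refine le_of_mul_le_mul_left ?_ hp'0
    nlinarith
  · intro I hI J hJ
    obtain ⟨k, hk, hk1, hk2⟩ := exists_freq_sub_eq (b := 1) (x := I 0) (y := J 0) (W := W) hA₀
      one_pos hw
      (by rw [one_mul]; exact h.le₀ I hI) (by rw [one_mul]; exact h.le_W₀ hI)
      (by rw [one_mul]; exact h.le₀ J hJ) (by rw [one_mul]; exact h.le_W₀ hJ)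
    have hW := hWpos I hI
    have hk0 : 0 ≤ k := le_trans (by positivity) hk1
    rw [hk, abs_neg, abs_mul, abs_of_nonneg hk0]
    gcongr
    refine hk2.trans (le_trans ?_ hc.slope_le)
    have := h.le_A₀
    rw [one_pow, mul_one]
    gcongr
  · intro I hI J hJ
    obtain ⟨k, hk, hk1, hk2⟩ := exists_freq_sub_eq hA₁ hb hw
      (h.le₁ I hI) (h.le_W₁ I hI) (h.le₁ J hJ) (h.le_W₁ J hJ)
    have hW := hWpos I hI
    have hck : c * b ^ 4 ≤ k := by
      refine le_trans ?_ hk1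
      have h1 := hc.le_slope
      have h2 : a * (3 * w ^ 2 / W ^ 6) ≤ A₁ * (3 * w ^ 2 / W ^ 6) := by
        have := h.a_le₁
        gcongr
      gcongr; linarith
    rw [hk]
    nlinarith [mul_le_mul_of_nonneg_right hck (sq_nonneg (J 1 - I 1))]
  · intro I hI
    obtain ⟨q', hq'⟩ := exists_freq_taylor (b := 1) (x := I 0) (W := W) hA₀ one_pos hw
      (by rw [one_mul]; exact h.le₀ I hI) (by rw [one_mul]; exact h.le_W₀ hI)
    refine ⟨q', fun J hJ => ?_⟩
    have h1 := hq' (J 0) (by rw [one_mul]; exact h.le₀ J hJ) (by rw [one_mul]; exact h.le_W₀ hJ)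
    refine h1.trans ?_
    have hW := hWpos I hI
    rw [one_pow, mul_one]
    gcongr
    refine le_trans ?_ hc.taylor_le
    have := h.le_A₀
    gcongr
  · intro I hI
    obtain ⟨q', hq'⟩ := exists_freq_taylor hA₁ hb hw (h.le₁ I hI) (h.le_W₁ I hI)
    refine ⟨q', fun J hJ => (hq' (J 1) (h.le₁ J hJ) (h.le_W₁ J hJ)).trans ?_⟩
    have hW := hWpos I hI
    gcongr
    refine le_trans ?_ hc.taylor_le
    have := h.le_A₁
    gcongr
  · intro I hI J hJ v
    exact h.abs_reDeriv_sub_le hw hb hb1 hc.δ_le hc.p_pos hc.q_pos hν hqν hc.one_le_Q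
      hc.one_le_q_mul_Q hc.lip_le hI hJ v
  · intro I hI J hJ
    exact h.convex hc hb hb1 hν hqν hI hJ
  · intro I hI v hv hv2 hv2'
    exact h.taylor hc hb hb1 hν hν1 hI v hv hv2 hv2'

end SecularModel

/-! ### Gradient and Hessian bounds, and steepness of the model. -/

lemma abs_apply_le_norm (v : ActR) (i : Fin 3) : |v i| ≤ ‖v‖ := by
  simpa using PiLp.norm_apply_le v i

lemma abs_freq_sub_le {A b w W x y : ℝ} (hA : 0 < A) (hb : 0 < b) (hb1 : b ≤ 1) (hw : 0 < w)
    (hx : w ≤ b * x) (hxW : b * x ≤ W) (hy : w ≤ b * y) (hyW : b * y ≤ W) :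
    |A / y ^ 3 - A / x ^ 3| ≤ A * (3 * W ^ 2 / w ^ 6) * |y - x| := by
  obtain ⟨k, hk, hk1, hk2⟩ := exists_freq_sub_eq hA hb hw hx hxW hy hyW
  have hW : 0 < W := hw.trans_le (hx.trans hxW)
  have hk0 : 0 ≤ k := le_trans (by positivity) hk1
  rw [hk, abs_neg, abs_mul, abs_of_nonneg hk0]
  gcongr
  exact hk2.trans (mul_le_of_le_one_right (by positivity) (pow_le_one₀ hb.le hb1))

namespace SecularModel

variable {a A p P' w W T q δ b ν Q c B D θ A₀ A₁ P G : ℝ} {V : Set ActR} {f : ActC → ℂ}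
  {I : ActR} {H : ActR → ℝ}

/-- The derivative along the inner action suffices: its Kepler part is at least `a / W ^ 3`, and the
perturbation takes away at most half. -/
lemma le_norm_gradient (h : SecularModel a A p P' w W T q δ b ν V A₀ A₁ P G f)
    (hc : ModelConstants a A p P' w W q δ Q c B D θ) (hb : 0 < b) (hb1 : b ≤ 1) (hν : 0 < ν)
    (hν1 : ν ≤ 1) (hqν : q * ν ≤ 1) (hBν : B * ν ≤ a / (2 * W ^ 3)) (hI : I ∈ V)
    (hH : IsModelAt H A₀ A₁ (ν ^ 4) (secN2 P G + f) I) :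
    a / (2 * W ^ 3) ≤ ‖gradient H I‖ := by
  have ha := hc.a_pos
  have hw := hc.w_pos
  have hx0 := hw.trans_le (h.le₀ I hI)
  have hW : 0 < W := hx0.trans_le (h.le_W₀ hI)
  have hA₀ : 0 < A₀ := ha.trans_le h.a_le₀
  have hA : 0 < A := hA₀.trans_le h.le_A₀
  have hB : 0 < B := lt_of_lt_of_le (by positivity) hc.slope_le
  have hn := h.abs_reDeriv_le hw hb hb1 hc.δ_le hc.p_pos hc.q_pos hν hqν hc.one_le_Q
      hc.one_le_q_mul_Q hc.lip_le hI (EuclideanSpace.single 0 1)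
  have hi := hH.inner_gradient (EuclideanSpace.single 0 1)
  set N := reDeriv (ν ^ 4) (secN2 P G + f) I (EuclideanSpace.single 0 1)
  simp only [PiLp.single_apply, Fin.isValue, ↓reduceIte, one_ne_zero, Fin.reduceEq, abs_one,
    abs_zero, add_zero, mul_one, mul_zero] at hn hi
  have e1 : B * (ν ^ 4 * b ^ 6) * (1 / ν) ≤ a / (2 * W ^ 3) := by
    have : ν ^ 2 * b ^ 6 ≤ 1 := mul_le_one₀ (pow_le_one₀ hν.le hν1) (by positivity)
        (pow_le_one₀ hb.le hb1)
    calc _ = B * ν * (ν ^ 2 * b ^ 6) := by field_simp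
      _ ≤ B * ν * 1 := by gcongr
      _ ≤ _ := by linarith
  have hlow : 2 * (a / (2 * W ^ 3)) ≤ A₀ / I 0 ^ 3 := by
    calc _ = a / W ^ 3 := by field_simp
      _ ≤ _ := by
        have := h.a_le₀; have := h.le_W₀ hI
        gcongr
  have hcs := real_inner_le_norm (gradient H I) (EuclideanSpace.single 0 1)
  rw [PiLp.norm_single, norm_one, mul_one] at hcs
  have := (abs_le.1 hn).1
  linarith

/-- The difference of gradients is tested against itself, which gives a Lipschitz bound at `I`. Two
horizontal derivatives cost `ν⁻²`, harmless against `ν ^ 4`; the 9 is the square of the 3 in `hwn`.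
-/
lemma norm_fderiv_gradient_le (h : SecularModel a A p P' w W T q δ b ν V A₀ A₁ P G f)
    (hc : ModelConstants a A p P' w W q δ Q c B D θ) (hb : 0 < b) (hb1 : b ≤ 1) (hν : 0 < ν)
    (hν1 : ν ≤ 1) (hqν : q * ν ≤ 1) (hI : I ∈ V)
    (hH : IsModelAt H A₀ A₁ (ν ^ 4) (secN2 P G + f) I) :
    ‖fderiv ℝ (gradient H) I‖ ≤ 2 * (A * (3 * (2 * W) ^ 2 / (w / 2) ^ 6)) + 9 * B := by
  have ha := hc.a_pos
  have hw := hc.w_pos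
  have hx0 := hw.trans_le (h.le₀ I hI)
  have hW : 0 < W := hx0.trans_le (h.le_W₀ hI)
  have hA₀ : 0 < A₀ := ha.trans_le h.a_le₀
  have hA₁ : 0 < A₁ := ha.trans_le h.a_le₁
  have hA : 0 < A := hA₀.trans_le h.le_A₀
  have hB : 0 < B := lt_of_lt_of_le (by positivity) hc.slope_le
  refine norm_fderiv_le_of_lip' ℝ (by positivity) ?_
  have c0 : Continuous fun J : ActR => J 0 := by fun_prop
  have c1 : Continuous fun J : ActR => b * J 1 := by fun_prop
  have hr : 0 < q * ν := mul_pos hc.q_pos hν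
  have c2 : Continuous fun J : ActR => max |(J - I) 0| |(J - I) 1| / (q * ν) + |(J - I) 2| := by
    fun_prop
  have hl0 := h.le₀ I hI
  have hl1 := h.le₁ I hI
  have hu0 := h.le_W₀ hI
  have hu1 := h.le_W₁ I hI
  -- Here `J` runs over a full neighbourhood of `I`, not over `V`; hence the wider range from `w /
  -- 2` to `2 * W` and the estimate that uses only the polydisc at `I`.
  filter_upwards [hH.eventually,
    c0.continuousAt.eventually (Ioo_mem_nhds (by linarith : w / 2 < I 0) (by linarith : I 0 < 2 * W)),
    c1.continuousAt.eventually
      (Ioo_mem_nhds (by linarith : w / 2 < b * I 1) (by linarith : b * I 1 < 2 * W)),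
    c2.continuousAt.eventually (gt_mem_nhds (by simp : _ < (1 / 2 : ℝ)))] with J hJ k0 k1 k2
  set d := gradient H J - gradient H I with hd
  have hi : inner ℝ d d = (A₀ / J 0 ^ 3 - A₀ / I 0 ^ 3) * d 0 + (A₁ / J 1 ^ 3 - A₁ / I 1 ^ 3) * d 1
      + (reDeriv (ν ^ 4) (secN2 P G + f) J d - reDeriv (ν ^ 4) (secN2 P G + f) I d) := by
    conv_lhs => rw [hd, inner_sub_left]
    rw [hJ.inner_gradient, hH.inner_gradient]
    ring
  have t0 := abs_freq_sub_le (b := 1) (w := w / 2) (W := 2 * W) (x := I 0) (y := J 0) hA₀ one_pos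
    le_rfl (by linarith) (by linarith) (by linarith) (by linarith [k0.1]) (by linarith [k0.2])
  have t1 := abs_freq_sub_le (b := b) (w := w / 2) (W := 2 * W) (x := I 1) (y := J 1) hA₁ hb
    hb1 (by linarith) (by linarith) (by linarith) (by linarith [k1.1]) (by linarith [k1.2])
  rw [← wnorm_toC] at k2
  have t2 : |reDeriv (ν ^ 4) (secN2 P G + f) J d - reDeriv (ν ^ 4) (secN2 P G + f) I d|
      ≤ ν ^ 4 * (16 * ((quadBound P' w W + 1) * b ^ 6) * wnorm (q * ν) (toC d)
        * wnorm (q * ν) (toC (J - I))) := by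
    rw [reDeriv_apply, reDeriv_apply, ← mul_sub, ← Complex.sub_re, abs_mul,
      abs_of_pos (by positivity : 0 < ν ^ 4), map_sub toC J I]
    gcongr
    refine (Complex.abs_re_le_norm _).trans
      (norm_fderiv_apply_sub_le_of_polydisc_of_near hr (h.analyticOnNhd_add hqν hI)
        (h.norm_add_le hw hb hb1 hc.δ_le hc.p_pos hqν hI) ?_ _)
    rw [← map_sub]
    exact k2
  have hQ := hc.one_le_Q
  have hwn : ∀ v : ActR, wnorm (q * ν) (toC v) ≤ Q * (3 * ‖v‖ / ν) := fun v => by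
    refine (wnorm_toC_le hc.q_pos hν hQ hc.one_le_q_mul_Q v).trans ?_
    gcongr
    have h2 : |v 2| ≤ ‖v‖ / ν := (abs_apply_le_norm v 2).trans
      (by rw [le_div_iff₀ hν]; nlinarith [norm_nonneg v])
    have h1 : (|v 0| + |v 1|) / ν ≤ (‖v‖ + ‖v‖) / ν := by
      gcongr <;> exact abs_apply_le_norm v _
    calc _ ≤ (‖v‖ + ‖v‖) / ν + ‖v‖ / ν := add_le_add h1 h2
      _ = _ := by ring
  have hm : 0 ≤ quadBound P' w W :=
    quadBound_nonneg (hc.p_pos.trans_le (h.p_le.trans h.le_P)) hw hW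
  have t3 : ν ^ 4 * (16 * ((quadBound P' w W + 1) * b ^ 6) * wnorm (q * ν) (toC d)
        * wnorm (q * ν) (toC (J - I))) ≤ 9 * B * (‖J - I‖ * ‖d‖) := by
    have w1 := wnorm_nonneg hr (toC d)
    have w2 := wnorm_nonneg hr (toC (J - I))
    calc _ ≤ ν ^ 4 * (16 * ((quadBound P' w W + 1) * b ^ 6) * (Q * (3 * ‖d‖ / ν))
          * (Q * (3 * ‖J - I‖ / ν))) := by
          gcongr
          · exact hwn d
          · exact hwn (J - I)
      _ = 9 * (16 * (quadBound P' w W + 1) * Q ^ 2) * (ν ^ 2 * b ^ 6) * (‖J - I‖ * ‖d‖) := by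
          field_simp; ring
      _ ≤ 9 * B * 1 * (‖J - I‖ * ‖d‖) := by
          have : ν ^ 2 * b ^ 6 ≤ 1 := mul_le_one₀ (pow_le_one₀ hν.le hν1) (by positivity)
            (pow_le_one₀ hb.le hb1)
          have := hc.lip_le
          gcongr
      _ = _ := by ring
  set K := 3 * (2 * W) ^ 2 / (w / 2) ^ 6 with hK
  have hK0 : 0 ≤ K := by positivity
  have term : ∀ A' : ℝ, 0 < A' → A' ≤ A → ∀ x : ℝ, ∀ i : Fin 3, |x| ≤ A' * K * |J i - I i| →
      x * d i ≤ A * K * (‖J - I‖ * ‖d‖) := by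
    intro A' hA' hle x i hx
    have hji := abs_apply_le_norm (J - I) i
    rw [PiLp.sub_apply] at hji
    calc x * d i ≤ |x| * |d i| := by rw [← abs_mul]; exact le_abs_self _
      _ ≤ (A * K * ‖J - I‖) * ‖d‖ := by
        refine mul_le_mul (hx.trans ?_) (abs_apply_le_norm d i) (abs_nonneg _) (by positivity)
        gcongr
      _ = _ := by ring
  have s0 := term A₀ hA₀ h.le_A₀ _ 0 t0
  have s1 := term A₁ hA₁ h.le_A₁ _ 1 t1
  have s2 := (le_abs_self _).trans (t2.trans t3)
  rw [real_inner_self_eq_norm_sq] at hi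
  rcases eq_or_lt_of_le (norm_nonneg d) with h0 | h0
  · rw [← h0]; positivity
  · refine le_of_mul_le_mul_right ?_ h0
    linarith

theorem isSteepOn (h : SecularModel a A p P' w W T q δ b ν V A₀ A₁ P G f)
    (hc : ModelConstants a A p P' w W q δ Q c B D θ) (hb : 0 < b) (hb1 : b ≤ 1) (hν : 0 < ν)
    (hν1 : ν ≤ 1) (hqν : q * ν ≤ 1) (hBν : B * ν ≤ a / (2 * W ^ 3))
    (hH : ∀ I ∈ V, IsModelAt H A₀ A₁ (ν ^ 4) (secN2 P G + f) I) (hW : 0 < W) (hA : 0 < A)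
    (hc0 : 0 < c) (hc1 : c ≤ 1) (hB : 1 ≤ B) (hD : 1 ≤ D)
    (hbc : 100 * (B * D ^ 2) * b ≤ c) (hνc : 100 * (B * D ^ 2) * ν ≤ c)
    (hνθ : (32 * B / c + 1) * ν ≤ θ)
    (hν2 : B * ((16 * B / c) ^ 3 + (D * (16 * B / c + 1)) ^ 3) * ν ≤ c / 2) {s : ℝ} (hs : 0 < s)
    (hsb : s ≤ b) :
    IsSteepOn H V (a / (2 * W ^ 3)) (2 * (A * (3 * (2 * W) ^ 2 / (w / 2) ^ 6)) + 9 * B)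
      (fun _ => ν ^ 4 * b ^ 4 * (c ^ 2 / (256 * B))) (fun _ => s) (fun _ => 5) where
  g_pos := by have := hc.a_pos; positivity
  m_pos := by have := hc.w_pos; positivity
  C_pos := fun _ => by positivity
  δ_pos := fun _ => hs
  one_le_a := fun _ => by norm_num
  smooth := fun I hI => (hH I hI).contDiffAt
  le_grad := fun I hI => h.le_norm_gradient hc hb hb1 hν hν1 hqν hBν hI (hH I hI)
  hess_le := fun I hI => h.norm_fderiv_gradient_le hc hb hb1 hν hν1 hqν hI (hH I hI)
  steep := by
    intro I hI j L hL hLg ξ hξ hξs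
    have hE := h.steepEstimates hc hb hb1 hν hν1 hqν hBν (gradient H)
      (fun I hI v => (hH I hI).inner_gradient v)
    obtain ⟨η, h1, h2, h3⟩ := hE.exists_lt_norm_starProjection hb hν hc0 hc1 hB hD hbc hνc hνθ hν2
      hI j hL hLg hξ (hξs.trans hsb)
    refine ⟨η, h1, h2, fun J hJ hJL hJη => ?_⟩
    have h5 := h3 J hJ hJL hJη
    rwa [show ξ ^ (5 : ℝ) = ξ ^ 5 by exact_mod_cast Real.rpow_natCast ξ 5]

end SecularModel

/-! ### Choice of the constants. -/

lemma eventually_mul_le (K : ℝ) {c : ℝ} (hc : 0 < c) :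
    ∀ᶠ x in nhdsWithin (0 : ℝ) (Set.Ioi 0), K * x ≤ c := by
  have h : Continuous fun x : ℝ => K * x := by fun_prop
  have := (h.tendsto 0).eventually (ge_mem_nhds (by simpa using hc : K * 0 < c))
  exact this.filter_mono nhdsWithin_le_nhds

/-- The order of choice avoids circularity: `δ` and `θ` take at most half of the lower bounds of the
secular derivatives, `c` at most the other half, then `B` dominates all upper bounds and `D` is
fixed last. -/
lemma exists_modelConstants {a A p P' w W q : ℝ} (ha : 0 < a) (hA : 0 < A) (hp : 0 < p)
    (hP' : 0 < P') (hw : 0 < w) (hW : 0 < W) (hq : 0 < q) :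
    ∃ δ Q c B D θ, ModelConstants a A p P' w W q δ Q c B D θ ∧ 0 < δ ∧ 0 < c ∧ c ≤ 1 ∧ 1 ≤ B ∧
      1 ≤ D ∧ 0 < θ := by
  set m2 := quadBound P' w W with hm2
  have hm : 0 ≤ m2 := SecularModel.quadBound_nonneg hP' hw hW
  set Q := max 1 (1 / q)
  have hQ : 1 ≤ Q := le_max_left _ _
  have hqQ : 1 ≤ q * Q := by
    calc 1 = q * (1 / q) := by field_simp
      _ ≤ q * Q := by gcongr; exact le_max_right _ _
  set cq := 3 * p * w ^ 2 / W ^ 6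
  set ct := 27 * p * w ^ 2 / (16 * W ^ 7)
  have hcq : 0 < cq := by positivity
  have hct : 0 < ct := by positivity
  set cs := a * (3 * w ^ 2 / W ^ 6)
  have hcs : 0 < cs := by positivity
  set δ := min 1 (min (cq / 32) (ct / 256))
  have hδ1 : δ ≤ 1 := min_le_left _ _
  have hδ2 : δ ≤ cq / 32 := (min_le_right _ _).trans (min_le_left _ _)
  have hδ3 : δ ≤ ct / 256 := (min_le_right _ _).trans (min_le_right _ _)
  have hδ : 0 < δ := lt_min one_pos (lt_min (by positivity) (by positivity))
  set θ := min (min 1 q) (ct / (512 * (m2 + 1)))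
  have hθ1 : θ ≤ 1 := (min_le_left _ _).trans (min_le_left _ _)
  have hθ2 : θ ≤ q := (min_le_left _ _).trans (min_le_right _ _)
  have hθ : 0 < θ := lt_min (lt_min one_pos hq) (by positivity)
  have hθ3 : 128 * m2 * θ ≤ ct / 4 := by
    calc 128 * m2 * θ ≤ 128 * (m2 + 1) * (ct / (512 * (m2 + 1))) := by
          gcongr
          · linarith
          · exact min_le_right _ _
      _ = ct / 4 := by field_simp; norm_num
  set c := min (min 1 cs) (min (cq / 2) (ct / 2))
  have hc1 : c ≤ 1 := (min_le_left _ _).trans (min_le_left _ _)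
  have hc2 : c ≤ cs := (min_le_left _ _).trans (min_le_right _ _)
  have hc3 : c ≤ cq / 2 := (min_le_right _ _).trans (min_le_left _ _)
  have hc4 : c ≤ ct / 2 := (min_le_right _ _).trans (min_le_right _ _)
  have hc : 0 < c := lt_min (lt_min one_pos hcs) (lt_min (by positivity) (by positivity))
  set B₁ := A * (3 * W ^ 2 / w ^ 6)
  set B₂ := A * (6 * W ^ 2 / w ^ 7)
  set B₃ := 16 * (m2 + 1) * Q ^ 2
  set B₄ := 800 * P' * W ^ 2 / w ^ 7 + 128 * m2 + 64
  have hB₁ : 0 ≤ B₁ := by positivity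
  have hB₂ : 0 ≤ B₂ := by positivity
  have hB₃ : 0 ≤ B₃ := by positivity
  have hB₄ : 0 ≤ B₄ := by positivity
  set B := 1 + B₁ + B₂ + B₃ + B₄
  have hB : 0 ≤ B := by positivity
  set D := 1 + (A / w ^ 3 + B) / (a / (2 * W ^ 3))
  have hD0 : 0 ≤ (A / w ^ 3 + B) / (a / (2 * W ^ 3)) := by positivity
  refine ⟨δ, Q, c, B, D, θ, ⟨ha, hp, hw, hq, hQ, hqQ, hδ.le, hδ1, hθ.le, hθ1, hθ2, ?_, ?_, ?_, ?_,
    hc2, ?_, ?_, ?_⟩, hδ, hc, hc1, ?_, ?_, hθ⟩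
  · change B₁ ≤ 1 + B₁ + B₂ + B₃ + B₄; linarith
  · change B₂ ≤ 1 + B₁ + B₂ + B₃ + B₄; linarith
  · change B₃ ≤ 1 + B₁ + B₂ + B₃ + B₄; linarith
  · change B₄ ≤ 1 + B₁ + B₂ + B₃ + B₄; linarith
  · change c + 16 * δ ≤ cq; linarith
  · change c + (128 * m2 * θ + 64 * δ) ≤ ct; linarith
  · have h0 : 0 < a / (2 * W ^ 3) := by positivity
    change _ ≤ (1 + (A / w ^ 3 + B) / (a / (2 * W ^ 3))) * (a / (2 * W ^ 3))
    rw [add_mul, div_mul_cancel₀ _ h0.ne']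
    linarith
  · change 1 ≤ 1 + B₁ + B₂ + B₃ + B₄; linarith
  · change 1 ≤ 1 + _; linarith

/-! ### The correction -/

/-- The holomorphic extension of the correction `Nstar`. -/
noncomputable def nstarC (d : ℕ) (c : ℕ → (Fin 2 → ℂ) → ℂ) (p : ActC) : ℂ :=
  ∑ k ∈ Finset.range (d + 1), c k p.1 * p.2 ^ k

variable {D : Set (Fin 2 → ℝ)} {r β : ℝ} {d : ℕ} {c : ℕ → (Fin 2 → ℂ) → ℂ}

lemma fst_mem_complexNhd {I : ActR} (hI : ![I 0, I 1] ∈ D) {z : ActC}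
    (hz : z ∈ polydisc (toC I) r) : z.1 ∈ complexNhd D r := by
  refine ⟨_, hI, fun i => ?_⟩
  refine lt_of_le_of_lt ?_ hz.1
  rw [toC_eq]
  have := norm_le_pi_norm (z.1 - (cpt (I 0) (I 1) (I 2)).1) i
  fin_cases i
  · exact this
  · exact this

lemma IsSmallNormalForm.analyticOnNhd (h : IsSmallNormalForm D r β d c) {I : ActR}
    (hI : ![I 0, I 1] ∈ D) : AnalyticOnNhd ℂ (nstarC d c) (polydisc (toC I) r) := by
  intro z hz
  have h1 : ∀ k ∈ Finset.range (d + 1), AnalyticAt ℂ (fun p : ActC => c k p.1 * p.2 ^ k) z := by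
    intro k hk
    have := h.analytic k (Nat.lt_succ_iff.1 (Finset.mem_range.1 hk)) z.1 (fst_mem_complexNhd hI hz)
    exact (AnalyticAt.comp (f := fun p : ActC => p.1) this analyticAt_fst).mul
      (analyticAt_snd.pow k)
  exact Finset.analyticAt_fun_sum _ h1

lemma IsSmallNormalForm.norm_le (h : IsSmallNormalForm D r β d c) {I : ActR}
    (hI : ![I 0, I 1] ∈ D) (hβ : 0 ≤ β) {T : ℝ} (h0 : 0 ≤ I 2) (hT : I 2 ≤ T) :
    ∀ z ∈ polydisc (toC I) r, ‖nstarC d c z‖ ≤ (d + 1) * (T + 1) ^ d * β := by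
  intro z hz
  have hz2 : ‖z.2‖ ≤ T + 1 := by
    have h1 := hz.2.le
    rw [toC_eq, cpt_snd] at h1
    calc ‖z.2‖ = ‖(z.2 - (I 2 : ℂ)) + (I 2 : ℂ)‖ := by rw [sub_add_cancel]
      _ ≤ ‖z.2 - (I 2 : ℂ)‖ + ‖(I 2 : ℂ)‖ := norm_add_le _ _
      _ ≤ T + 1 := by
        rw [Complex.norm_real, Real.norm_eq_abs, abs_of_nonneg h0]; linarith
  calc ‖nstarC d c z‖ ≤ ∑ k ∈ Finset.range (d + 1), β * (T + 1) ^ d := by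
        refine norm_sum_le_of_le _ fun k hk => ?_
        have hk' := Nat.lt_succ_iff.1 (Finset.mem_range.1 hk)
        rw [norm_mul, norm_pow]
        refine mul_le_mul (h.bound k hk' _ (fst_mem_complexNhd hI hz)) ?_ (by positivity) hβ
        exact (pow_le_pow_left₀ (norm_nonneg _) hz2 k).trans
          (pow_le_pow_right₀ (by linarith) hk')
    _ = _ := by simp; ring

lemma nstarC_toC_re (d : ℕ) (c : ℕ → (Fin 2 → ℂ) → ℂ) (I : ActR) :
    (nstarC d c (toC I)).re = Nstar d c ![I 0, I 1] (I 2) := by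
  rw [nstarC, Nstar, Complex.re_sum, toC_eq]
  refine Finset.sum_congr rfl fun k _ => ?_
  have : (cpt (I 0) (I 1) (I 2)).1 = fun i => ((![I 0, I 1] i : ℝ) : ℂ) := by
    ext i; fin_cases i <;> rfl
  rw [this, cpt_snd, ← Complex.ofReal_pow, Complex.re_mul_ofReal]

/-! ### The Hamiltonian as a secular model -/

lemma secN2_toC_re (P G : ℝ) (I : ActR) : (secN2 P G (toC I)).re
    = -(P * ((5 * I 0 ^ 4 - 3 * I 0 ^ 2 * (I 2 - I 1 + G) ^ 2) / (I 1 * (I 1 - I 2)) ^ 3)) := by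
  have : secN2 P G (toC I) = ((-(P * ((5 * I 0 ^ 4 - 3 * I 0 ^ 2 * (I 2 - I 1 + G) ^ 2)
      / (I 1 * (I 1 - I 2)) ^ 3)) : ℝ) : ℂ) := by
    rw [toC_eq, secN2, cpt_fst_zero, cpt_fst_one, cpt_snd]
    push_cast
    rfl
  rw [this, Complex.ofReal_re]

/-- Coefficient of the Keplerian part of the inner planet. -/
noncomputable def coefA₀ (mb : Fin 3 → ℝ) (μ : ℝ) : ℝ := bigMass mb μ 0 ^ 2 * redMass mb μ 0 ^ 3

/-- Coefficient of the Keplerian part of the outer planet, with the monopole term included. -/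
noncomputable def coefA₁ (mb : Fin 3 → ℝ) (μ : ℝ) : ℝ :=
  bigMass mb μ 1 ^ 2 * redMass mb μ 1 ^ 3
    + 2 * μ * (mb 1 * mb 2 * (redMass mb μ 1 ^ 2 * bigMass mb μ 1))

/-- Coefficient of the quadrupole term. -/
noncomputable def coefP (mb : Fin 3 → ℝ) (μ : ℝ) : ℝ :=
  mb 1 * mb 2 * redMass mb μ 1 ^ 6 * bigMass mb μ 1 ^ 3
    / (8 * redMass mb μ 0 ^ 4 * bigMass mb μ 0 ^ 2)

/-- The monopole `-m̄₁ m̄₂ / a₂` is a multiple of `1 / I 1 ^ 2`, so `μ` times it merges with the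
outer Kepler term. -/
lemma H0_eq {mb : Fin 3 → ℝ} (hmb : ∀ i, 0 < mb i) {μ G : ℝ} (hμ : 0 < μ) (ψ : ℝ) (d : ℕ)
    (c : ℕ → (Fin 2 → ℂ) → ℂ) {I : ActR} (h0 : 0 < I 0) (h1 : 0 < I 1) (h2 : 0 < I 2)
    (h3 : I 2 < I 1) (h4 : 0 < I 0 + I 1 - G - I 2) (h5 : I 0 + I 1 - G - I 2 < I 0) :
    H0 mb μ G ψ d c I = -(coefA₀ mb μ / (2 * I 0 ^ 2)) + -(coefA₁ mb μ / (2 * I 1 ^ 2))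
      + μ * ((secN2 (coefP mb μ) G + nstarC d c) (toC I)).re := by
  have hN := Nhat_eq (mb := mb) (μ := μ) (G := G) (ψ := ψ) (Λ := ![I 0, I 1]) (t := I 2) hmb hμ
    (fun i => by fin_cases i <;> simpa) h2.le h3 h4.le h5
  simp only [Matrix.cons_val_zero, Matrix.cons_val_one] at hN
  rw [H0, hN, hKep, Pi.add_apply, Complex.add_re, secN2_toC_re, nstarC_toC_re]
  simp only [Fin.sum_univ_two, Matrix.cons_val_zero, Matrix.cons_val_one]
  rw [coefA₀, coefA₁, coefP]
  field_simp
  ring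

lemma isModelAt_H0 {mb : Fin 3 → ℝ} (hmb : ∀ i, 0 < mb i) {μ G : ℝ} (hμ : 0 < μ) (ψ : ℝ) (d : ℕ)
    (c : ℕ → (Fin 2 → ℂ) → ℂ) {I : ActR} (h0 : 0 < I 0) (h1 : 0 < I 1) (h2 : 0 < I 2)
    (h3 : I 2 < I 1) (h4 : 0 < I 0 + I 1 - G - I 2) (h5 : I 0 + I 1 - G - I 2 < I 0)
    (hf : AnalyticAt ℂ (secN2 (coefP mb μ) G + nstarC d c) (toC I)) :
    IsModelAt (H0 mb μ G ψ d c) (coefA₀ mb μ) (coefA₁ mb μ) μ (secN2 (coefP mb μ) G + nstarC d c)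
      I := by
  refine ⟨?_, h0.ne', h1.ne', hf⟩
  have c0 : Continuous fun J : ActR => J 0 := by fun_prop
  have c1 : Continuous fun J : ActR => J 1 := by fun_prop
  have c2 : Continuous fun J : ActR => J 2 := by fun_prop
  have c4 : Continuous fun J : ActR => J 0 + J 1 - G - J 2 := by fun_prop
  filter_upwards [c0.continuousAt.eventually (lt_mem_nhds h0),
    c1.continuousAt.eventually (lt_mem_nhds h1), c2.continuousAt.eventually (lt_mem_nhds h2),
    c2.continuousAt.eventually_lt c1.continuousAt h3, c4.continuousAt.eventually (lt_mem_nhds h4),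
    c4.continuousAt.eventually_lt c0.continuousAt h5] with J k0 k1 k2 k3 k4 k5
  exact H0_eq hmb hμ ψ d c k0 k1 k2 k3 k4 k5

/-! ### Uniform bounds of the coefficients -/

/-- The square of the action of a circular orbit of unit radius. -/
noncomputable def coefQ (mb : Fin 3 → ℝ) (μ : ℝ) (i : Fin 2) : ℝ :=
  redMass mb μ i ^ 2 * bigMass mb μ i

lemma eventually_half_le_and_le_two_mul {F : ℝ → ℝ} (hF : ContinuousAt F 0) (h0 : 0 < F 0) :
    ∀ᶠ μ in nhdsWithin (0 : ℝ) (Set.Ioi 0), F 0 / 2 ≤ F μ ∧ F μ ≤ 2 * F 0 := by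
  have h := hF.eventually (Ioo_mem_nhds (by linarith : F 0 / 2 < F 0) (by linarith : F 0 < 2 * F 0))
  filter_upwards [h.filter_mono nhdsWithin_le_nhds] with μ hμ
  exact ⟨hμ.1.le, hμ.2.le⟩

variable {mb : Fin 3 → ℝ}

lemma bigMass_pos (hmb : ∀ i, 0 < mb i) {μ : ℝ} (hμ : 0 ≤ μ) (i : Fin 2) : 0 < bigMass mb μ i := by
  have := hmb 0; have := hmb i.succ
  rw [bigMass]; positivity

lemma redMass_pos (hmb : ∀ i, 0 < mb i) {μ : ℝ} (hμ : 0 ≤ μ) (i : Fin 2) : 0 < redMass mb μ i := by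
  have := hmb 0; have := hmb i.succ
  rw [redMass]; positivity

lemma continuousAt_bigMass (i : Fin 2) : ContinuousAt (fun μ => bigMass mb μ i) 0 := by
  unfold bigMass; fun_prop

lemma continuousAt_redMass (hmb : ∀ i, 0 < mb i) (i : Fin 2) :
    ContinuousAt (fun μ => redMass mb μ i) 0 := by
  have : mb 0 + 0 * mb i.succ ≠ 0 := by simpa using (hmb 0).ne'
  unfold redMass; fun_prop (disch := assumption)

lemma coefA₀_pos (hmb : ∀ i, 0 < mb i) {μ : ℝ} (hμ : 0 ≤ μ) : 0 < coefA₀ mb μ := by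
  have := bigMass_pos hmb hμ 0; have := redMass_pos hmb hμ 0
  rw [coefA₀]; positivity

lemma coefA₁_pos (hmb : ∀ i, 0 < mb i) {μ : ℝ} (hμ : 0 ≤ μ) : 0 < coefA₁ mb μ := by
  have := bigMass_pos hmb hμ 1; have := redMass_pos hmb hμ 1; have := hmb 1; have := hmb 2
  rw [coefA₁]; positivity

lemma coefP_pos (hmb : ∀ i, 0 < mb i) {μ : ℝ} (hμ : 0 ≤ μ) : 0 < coefP mb μ := by
  have := bigMass_pos hmb hμ 1; have := redMass_pos hmb hμ 1; have := hmb 1; have := hmb 2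
  have := bigMass_pos hmb hμ 0; have := redMass_pos hmb hμ 0
  rw [coefP]; positivity

lemma coefQ_pos (hmb : ∀ i, 0 < mb i) {μ : ℝ} (hμ : 0 ≤ μ) (i : Fin 2) : 0 < coefQ mb μ i := by
  have := bigMass_pos hmb hμ i; have := redMass_pos hmb hμ i
  rw [coefQ]; positivity

lemma continuousAt_coefA₀ (hmb : ∀ i, 0 < mb i) : ContinuousAt (coefA₀ mb) 0 :=
  ((continuousAt_bigMass 0).pow 2).mul ((continuousAt_redMass hmb 0).pow 3)

lemma continuousAt_coefA₁ (hmb : ∀ i, 0 < mb i) : ContinuousAt (coefA₁ mb) 0 :=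
  (((continuousAt_bigMass 1).pow 2).mul ((continuousAt_redMass hmb 1).pow 3)).add
    ((continuousAt_const.mul continuousAt_id).mul
      (continuousAt_const.mul (((continuousAt_redMass hmb 1).pow 2).mul (continuousAt_bigMass 1))))

lemma continuousAt_coefP (hmb : ∀ i, 0 < mb i) : ContinuousAt (coefP mb) 0 := by
  have h1 := bigMass_pos hmb le_rfl 0
  have h2 := redMass_pos hmb le_rfl 0
  exact ((continuousAt_const.mul ((continuousAt_redMass hmb 1).pow 6)).mul
    ((continuousAt_bigMass 1).pow 3)).div
    ((continuousAt_const.mul ((continuousAt_redMass hmb 0).pow 4)).mul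
      ((continuousAt_bigMass 0).pow 2)) (by positivity)

lemma continuousAt_coefQ (hmb : ∀ i, 0 < mb i) (i : Fin 2) :
    ContinuousAt (fun μ => coefQ mb μ i) 0 :=
  ((continuousAt_redMass hmb i).pow 2).mul (continuousAt_bigMass i)

lemma coefQ_zero (hmb : ∀ i, 0 < mb i) : coefQ mb 0 0 = mb 1 ^ 2 * mb 0 := by
  have := (hmb 0).ne'
  simp only [coefQ, redMass, bigMass, zero_mul, add_zero, Fin.succ_zero_eq_one]
  field_simp

lemma semiAxis_eq (mb : Fin 3 → ℝ) (μ : ℝ) (Λ : Fin 2 → ℝ) (i : Fin 2) :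
    semiAxis mb μ Λ i = Λ i ^ 2 / coefQ mb μ i := by
  rw [semiAxis, coefQ, div_pow, div_div]

lemma le_of_sq_le_sq {x y : ℝ} (h : x ^ 2 ≤ y ^ 2) (hy : 0 ≤ y) : x ≤ y :=
  (abs_le_of_sq_le_sq' h hy).2

/-! ### The domain -/

section Domain

variable {μ am ap ρs ε₀ ε₁ b w W G Mb γs τ K : ℝ} {D : Set (Fin 2 → ℝ)} {I : ActR}

/-- The bounds on `a₁` and `α * a₂` become bounds on the squares of `I 0` and `b * I 1`. For the
inner secular action, `ε₁ ≤ ρs` gives positivity, since `t` is below `ρs ^ 2 / 2`, and `ε₀ ^ 2 / 2 <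
I 0` keeps the inner ellipse nondegenerate. -/
lemma bounds_of_mem_actionDomain (hmb : ∀ i, 0 < mb i) (hμ : 0 < μ) (hρs : 0 < ρs)
    (hρε : ρs < ε₀) (hε₁ : 0 < ε₁) (hε : ε₁ ≤ ρs) (hb : 0 < b) (hW : 0 < W)
    (hwQ : ∀ i, w ^ 2 ≤ am * coefQ mb μ i) (hWQ : ∀ i, ap * coefQ mb μ i ≤ W ^ 2)
    (hε₀ : (ε₀ ^ 2 / 2) ^ 2 < am * coefQ mb μ 0)
    (hD : D ⊆ setAG mb μ am ap ρs ε₀ (b ^ 2) G) (hI : I ∈ actionDomain D ε₁) :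
    w ≤ I 0 ∧ I 0 ≤ W ∧ w ≤ b * I 1 ∧ b * I 1 ≤ W ∧ ∀ t ∈ Set.Ioo 0 ((ε₁ / 8) ^ 2 / 2),
      0 < I 0 + I 1 - G - t ∧ I 0 + I 1 - G - t < I 0 := by
  obtain ⟨hpos, h1, h2, h3, h4, h5⟩ := hD hI.1
  have h0 : 0 < I 0 := hpos 0
  have hI1 : 0 < I 1 := hpos 1
  have hbI : 0 < b * I 1 := mul_pos hb hI1
  rw [semiAxis_eq] at h1 h2 h3
  rw [semiAxis_eq] at h2
  simp only [Matrix.cons_val_zero, Matrix.cons_val_one] at h1 h2 h3 h4 h5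
  have q0 := coefQ_pos hmb hμ.le 0
  have q1 := coefQ_pos hmb hμ.le 1
  have k1 : am * coefQ mb μ 0 < I 0 ^ 2 := (lt_div_iff₀ q0).1 h1
  have k2 : I 0 ^ 2 < ap * coefQ mb μ 0 := (div_lt_iff₀ q0).1 (h2.trans h3)
  have e : b ^ 2 * (I 1 ^ 2 / coefQ mb μ 1) = (b * I 1) ^ 2 / coefQ mb μ 1 := by ring
  rw [e] at h2 h3
  have k3 : am * coefQ mb μ 1 < (b * I 1) ^ 2 := (lt_div_iff₀ q1).1 (h1.trans h2)
  have k4 : (b * I 1) ^ 2 < ap * coefQ mb μ 1 := (div_lt_iff₀ q1).1 h3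
  have k5 := (Real.le_sqrt' hρs).1 h4
  have k6 := (Real.sqrt_lt' (hρs.trans hρε)).1 h5
  have k7 : ε₀ ^ 2 / 2 < I 0 := lt_of_pow_lt_pow_left₀ 2 h0.le (hε₀.trans k1)
  refine ⟨le_of_sq_le_sq ((hwQ 0).trans k1.le) h0.le, le_of_sq_le_sq (k2.le.trans (hWQ 0)) hW.le,
    le_of_sq_le_sq ((hwQ 1).trans k3.le) hbI.le, le_of_sq_le_sq (k4.le.trans (hWQ 1)) hW.le,
    fun t ht => ?_⟩
  have k8 : ε₁ ^ 2 ≤ ρs ^ 2 := pow_le_pow_left₀ hε₁.le hε 2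
  have k9 := ht.1
  have k10 := ht.2
  have k11 : 0 < ε₁ ^ 2 := by positivity
  constructor
  · nlinarith
  · linarith

lemma secularModel_actionDomain (hmb : ∀ i, 0 < mb i) (hμ : 0 < μ) (hρs : 0 < ρs)
    (hρε : ρs < ε₀) (hε₁ : 0 < ε₁) (hε : ε₁ ≤ ρs) (hb : 0 < b) (hw : 0 < w) (hW : 0 < W)
    (hwQ : ∀ i, w ^ 2 ≤ am * coefQ mb μ i) (hWQ : ∀ i, ap * coefQ mb μ i ≤ W ^ 2)
    (hε₀ : (ε₀ ^ 2 / 2) ^ 2 < am * coefQ mb μ 0)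
    (hD : D ⊆ setAG mb μ am ap ρs ε₀ (b ^ 2) G) (hbw : 2 * (32 * W + ρs ^ 2 + 4) * b ≤ w)
    {a A p P' q ν δ β : ℝ} (ha₀ : a ≤ coefA₀ mb μ) (hA₀ : coefA₀ mb μ ≤ A) (ha₁ : a ≤ coefA₁ mb μ)
    (hA₁ : coefA₁ mb μ ≤ A) (hp : p ≤ coefP mb μ) (hP' : coefP mb μ ≤ P') {d : ℕ}
    {c : ℕ → (Fin 2 → ℂ) → ℂ} (hc : IsSmallNormalForm D (q * ν) β d c) (hβ0 : 0 ≤ β)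
    (hβ : (d + 1) * (ρs ^ 2 + 1) ^ d * β ≤ δ * b ^ 7) :
    SecularModel a A p P' w W ((ε₁ / 8) ^ 2 / 2) q δ b ν (actionDomain D ε₁) (coefA₀ mb μ)
      (coefA₁ mb μ) (coefP mb μ) G (nstarC d c) := by
  have hbd := fun I (hI : I ∈ actionDomain D ε₁) => bounds_of_mem_actionDomain hmb hμ hρs hρε
    hε₁ hε hb hW hwQ hWQ hε₀ hD hI
  have hT : (ε₁ / 8) ^ 2 / 2 ≤ ρs ^ 2 := by
    have : ε₁ ^ 2 ≤ ρs ^ 2 := pow_le_pow_left₀ hε₁.le hε 2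
    nlinarith [sq_nonneg ρs]
  refine ⟨ha₀, hA₀, ha₁, hA₁, hp, hP', fun I hI => (hbd I hI).1, fun I hI => (hbd I hI).2.2.1,
    fun I hI => (hbd I hI).2.2.2.1, fun I hI => hI.2, ?_, ?_, fun I hI => hc.analyticOnNhd hI.1, ?_⟩
  · intro I hI t ht
    obtain ⟨h1, h2, h3, h4, h5⟩ := hbd I hI
    obtain ⟨h6, h7⟩ := h5 t ht
    -- The inner angular momentum `t - Λ₁ + G` lies between 0 and `I 0 ≤ W`, so `X = W` is
    -- admissible and `24 * X + 8 * W = 32 * W`.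
    refine ⟨hw.trans_le h1, h2, ht.1, ht.2, abs_le.2 ⟨by linarith, by linarith⟩, ?_⟩
    have h8 : 2 * (32 * W + ρs ^ 2 + 4) ≤ I 1 := by
      refine le_of_mul_le_mul_left ?_ hb
      linarith
    linarith
  · intro I hI J hJ
    exact ⟨!₂[I 0, I 1, J 2], ⟨hI.1, hJ.2⟩, rfl, rfl, rfl⟩
  · intro I hI z hz
    exact (hc.norm_le hI.1 hβ0 hI.2.1.le (hI.2.2.le.trans hT) z hz).trans hβ

lemma isModelAt_H0_of_secularModel (hmb : ∀ i, 0 < mb i) (hμ : 0 < μ)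
    {a A p P' w W T q δ b ν A₀ A₁ : ℝ} {V : Set ActR} {d : ℕ} {c : ℕ → (Fin 2 → ℂ) → ℂ}
    (h : SecularModel a A p P' w W T q δ b ν V A₀ A₁ (coefP mb μ) G (nstarC d c))
    (hq : 0 < q) (hν : 0 < ν) (ψ : ℝ) (hI : I ∈ V)
    (ht : 0 < I 0 + I 1 - G - I 2 ∧ I 0 + I 1 - G - I 2 < I 0) :
    IsModelAt (H0 mb μ G ψ d c) (coefA₀ mb μ) (coefA₁ mb μ) μ (secN2 (coefP mb μ) G + nstarC d c)
      I := by
  have hh := h.quad I hI _ (h.mem_Ioo I hI)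
  have h0 := hh.L₀_pos
  have := hh.X_nonneg; have := hh.t_lt; have := hh.le_L₁; have := hh.t_pos
  exact isModelAt_H0 hmb hμ ψ d c h0 hh.L₁_pos hh.t_pos (by linarith) ht.1 ht.2
    ((h.analyticAt_secN2 hI).add (h.analyticAt hq hν hI))

end Domain

/-! ### Proof of the theorem. -/

lemma exists_forall_of_eventually {φ : ℝ → Prop}
    (h : ∀ᶠ x in nhdsWithin (0 : ℝ) (Set.Ioi 0), φ x) : ∃ ε > 0, ∀ x, 0 < x → x < ε → φ x := by
  obtain ⟨ε, hε, hs⟩ := mem_nhdsGT_iff_exists_Ioo_subset.1 h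
  exact ⟨ε, hε, fun x h0 h1 => hs ⟨h0, h1⟩⟩

end PlanarThreeBody

theorem mainTheorem10 (mb : Fin 3 → ℝ) (hmb : ∀ i, 0 < mb i)
    (am ap : ℝ) (ham : 0 < am) (hap : am < ap)
    (ρs ε₀ : ℝ) (hρs : 0 < ρs) (hρε : ρs < ε₀) (hε₀ : ε₀ ^ 2 / 2 < mb 1 * √(mb 0 * am))
    (Mb s₀ γs Ks Cs τ : ℝ) (hMb : 0 < Mb) (hs₀ : 0 < s₀) (hγs : 0 < γs) (hKs : 0 < Ks)
    (hCs : 0 < Cs) (hτ : 2 < τ) (d : ℕ) :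
    ∃ (g m : ℝ) (C δ a : Fin 2 → ℝ),
      0 < g ∧ 0 < m ∧ (∀ j, 0 < C j) ∧ (∀ j, 0 < δ j) ∧ (∀ j, 1 ≤ a j) ∧
      ∃ αbar > (0 : ℝ), ∃ μbar > (0 : ℝ), ∃ σ > (0 : ℝ),
        ∀ α μ ε₁ : ℝ, 0 < α → α < αbar → 0 < μ → μ < μbar → 0 < ε₁ → ε₁ ≤ ρs →
        ∀ K γ : ℝ, K = PlanarThreeBody.cutoff Ks ε₁ → 6 / s₀ < K →
          γ = PlanarThreeBody.gammaBar γs τ μ K →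
          μ * K ^ (2 * τ + 1) / γ ^ 2 ≤ σ * α ^ (7 / 2 : ℝ) →
        ∀ (G ψ : ℝ) (D : Set (Fin 2 → ℝ)),
          D = PlanarThreeBody.setD (PlanarThreeBody.setAG mb μ am ap ρs ε₀ α G) mb Mb γs τ μ K →
        ∀ c : ℕ → (Fin 2 → ℂ) → ℂ,
          PlanarThreeBody.IsSmallNormalForm D (PlanarThreeBody.rhoBar Mb γs τ μ K / 16)
            (Cs * (μ * K ^ (2 * τ + 1) / γ ^ 2 + α ^ 4)) d c →
          PlanarThreeBody.IsSteepOn (PlanarThreeBody.H0 mb μ G ψ d c)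
            (PlanarThreeBody.actionDomain D ε₁) g m
            (fun j => μ * α ^ 2 * C j) (fun j => min (√α) (ε₁ ^ 2) * δ j) a := by
  obtain ⟨hA₀, hA₁, hP⟩ : 0 < PlanarThreeBody.coefA₀ mb 0 ∧ 0 < PlanarThreeBody.coefA₁ mb 0 ∧
      0 < PlanarThreeBody.coefP mb 0 :=
    ⟨PlanarThreeBody.coefA₀_pos hmb le_rfl, PlanarThreeBody.coefA₁_pos hmb le_rfl,
      PlanarThreeBody.coefP_pos hmb le_rfl⟩
  have hQ := PlanarThreeBody.coefQ_pos hmb (le_refl (0 : ℝ))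
  have hap0 : 0 < ap := ham.trans hap
  -- The factors 2 here and below absorb the dependence on `μ`: for small `μ` each mass coefficient
  -- stays within a factor 2 of its value at `μ = 0`.
  obtain ⟨w, hw, hwQ⟩ : ∃ w : ℝ, 0 < w ∧ ∀ i, w ^ 2 ≤ am * (PlanarThreeBody.coefQ mb 0 i / 2) := by
    refine ⟨min √(am * (PlanarThreeBody.coefQ mb 0 0 / 2))
      √(am * (PlanarThreeBody.coefQ mb 0 1 / 2)), ?_, fun i => ?_⟩
    · have := hQ 0; have := hQ 1
      exact lt_min (Real.sqrt_pos.2 (by positivity)) (Real.sqrt_pos.2 (by positivity))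
    · have := hQ i
      rw [← Real.le_sqrt (by positivity) (by positivity)]
      fin_cases i
      · exact min_le_left _ _
      · exact min_le_right _ _
  obtain ⟨W, hW, hWQ⟩ : ∃ W : ℝ, 0 < W ∧ ∀ i, ap * (2 * PlanarThreeBody.coefQ mb 0 i) ≤ W ^ 2 := by
    refine ⟨max √(ap * (2 * PlanarThreeBody.coefQ mb 0 0))
      √(ap * (2 * PlanarThreeBody.coefQ mb 0 1)), ?_, fun i => ?_⟩
    · have := hQ 0
      exact lt_max_of_lt_left (Real.sqrt_pos.2 (by positivity))
    · rw [← Real.sqrt_le_left (by positivity)]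
      fin_cases i
      · exact le_max_left _ _
      · exact le_max_right _ _
  have hε₀' : (ε₀ ^ 2 / 2) ^ 2 < am * PlanarThreeBody.coefQ mb 0 0 := by
    rw [PlanarThreeBody.coefQ_zero hmb]
    have h1 := pow_lt_pow_left₀ hε₀ (by positivity) two_ne_zero
    rw [mul_pow, Real.sq_sqrt (mul_nonneg (hmb 0).le ham.le)] at h1
    linarith
  set a := min (PlanarThreeBody.coefA₀ mb 0 / 2) (PlanarThreeBody.coefA₁ mb 0 / 2) with ha
  have ha0 : 0 < a := lt_min (by positivity) (by positivity)
  set A := max (2 * PlanarThreeBody.coefA₀ mb 0) (2 * PlanarThreeBody.coefA₁ mb 0) with hA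
  have hA0 : 0 < A := lt_max_of_lt_left (by positivity)
  set p := PlanarThreeBody.coefP mb 0 / 2 with hp
  have hp0 : 0 < p := by positivity
  set P' := 2 * PlanarThreeBody.coefP mb 0 with hP'
  have hP'0 : 0 < P' := by positivity
  -- In the analyticity radius `ρ̄ / 16` the powers of the cut-off cancel, leaving this constant
  -- times the fourth root of `μ`.
  set q := γs / (32 * Mb) with hq
  have hq0 : 0 < q := by positivity
  obtain ⟨δ, Q, c₀, B, D₀, θ, hc, hδ, hc0, hc1, hB, hD₀, hθ⟩ :=
    PlanarThreeBody.exists_modelConstants (a := a) (A := A) (p := p) (P' := P') (w := w) (W := W)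
      (q := q) ha0 hA0 hp0 hP'0 hw hW hq0
  set Kd : ℝ := (d + 1) * (ρs ^ 2 + 1) ^ d * Cs with hKd
  have hKd0 : 0 < Kd := by positivity
  obtain ⟨b₀, hb₀, hbs⟩ := PlanarThreeBody.exists_forall_of_eventually
    (((PlanarThreeBody.eventually_mul_le 1 one_pos).and
      (PlanarThreeBody.eventually_mul_le (100 * (B * D₀ ^ 2)) hc0)).and
      ((PlanarThreeBody.eventually_mul_le (2 * (32 * W + ρs ^ 2 + 4)) hw).and
      (PlanarThreeBody.eventually_mul_le Kd (half_pos hδ))))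
  obtain ⟨ν₀, hν₀, hνs⟩ := PlanarThreeBody.exists_forall_of_eventually
    (((PlanarThreeBody.eventually_mul_le 1 one_pos).and
      (PlanarThreeBody.eventually_mul_le q one_pos)).and
      (((PlanarThreeBody.eventually_mul_le B (by positivity : 0 < a / (2 * W ^ 3))).and
      (PlanarThreeBody.eventually_mul_le (100 * (B * D₀ ^ 2)) hc0)).and
      ((PlanarThreeBody.eventually_mul_le (32 * B / c₀ + 1) hθ).and
      (PlanarThreeBody.eventually_mul_le (B * ((16 * B / c₀) ^ 3 + (D₀ * (16 * B / c₀ + 1)) ^ 3))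
        (half_pos hc0)))))
  have hε₀ev : ∀ᶠ μ in nhdsWithin (0 : ℝ) (Set.Ioi 0),
      (ε₀ ^ 2 / 2) ^ 2 < am * PlanarThreeBody.coefQ mb μ 0 :=
    ((continuousAt_const.mul (PlanarThreeBody.continuousAt_coefQ hmb 0)).eventually
      (lt_mem_nhds hε₀')).filter_mono nhdsWithin_le_nhds
  obtain ⟨μ₀, hμ₀, hμs⟩ := PlanarThreeBody.exists_forall_of_eventually
    (((PlanarThreeBody.eventually_half_le_and_le_two_mul
        (PlanarThreeBody.continuousAt_coefA₀ hmb) hA₀).and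
      (PlanarThreeBody.eventually_half_le_and_le_two_mul
        (PlanarThreeBody.continuousAt_coefA₁ hmb) hA₁)).and
      (((PlanarThreeBody.eventually_half_le_and_le_two_mul
        (PlanarThreeBody.continuousAt_coefP hmb) hP).and hε₀ev).and
      ((PlanarThreeBody.eventually_half_le_and_le_two_mul
        (PlanarThreeBody.continuousAt_coefQ hmb 0) (hQ 0)).and
      (PlanarThreeBody.eventually_half_le_and_le_two_mul
        (PlanarThreeBody.continuousAt_coefQ hmb 1) (hQ 1)))))
  refine ⟨a / (2 * W ^ 3), 2 * (A * (3 * (2 * W) ^ 2 / (w / 2) ^ 6)) + 9 * B,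
    fun _ => c₀ ^ 2 / (256 * B), fun _ => 1, fun _ => 5, by positivity, by positivity,
    fun _ => by positivity, fun _ => one_pos, fun _ => by norm_num, b₀ ^ 2, by positivity,
    min μ₀ (ν₀ ^ 4), lt_min hμ₀ (by positivity), δ / (2 * Kd), by positivity, ?_⟩
  intro α μ ε₁ hα hα' hμ hμ' hε₁ hε K γ hK hKs hγ hκ G ψ D hD c hcs
  obtain ⟨b, hb, hbα⟩ : ∃ b : ℝ, 0 < b ∧ b ^ 2 = α := ⟨√α, Real.sqrt_pos.2 hα, Real.sq_sqrt hα.le⟩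
  obtain ⟨ν, hν, hνμ⟩ : ∃ ν : ℝ, 0 < ν ∧ ν ^ 4 = μ :=
    ⟨μ ^ (1 / 4 : ℝ), by positivity, by
      rw [← Real.rpow_natCast, ← Real.rpow_mul hμ.le]; norm_num⟩
  have hsqrt : √α = b := by rw [← hbα, Real.sqrt_sq hb.le]
  have hroot : μ ^ (1 / 4 : ℝ) = ν := by
    rw [← hνμ, ← Real.rpow_natCast, ← Real.rpow_mul hν.le]; norm_num
  have hα7 : α ^ (7 / 2 : ℝ) = b ^ 7 := by
    rw [← hbα, ← Real.rpow_natCast, ← Real.rpow_mul hb.le, ← Real.rpow_natCast]; norm_num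
  obtain ⟨⟨hb1, hbc⟩, hbw, hbK⟩ := hbs b hb
    (lt_of_pow_lt_pow_left₀ 2 hb₀.le (by rw [hbα]; exact hα'))
  obtain ⟨⟨hν1, hqν⟩, ⟨hBν, hνc⟩, hνθ, hν2⟩ := hνs ν hν
    (lt_of_pow_lt_pow_left₀ 4 hν₀.le (by rw [hνμ]; exact hμ'.trans_le (min_le_right _ _)))
  obtain ⟨⟨mA₀, mA₁⟩, ⟨mP, mε⟩, mQ₀, mQ₁⟩ := hμs μ hμ (hμ'.trans_le (min_le_left _ _))
  rw [one_mul] at hb1 hν1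
  have hK0 : 0 < K := lt_trans (by positivity) hKs
  have hrad : PlanarThreeBody.rhoBar Mb γs τ μ K / 16 = q * ν := by
    have : 0 < K ^ (τ + 1) := Real.rpow_pos_of_pos hK0 _
    rw [PlanarThreeBody.rhoBar, PlanarThreeBody.gammaBar, hroot, hq]
    field_simp
    norm_num
  rw [hrad] at hcs
  rw [hα7] at hκ
  set κ := μ * K ^ (2 * τ + 1) / γ ^ 2 with hκd
  have hκ0 : 0 ≤ κ := by
    have : 0 < K ^ (2 * τ + 1) := Real.rpow_pos_of_pos hK0 _
    positivity
  -- Half of the admissible size `δ * b ^ 7` of the correction is spent on κ, which fixes `σ`, and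
  -- half on `α ^ 4 = b * b ^ 7`, which is small because `b` is.
  have hβ : (d + 1) * (ρs ^ 2 + 1) ^ d * (Cs * (κ + α ^ 4)) ≤ δ * b ^ 7 := by
    have e : α ^ 4 = b * b ^ 7 := by rw [← hbα]; ring
    calc _ = Kd * κ + (Kd * b) * b ^ 7 := by rw [e, hKd]; ring
      _ ≤ Kd * (δ / (2 * Kd) * b ^ 7) + δ / 2 * b ^ 7 := by gcongr
      _ = δ * b ^ 7 := by field_simp; norm_num
  have hwQ' : ∀ i, w ^ 2 ≤ am * PlanarThreeBody.coefQ mb μ i := fun i => by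
    refine (hwQ i).trans (mul_le_mul_of_nonneg_left ?_ ham.le)
    fin_cases i
    · exact mQ₀.1
    · exact mQ₁.1
  have hWQ' : ∀ i, ap * PlanarThreeBody.coefQ mb μ i ≤ W ^ 2 := fun i => by
    refine (mul_le_mul_of_nonneg_left ?_ hap0.le).trans (hWQ i)
    fin_cases i
    · exact mQ₀.2
    · exact mQ₁.2
  have hDs : D ⊆ PlanarThreeBody.setAG mb μ am ap ρs ε₀ (b ^ 2) G := by
    rw [hD, hbα]; exact fun Λ hΛ => hΛ.1
  have hM := PlanarThreeBody.secularModel_actionDomain (a := a) (A := A) (p := p) (P' := P')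
    hmb hμ hρs hρε hε₁ hε hb hw hW hwQ' hWQ' mε hDs hbw ((min_le_left _ _).trans mA₀.1)
    (mA₀.2.trans (le_max_left _ _)) ((min_le_right _ _).trans mA₁.1)
    (mA₁.2.trans (le_max_right _ _)) mP.1 mP.2 hcs (by positivity) hβ
  have hmodel : ∀ I ∈ PlanarThreeBody.actionDomain D ε₁,
      PlanarThreeBody.IsModelAt (PlanarThreeBody.H0 mb μ G ψ d c) (PlanarThreeBody.coefA₀ mb μ)
        (PlanarThreeBody.coefA₁ mb μ) (ν ^ 4)
        (PlanarThreeBody.secN2 (PlanarThreeBody.coefP mb μ) G + PlanarThreeBody.nstarC d c) I := by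
    intro I hI
    rw [hνμ]
    exact PlanarThreeBody.isModelAt_H0_of_secularModel hmb hμ hM hq0 hν ψ hI
      ((PlanarThreeBody.bounds_of_mem_actionDomain hmb hμ hρs hρε hε₁ hε hb hW hwQ' hWQ' mε hDs
        hI).2.2.2.2 _ hI.2)
  -- The estimates hold up to `ξ = b`; the smaller threshold `min b (ε₁ ^ 2)` only restricts `ξ`.
  have hS := hM.isSteepOn hc hb hb1 hν hν1 hqν hBν hmodel hW hA0 hc0 hc1 hB hD₀ hbc hνc hνθ hν2
    (s := min b (ε₁ ^ 2)) (lt_min hb (by positivity)) (min_le_left _ _)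
  have e1 : μ * α ^ 2 = ν ^ 4 * b ^ 4 := by rw [← hbα, hνμ]; ring
  simp only [e1, hsqrt, mul_one]
  exact hS
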